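/- Let $\mathbb K=\mathbb R$ or $\mathbb C$ and let $\alpha,A_1,A_2\in\mathbb K$ be nonzero. Consider the chain $$t_{1x}=t_x+d(t,t_1),\qquad d(t,t_1)=A_1(e^{\alpha t_1}+e^{\alpha t})+A_2(e^{-\alpha t}+e^{-\alpha t_1}),$$ for $t=t(n,x)$, $n\in\mathbb Z$, $t_k=t(n+k,x)$. The quantities $x$, $t_k$ ($k\in\mathbb Z$) and $D_x^mt$ ($m\ge1$) are regarded as independent variables. All functions are analytic, each in finitely many variables, and vector fields are formal series $\sum a_i\partial_i$ with such coefficients. Vector fields are called linearly independent (over functions) if on no nonempty open region they satisfy, after truncation to finitely many directions for every such truncation, a linear relation with analytic coefficients that are not all identically zero. The dimension of the characteristic Lie algebra is understood in this sense. Let $L_x$ be the Lie algebra generated by $X=\partial/\partial t_x$ and $K_0=\partial/\partial x+\sum_k t_{k,x}\,\partial/\partial t_k$, where $t_{k,x}$ is expressed through $t_x$ and the $t_j$ by the chain, and let $\tilde X=\sum_k\partial/\partial t_k$. Put $\tau_j=t_j-t_{j+1}$, $\tau=\tau_0$, $\rho_j=t_j-t$, $$S_0=\sum_j(e^{-\alpha\tau_j}+1)e^{\alpha\rho_j}\frac{\partial}{\partial\tau_j},\qquad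 S_1=\sum_j(e^{\alpha\tau_j}+1)e^{-\alpha\rho_j}\frac{\partial}{\partial\tau_j},$$ and define $P_1=Q_1=[S_0,S_1]+\alpha S_0+\alpha S_1$ and, for $n\ge1$, $P_{2n}=[S_1,P_{2n-1}]$, $P_{2n+1}=[S_0,P_{2n}]+\alpha P_{2n}$, $Q_{2n}=[S_0,Q_{2n-1}]$, $Q_{2n+1}=[S_1,Q_{2n}]-\alpha Q_{2n}$. Let $D$ be the shift $\tau_j\mapsto\tau_{j+1}$ on functions of the $\tau_j$. Then the following hold. 0. Over $\mathbb C$, a substitution $t(n,x)=\kappa\,u(n,lx)+c$ with constants $\kappa,l\ne0$ and $c$ transforms the chain into the semi-discrete sine-Gordon model $u_{1x}=u_x+\sin u+\sin u_1$, and conversely. 1. In the coordinates $x,t,\tau_j,D_x^mt$ one has $K_0=\partial_x+t_x\tilde X-A_1e^{\alpha t}S_0-A_2e^{-\alpha t}S_1$, and $e^{\alpha t}S_0,\ e^{-\alpha t}S_1\in L_x$. On functions of the $\tau_j$: $DS_0D^{-1}=e^{\alpha\tau}S_0$, $DS_1D^{-1}=e^{-\alpha\tau}S_1$, $DP_1D^{-1}=P_1-2\alpha(S_0+S_1)$,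 $DP_2D^{-1}=e^{-\alpha\tau}(P_2+2\alpha P_1-2\alpha^2(S_0+S_1))$, $DQ_2D^{-1}=e^{\alpha\tau}(Q_2-2\alpha P_1+2\alpha^2(S_0+S_1))$, $[S_1,P_2]=-\alpha P_2$, $[S_0,Q_2]=\alpha Q_2$. 2. For all $n\ge1$: $DP_{2n+1}D^{-1}+2\alpha e^{\alpha\tau}DP_{2n}D^{-1}=P_{2n+1}+2\alpha Q_{2n}$; $e^{\alpha\tau}DP_{2n+2}D^{-1}-\alpha DP_{2n+1}D^{-1}=P_{2n+2}+\alpha Q_{2n+1}$; $DQ_{2n+1}D^{-1}-2\alpha e^{-\alpha\tau}DQ_{2n}D^{-1}=Q_{2n+1}-2\alpha P_{2n}$; $e^{-\alpha\tau}DQ_{2n+2}D^{-1}+\alpha DQ_{2n+1}D^{-1}=Q_{2n+2}-\alpha P_{2n+1}$; $P_{2n+1}=Q_{2n+1}$; $[S_1,P_{2n+2}]=-\alpha P_{2n+2}$; $[S_0,Q_{2n+2}]=\alpha Q_{2n+2}$. Moreover, for all $k\ge 1$ the coefficient of $\partial/\partial\tau$ in $DP_kD^{-1}$ and $DQ_kD^{-1}$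 is zero. 3. $e^{-\alpha\tau}DQ_{2n}D^{-1}+e^{\alpha\tau}DP_{2n}D^{-1}=Q_{2n}+P_{2n}$ for $n\ge1$, and there are constants $\mu^{(m)}_k,\nu^{(m)}_k\in\mathbb K$ such that $$DP_{2n+1}D^{-1}=P_{2n+1}+\sum_{k=1}^n(\mu^{(2n+1)}_{2k}P_{2k}+\nu^{(2n+1)}_{2k}Q_{2k})+\sum_{k=0}^{n-1}\mu^{(2n+1)}_{2k+1}P_{2k+1}+\mu^{(2n+1)}_0S_0+\nu^{(2n+1)}_0S_1\quad(n\ge0),$$ and, for $n\ge1$, $DP_{2n}D^{-1}=e^{-\alpha\tau}(P_{2n}+R_n)$ and $DQ_{2n}D^{-1}=e^{\alpha\tau}(Q_{2n}-R_n)$ with $$R_n=\sum_{k=1}^{n-1}(\mu^{(2n)}_{2k}P_{2k}+\nu^{(2n)}_{2k}Q_{2k})+\sum_{k=0}^{n-1}\mu^{(2n)}_{2k+1}P_{2k+1}+\mu^{(2n)}_0S_0+\nu^{(2n)}_0S_1,$$ where $\mu^{(2n+1)}_{2n}=-2\alpha$, $\nu^{(2n+1)}_{2n}=2\alpha$, $\mu^{(2n)}_{2n-1}=2\alpha$.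 4. Let $V_n$ be the $\mathbb K$-linear span of all multiple commutators of $S_0,S_1$ formed with at most $n$ brackets ($S_0,S_1$ themselves included). Then $S_0,S_1,P_1,\dots,P_n,Q_2,Q_4,\dots,Q_{2\lfloor n/2\rfloor}$ is a basis of $V_n$, linearly independent even over functions. In particular $\dim V_n=2+n+\lfloor n/2\rfloor$ grows linearly. 5. The fields $\partial_{t_x},\partial_x,\tilde X,S_0,S_1,P_k\ (k\ge1),Q_{2k}\ (k\ge1)$ (in the coordinates $x,t,\tau_j,D_x^mt$) are linearly independent over functions and have the same span over everywhere defined analytic functions as $L_x$. Hence $L_x$ is infinite-dimensional: it contains arbitrarily many vector fields that are linearly independent over functions (in particular it is infinite-dimensional over $\mathbb K$). 6. The chain has no nontrivial $x$-integral: if $U$ is a nonempty connected open region and $F$ is an analytic function on $U$ of finitely many of the variables $x,t_k,D_x^mt$ with $D_xF=0$ on $U$, then $F$ is constant on $U$. -/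

import Mathlib

open scoped BigOperators

namespace DarbouxChain

noncomputable section

/-! ### Locally analytic functions of finitely many variables -/

/-- `F` is, on the set `U`, an analytic function of finitely many of the variables `p i`, `i : ι`
(the class of locally analytic functions depending on finitely many variables). -/
def IsLocFun {𝕜 : Type*} [RCLike 𝕜] {ι : Type*} (U : Set (ι → 𝕜)) (F : (ι → 𝕜) → 𝕜) : Prop :=
  ∃ (s : Finset ι) (g : (s → 𝕜) → 𝕜),
    AnalyticOnNhd 𝕜 g (s.restrict '' U) ∧ ∀ p ∈ U, F p = g (s.restrict p)

/-- Partial derivative of `F` in the variable `i` at the point `p`. -/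
def pd {𝕜 : Type*} [RCLike 𝕜] {ι : Type*} [DecidableEq ι] (i : ι) (F : (ι → 𝕜) → 𝕜)
    (p : ι → 𝕜) : 𝕜 :=
  deriv (fun h => F (Function.update p i h)) (p i)

theorem isLocFun_univ_iff {𝕜 : Type*} [RCLike 𝕜] {ι : Type*} {F : (ι → 𝕜) → 𝕜} :
    IsLocFun Set.univ F ↔ ∃ (s : Finset ι) (g : (s → 𝕜) → 𝕜),
      AnalyticOnNhd 𝕜 g Set.univ ∧ ∀ p, F p = g (s.restrict p) := by
  classical
  have hs : ∀ s : Finset ι, (s.restrict : (ι → 𝕜) → (s → 𝕜)) '' Set.univ = Set.univ := by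
    intro s
    rw [Set.image_univ, Set.range_eq_univ]
    intro q
    refine ⟨fun i => if h : i ∈ s then q ⟨i, h⟩ else 0, ?_⟩
    funext i
    simp [Finset.restrict]
  constructor
  · rintro ⟨s, g, hg, h⟩
    rw [hs] at hg
    exact ⟨s, g, hg, fun p => h p trivial⟩
  · rintro ⟨s, g, hg, h⟩
    refine ⟨s, g, ?_, fun p _ => h p⟩
    rw [hs]
    exact hg

theorem isLocFun_comp {𝕜 : Type*} [RCLike 𝕜] {ι J : Type*} [Fintype J] (G : (J → 𝕜) → 𝕜)
    (hG : AnalyticOnNhd 𝕜 G Set.univ) (φ : J → (ι → 𝕜) → 𝕜)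
    (hφ : ∀ j, IsLocFun Set.univ (φ j)) :
    IsLocFun Set.univ (fun p => G (fun j => φ j p)) := by
  classical
  simp only [isLocFun_univ_iff] at hφ ⊢
  choose s g hg h using hφ
  have hsub : ∀ j, s j ⊆ Finset.univ.biUnion s := fun j =>
    Finset.subset_biUnion_of_mem s (Finset.mem_univ j)
  refine ⟨Finset.univ.biUnion s,
    fun q => G (fun j => g j (fun i => q ⟨i.1, hsub j i.2⟩)), ?_, ?_⟩
  · intro q _
    refine AnalyticAt.fun_comp (hG _ trivial) (AnalyticAt.pi fun j => ?_)
    refine AnalyticAt.fun_comp (hg j _ trivial) (AnalyticAt.pi fun i => ?_)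
    exact (ContinuousLinearMap.proj (R := 𝕜) (φ := fun _ => 𝕜)
      (⟨i.1, hsub j i.2⟩ : (Finset.univ.biUnion s : Finset ι))).analyticAt q
  · intro p
    simp only [h]
    rfl

theorem analyticAt_coord {𝕜 : Type*} [RCLike 𝕜] {J : Type*} [Fintype J] (j : J) (q : J → 𝕜) :
    AnalyticAt 𝕜 (fun q : J → 𝕜 => q j) q :=
  (ContinuousLinearMap.proj (R := 𝕜) (φ := fun _ : J => 𝕜) j).analyticAt q

theorem isLocFun_coord {𝕜 : Type*} [RCLike 𝕜] {ι : Type*} (i : ι) :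
    IsLocFun Set.univ (fun p : ι → 𝕜 => p i) := by
  rw [isLocFun_univ_iff]
  exact ⟨{i}, fun q => q ⟨i, by simp⟩, fun q _ => analyticAt_coord _ q, fun p => rfl⟩

/-- The algebra of everywhere defined analytic functions, each of finitely many of the variables
indexed by `ι`. -/
def fnAlg (𝕜 : Type*) [RCLike 𝕜] (ι : Type*) : Subalgebra 𝕜 ((ι → 𝕜) → 𝕜) where
  carrier := {F | IsLocFun Set.univ F}
  mul_mem' {F G} hF hG := by
    have := isLocFun_comp (J := Fin 2) (fun q : Fin 2 → 𝕜 => q 0 * q 1)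
      (fun q _ => (analyticAt_coord 0 q).mul (analyticAt_coord 1 q)) ![F, G]
      (by intro j; fin_cases j <;> assumption)
    exact this
  add_mem' {F G} hF hG := by
    have := isLocFun_comp (J := Fin 2) (fun q : Fin 2 → 𝕜 => q 0 + q 1)
      (fun q _ => (analyticAt_coord 0 q).add (analyticAt_coord 1 q)) ![F, G]
      (by intro j; fin_cases j <;> assumption)
    exact this
  algebraMap_mem' c := isLocFun_univ_iff.2 ⟨∅, fun _ => c, analyticOnNhd_const, fun _ => rfl⟩

/-- Everywhere defined analytic functions of finitely many of the variables indexed by `ι`. -/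
abbrev Fn (𝕜 : Type*) [RCLike 𝕜] (ι : Type*) : Type _ := ↥(fnAlg 𝕜 ι)

/-- The `i`-th variable. -/
def coord {𝕜 : Type*} [RCLike 𝕜] {ι : Type*} (i : ι) : Fn 𝕜 ι :=
  ⟨fun p => p i, isLocFun_coord i⟩

/-- The exponential of a function. -/
def expF {𝕜 : Type*} [RCLike 𝕜] {ι : Type*} (f : Fn 𝕜 ι) : Fn 𝕜 ι :=
  ⟨fun p => NormedSpace.exp (f.1 p),
    isLocFun_comp (J := Unit) (fun q => NormedSpace.exp (q ()))
      (fun q _ => AnalyticAt.fun_comp (NormedSpace.exp_analytic (𝕂 := 𝕜) (q ()))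
        (analyticAt_coord () q))
      (fun _ => f.1) (fun _ => f.2)⟩

/-- Substitution of functions `φ i` for the variables. -/
def subst {𝕜 : Type*} [RCLike 𝕜] {ι κ : Type*} (φ : ι → Fn 𝕜 κ) : Fn 𝕜 ι →ₐ[𝕜] Fn 𝕜 κ where
  toFun F := ⟨fun p => F.1 (fun i => (φ i).1 p), by
    obtain ⟨s, g, hg, h⟩ := isLocFun_univ_iff.1 F.2
    have := isLocFun_comp g hg (fun j : s => (φ j).1) (fun j => (φ j).2)
    refine cast ?_ this
    congr 1
    funext p
    exact (h fun i => (φ i).1 p).symm⟩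
  map_one' := rfl
  map_mul' _ _ := rfl
  map_zero' := rfl
  map_add' _ _ := rfl
  commutes' _ := rfl

/-! ### Vector fields -/

/-- Vector fields, as derivations of the algebra of functions. -/
abbrev VF (𝕜 : Type*) [RCLike 𝕜] (ι : Type*) : Type _ := Derivation 𝕜 (Fn 𝕜 ι) (Fn 𝕜 ι)

theorem hasDerivAt_comp_update {𝕜 : Type*} [RCLike 𝕜] {ι : Type*} [DecidableEq ι] (i : ι)
    {F : (ι → 𝕜) → 𝕜} {s : Finset ι} {g : (s → 𝕜) → 𝕜} (hg : AnalyticOnNhd 𝕜 g Set.univ)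
    (h : ∀ p, F p = g (s.restrict p)) (p : ι → 𝕜) :
    HasDerivAt (fun x => F (Function.update p i x))
      (fderiv 𝕜 g (s.restrict p) (s.restrict (Pi.single i (1 : 𝕜) : ι → 𝕜))) (p i) := by
  have h1 : HasDerivAt (fun x => s.restrict (Function.update p i x))
      (s.restrict (Pi.single i (1 : 𝕜) : ι → 𝕜)) (p i) := by
    rw [hasDerivAt_pi]
    intro j
    exact (hasDerivAt_pi.1 (hasDerivAt_update p i (p i))) j.1
  have h2 := (hg (s.restrict (Function.update p i (p i))) trivial).differentiableAt.hasFDerivAt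
  have h3 := h2.comp_hasDerivAt (p i) h1
  rw [Function.update_eq_self] at h3
  refine h3.congr_of_eventuallyEq (Filter.Eventually.of_forall fun x => ?_)
  exact h _

theorem differentiableAt_update {𝕜 : Type*} [RCLike 𝕜] {ι : Type*} [DecidableEq ι] (i : ι)
    (F : Fn 𝕜 ι) (p : ι → 𝕜) :
    DifferentiableAt 𝕜 (fun x => F.1 (Function.update p i x)) (p i) := by
  obtain ⟨s, g, hg, h⟩ := isLocFun_univ_iff.1 F.2
  exact (hasDerivAt_comp_update i hg h p).differentiableAt

theorem pd_mem {𝕜 : Type*} [RCLike 𝕜] {ι : Type*} [DecidableEq ι] (i : ι) (F : Fn 𝕜 ι) :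
    pd i F.1 ∈ fnAlg 𝕜 ι := by
  obtain ⟨s, g, hg, h⟩ := isLocFun_univ_iff.1 F.2
  refine isLocFun_univ_iff.2
    ⟨s, fun q => fderiv 𝕜 g q (s.restrict (Pi.single i (1 : 𝕜) : ι → 𝕜)), ?_, ?_⟩
  · intro q _
    exact ((ContinuousLinearMap.apply 𝕜 𝕜
      (s.restrict (Pi.single i (1 : 𝕜) : ι → 𝕜))).analyticAt _).fun_comp (hg.fderiv q trivial)
  · intro p
    exact (hasDerivAt_comp_update i hg h p).deriv

theorem pd_ne_zero_finite {𝕜 : Type*} [RCLike 𝕜] {ι : Type*} [DecidableEq ι] (F : Fn 𝕜 ι) :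
    {i : ι | pd i F.1 ≠ 0}.Finite := by
  obtain ⟨s, g, hg, h⟩ := isLocFun_univ_iff.1 F.2
  refine s.finite_toSet.subset fun i hi => ?_
  by_contra his
  refine hi (funext fun p => ?_)
  have h0 : s.restrict (Pi.single i (1 : 𝕜) : ι → 𝕜) = 0 := by
    funext j
    have : (j : ι) ≠ i := fun e => his (by rw [← e]; exact j.2)
    simp [Finset.restrict, this]
  have := (hasDerivAt_comp_update i hg h p).deriv
  rw [h0, map_zero] at this
  exact this

/-- The coordinate vector field `∂/∂(variable i)`. -/
def partialVF (𝕜 : Type*) [RCLike 𝕜] {ι : Type*} [DecidableEq ι] (i : ι) : VF 𝕜 ι :=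
  Derivation.mk'
    { toFun := fun F => ⟨pd i F.1, pd_mem i F⟩
      map_add' := fun F G => Subtype.ext <| funext fun p =>
        deriv_add (differentiableAt_update i F p) (differentiableAt_update i G p)
      map_smul' := fun c F => Subtype.ext <| funext fun p =>
        deriv_const_smul c (differentiableAt_update i F p) }
    (fun F G => Subtype.ext <| funext fun p => by
      have := deriv_mul (differentiableAt_update i F p) (differentiableAt_update i G p)
      simp only [Function.update_eq_self] at this
      refine this.trans ?_
      change _ = F.1 p * pd i G.1 p + G.1 p * pd i F.1 p
      simp only [pd]
      ring)

theorem partialVF_support_finite {𝕜 : Type*} [RCLike 𝕜] {ι : Type*} [DecidableEq ι]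
    (a : ι → Fn 𝕜 ι) (F : Fn 𝕜 ι) :
    (Function.support fun i => a i * partialVF 𝕜 i F).Finite := by
  refine (pd_ne_zero_finite F).subset fun i hi h0 => hi ?_
  have : partialVF 𝕜 i F = 0 := Subtype.ext h0
  simp [this]

/-- The (infinite, formal) vector field `∑ i, a i ∂/∂(variable i)`. On each function the sum has
only finitely many nonzero terms. -/
def vectorField {𝕜 : Type*} [RCLike 𝕜] {ι : Type*} [DecidableEq ι] (a : ι → Fn 𝕜 ι) : VF 𝕜 ι :=
  Derivation.mk'
    { toFun := fun F => ∑ᶠ i, a i * partialVF 𝕜 i F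
      map_add' := fun F G => by
        rw [← finsum_add_distrib (partialVF_support_finite a F) (partialVF_support_finite a G)]
        simp only [map_add, mul_add]
      map_smul' := fun c F => by
        rw [RingHom.id_apply, smul_finsum' c (partialVF_support_finite a F)]
        refine finsum_congr fun i => ?_
        rw [Derivation.map_smul, mul_smul_comm] }
    (fun F G => by
      change ∑ᶠ i, a i * partialVF 𝕜 i (F * G) =
        F • (∑ᶠ i, a i * partialVF 𝕜 i G) + G • (∑ᶠ i, a i * partialVF 𝕜 i F)
      rw [smul_finsum' F (partialVF_support_finite a G),
        smul_finsum' G (partialVF_support_finite a F), ← finsum_add_distrib]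
      · refine finsum_congr fun i => ?_
        rw [Derivation.leibniz]
        simp only [smul_eq_mul]
        ring
      · refine (partialVF_support_finite a G).subset fun i hi h0 => hi ?_
        simp only [h0, smul_zero]
      · refine (partialVF_support_finite a F).subset fun i hi h0 => hi ?_
        simp only [h0, smul_zero])

/-- A finite family of vector fields is linearly dependent on the region `U`: for every finite set
`s` of variables, the truncations of the vector fields to the directions in `s` satisfy a linear
relation on `U` whose coefficients are analytic functions on `U`, each of finitely many variables,
which do not all vanish identically. -/
def LinDepOn {𝕜 : Type*} [RCLike 𝕜] {ι : Type*} (U : Set (ι → 𝕜)) {J : Type*} [Fintype J]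
    (Z : J → VF 𝕜 ι) : Prop :=
  ∀ s : Finset ι, ∃ c : J → (ι → 𝕜) → 𝕜,
    (∀ j, IsLocFun U (c j)) ∧ (∃ j, ∃ p ∈ U, c j p ≠ 0) ∧
      ∀ p ∈ U, ∀ i ∈ s, ∑ j, c j p * (Z j (coord i)).1 p = 0

/-- A family of vector fields is linearly independent over functions: no finite subfamily is
linearly dependent on any nonempty open region. -/
def FnIndep {𝕜 : Type*} [RCLike 𝕜] {ι : Type*} {J : Type*} (Z : J → VF 𝕜 ι) : Prop :=
  ∀ (K : Finset J) (U : Set (ι → 𝕜)), IsOpen U → U.Nonempty →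
    ¬ LinDepOn U (fun j : K => Z j)

/-- For `h : ℤ → M`, the sequence with value `0` at `0` and increments `h`:
`h 0 + ⋯ + h (k - 1)` for `k ≥ 0` and `-(h (-1) + ⋯ + h k)` for `k < 0`. -/
def tele {M : Type*} [AddCommGroup M] (h : ℤ → M) : ℤ → M
  | Int.ofNat n => ∑ i ∈ Finset.range n, h i
  | Int.negSucc n => -∑ i ∈ Finset.range (n + 1), h (-((i : ℤ) + 1))

theorem tele_zero {M : Type*} [AddCommGroup M] (h : ℤ → M) : tele h 0 = 0 := by
  change ∑ i ∈ Finset.range 0, h i = 0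
  simp

theorem tele_add_one {M : Type*} [AddCommGroup M] (h : ℤ → M) (k : ℤ) :
    tele h (k + 1) = tele h k + h k := by
  rcases k with n | n
  · change ∑ i ∈ Finset.range (n + 1), h i = ∑ i ∈ Finset.range n, h i + h n
    rw [Finset.sum_range_succ]
  · rcases n with _ | n
    · change ∑ i ∈ Finset.range 0, h i = -∑ i ∈ Finset.range (0 + 1), h (-((i : ℤ) + 1)) + h (-1)
      simp
    · change -∑ i ∈ Finset.range (n + 1), h (-((i : ℤ) + 1)) =
        -∑ i ∈ Finset.range (n + 1 + 1), h (-((i : ℤ) + 1)) + h (-((n + 1 : ℕ) + 1 : ℤ))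
      rw [Finset.sum_range_succ _ (n + 1)]
      abel

/-! ### The chain, its characteristic Lie algebra and its `x`-integrals -/

/-- The independent variables: `x`, the shifts `t k = t(n + k)` (`k ∈ ℤ`, `t 0 = t`), and the
derivatives `dt m = D_x ^ (m + 1) t` (`m ≥ 0`, so that `dt 0 = t_x`). -/
inductive DynVar : Type
  | x : DynVar
  | t (k : ℤ) : DynVar
  | dt (m : ℕ) : DynVar
  deriving DecidableEq

open DynVar

/-- The function `d(t_j, t_{j+1})`, with
`d(u, v) = A₁ (e^{α v} + e^{α u}) + A₂ (e^{-α u} + e^{-α v})`. -/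
def dF {𝕜 : Type*} [RCLike 𝕜] (α A₁ A₂ : 𝕜) (j : ℤ) : Fn 𝕜 DynVar :=
  A₁ • (expF (α • coord (t (j + 1))) + expF (α • coord (t j))) +
    A₂ • (expF (-(α • coord (t j))) + expF (-(α • coord (t (j + 1)))))

/-- The derivative `t_{k,x}` expressed through the independent variables by means of the chain
`t_{1x} = t_x + d(t, t_1)`. -/
def vel {𝕜 : Type*} [RCLike 𝕜] (α A₁ A₂ : 𝕜) (k : ℤ) : Fn 𝕜 DynVar :=
  coord (dt 0) + tele (dF α A₁ A₂) k

theorem vel_zero {𝕜 : Type*} [RCLike 𝕜] (α A₁ A₂ : 𝕜) : vel α A₁ A₂ 0 = coord (dt 0) := by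
  simp [vel, tele_zero]

theorem vel_add_one {𝕜 : Type*} [RCLike 𝕜] (α A₁ A₂ : 𝕜) (k : ℤ) :
    vel α A₁ A₂ (k + 1) = vel α A₁ A₂ k + dF α A₁ A₂ k := by
  simp [vel, tele_add_one, add_assoc]

/-- The vector field `K₀ = ∂/∂x + ∑ k, t_{k,x} ∂/∂t_k`. -/
def K₀ {𝕜 : Type*} [RCLike 𝕜] (α A₁ A₂ : 𝕜) : VF 𝕜 DynVar :=
  vectorField fun
    | x => 1
    | t k => vel α A₁ A₂ k
    | dt _ => 0

/-- The vector field `X = ∂/∂t_x`. -/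
def X (𝕜 : Type*) [RCLike 𝕜] : VF 𝕜 DynVar := partialVF 𝕜 (dt 0)

/-- The vector field `X̃ = ∑ k, ∂/∂t_k`. -/
def Xtilde (𝕜 : Type*) [RCLike 𝕜] : VF 𝕜 DynVar :=
  vectorField fun
    | x => 0
    | t _ => 1
    | dt _ => 0

/-- The characteristic Lie algebra `L_x` of the chain, generated by `K₀` and `X`. -/
def Lx {𝕜 : Type*} [RCLike 𝕜] (α A₁ A₂ : 𝕜) : LieSubalgebra 𝕜 (VF 𝕜 DynVar) :=
  LieSubalgebra.lieSpan 𝕜 (VF 𝕜 DynVar) {K₀ α A₁ A₂, X 𝕜}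

/-- A Lie algebra of vector fields has infinite dimension: it contains arbitrarily large finite
families that are linearly independent over functions. -/
def InfiniteDim {𝕜 : Type*} [RCLike 𝕜] {ι : Type*} (L : LieSubalgebra 𝕜 (VF 𝕜 ι)) : Prop :=
  ∀ m : ℕ, ∃ Z : Fin m → VF 𝕜 ι, (∀ j, Z j ∈ L) ∧ FnIndep Z

/-- The coefficients of the total derivative
`D_x = ∂/∂x + ∑ k, t_{k,x} ∂/∂t_k + ∑ m, (D_x ^ (m + 2) t) ∂/∂(D_x ^ (m + 1) t)`. -/
def DxCoeff {𝕜 : Type*} [RCLike 𝕜] (α A₁ A₂ : 𝕜) : DynVar → Fn 𝕜 DynVar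
  | x => 1
  | t k => vel α A₁ A₂ k
  | dt m => coord (dt (m + 1))

/-- `F` is an `x`-integral of the chain on the region `U`: a locally analytic function of `x` and
finitely many of the variables, with `D_x F = 0` on `U`. -/
def IsXIntegral {𝕜 : Type*} [RCLike 𝕜] (α A₁ A₂ : 𝕜) (U : Set (DynVar → 𝕜))
    (F : (DynVar → 𝕜) → 𝕜) : Prop :=
  IsLocFun U F ∧ ∀ p ∈ U, ∑ᶠ i, (DxCoeff α A₁ A₂ i).1 p * pd i F p = 0

/-- The function `e^{β t}`, `t = t_0`. -/
def eT {𝕜 : Type*} [RCLike 𝕜] (β : 𝕜) : Fn 𝕜 DynVar := expF (β • coord (t 0))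

/-! ### The variables `τ_j = t_j - t_{j+1}` and the vector fields `S₀`, `S₁`, `P_k`, `Q_k` -/

/-- The shift `D` on functions of the variables `τ_j`, `j ∈ ℤ`: `D τ_j = τ_{j+1}`. -/
def shift (𝕜 : Type*) [RCLike 𝕜] : Fn 𝕜 ℤ ≃ₐ[𝕜] Fn 𝕜 ℤ :=
  AlgEquiv.ofAlgHom (subst fun j => coord (j + 1)) (subst fun j => coord (j - 1))
    (by
      refine AlgHom.ext fun F => Subtype.ext (funext fun p => ?_)
      change F.1 (fun i => p (i - 1 + 1)) = F.1 p
      simp)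
    (by
      refine AlgHom.ext fun F => Subtype.ext (funext fun p => ?_)
      change F.1 (fun i => p (i + 1 - 1)) = F.1 p
      simp)

/-- The conjugate `D Z D⁻¹` of a vector field by the shift. -/
def conj {𝕜 : Type*} [RCLike 𝕜] (Z : VF 𝕜 ℤ) : VF 𝕜 ℤ :=
  Derivation.mk'
    ((shift 𝕜).toLinearMap ∘ₗ (Z : Fn 𝕜 ℤ →ₗ[𝕜] Fn 𝕜 ℤ) ∘ₗ (shift 𝕜).symm.toLinearMap)
    (fun F G => by simp [map_add, map_mul])

/-- `ρ_j = t_j - t` as a function of the variables `τ_i`. -/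
def rho {𝕜 : Type*} [RCLike 𝕜] (j : ℤ) : Fn 𝕜 ℤ := -tele coord j

/-- `S₀ = ∑ j, (e^{-α τ_j} + 1) e^{α ρ_j} ∂/∂τ_j`. -/
def S₀ {𝕜 : Type*} [RCLike 𝕜] (α : 𝕜) : VF 𝕜 ℤ :=
  vectorField fun j => (expF (-(α • coord j)) + 1) * expF (α • rho j)

/-- `S₁ = ∑ j, (e^{α τ_j} + 1) e^{-α ρ_j} ∂/∂τ_j`. -/
def S₁ {𝕜 : Type*} [RCLike 𝕜] (α : 𝕜) : VF 𝕜 ℤ :=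
  vectorField fun j => (expF (α • coord j) + 1) * expF (-(α • rho j))

/-- The function `e^{β τ}`, `τ = τ_0`. -/
def eTau {𝕜 : Type*} [RCLike 𝕜] (β : 𝕜) : Fn 𝕜 ℤ := expF (β • coord 0)

/-- The sequence `P_k`, `k ≥ 1` (the value at `0` is not used):
`P_1 = [S₀, S₁] + α S₀ + α S₁`, `P_{2n} = [S₁, P_{2n-1}]`, `P_{2n+1} = [S₀, P_{2n}] + α P_{2n}`. -/
def P {𝕜 : Type*} [RCLike 𝕜] (α : 𝕜) : ℕ → VF 𝕜 ℤ
  | 0 => 0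
  | 1 => ⁅S₀ α, S₁ α⁆ + α • S₀ α + α • S₁ α
  | k + 2 => if Even k then ⁅S₁ α, P α (k + 1)⁆ else ⁅S₀ α, P α (k + 1)⁆ + α • P α (k + 1)

/-- The sequence `Q_k`, `k ≥ 1` (the value at `0` is not used):
`Q_1 = P_1`, `Q_{2n} = [S₀, Q_{2n-1}]`, `Q_{2n+1} = [S₁, Q_{2n}] - α Q_{2n}`. -/
def Q {𝕜 : Type*} [RCLike 𝕜] (α : 𝕜) : ℕ → VF 𝕜 ℤ
  | 0 => 0
  | 1 => P α 1
  | k + 2 => if Even k then ⁅S₀ α, Q α (k + 1)⁆ else ⁅S₁ α, Q α (k + 1)⁆ - α • Q α (k + 1)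

/-- `IsCommutator α m Z`: the vector field `Z` is a multiple commutator of `S₀` and `S₁` of
multiplicity `m`, that is, formed with `m` brackets. -/
inductive IsCommutator {𝕜 : Type*} [RCLike 𝕜] (α : 𝕜) : ℕ → VF 𝕜 ℤ → Prop
  | left : IsCommutator α 0 (S₀ α)
  | right : IsCommutator α 0 (S₁ α)
  | bracket {m n : ℕ} {Y Z : VF 𝕜 ℤ} :
      IsCommutator α m Y → IsCommutator α n Z → IsCommutator α (m + n + 1) ⁅Y, Z⁆

/-- The linear space of all commutators of `S₀` and `S₁` of multiplicity at most `n`. -/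
def V {𝕜 : Type*} [RCLike 𝕜] (α : 𝕜) (n : ℕ) : Submodule 𝕜 (VF 𝕜 ℤ) :=
  Submodule.span 𝕜 {Z | ∃ m ≤ n, IsCommutator α m Z}

/-- The family `S₀, S₁; P_1, …, P_n; Q_2, Q_4, …, Q_{2⌊n/2⌋}`. -/
def basisV {𝕜 : Type*} [RCLike 𝕜] (α : 𝕜) (n : ℕ) : Fin 2 ⊕ Fin n ⊕ Fin (n / 2) → VF 𝕜 ℤ :=
  Sum.elim ![S₀ α, S₁ α]
    (Sum.elim (fun k => P α ((k : ℕ) + 1)) (fun k => Q α (2 * ((k : ℕ) + 1))))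

/-- Functions of the `τ_j` regarded as functions of all variables, through
`τ_j = t_j - t_{j+1}`. -/
def pull {𝕜 : Type*} [RCLike 𝕜] : Fn 𝕜 ℤ →ₐ[𝕜] Fn 𝕜 DynVar :=
  subst fun j => coord (t j) - coord (t (j + 1))

/-- A vector field `∑ j, z_j ∂/∂τ_j` regarded as a vector field in all variables, where `∂/∂τ_j` is
taken in the coordinates `x`, `t`, `τ_j` (`j ∈ ℤ`), `D_x ^ m t` (`m ≥ 1`). Thus it annihilates `x`,
`t = t_0` and `D_x ^ m t`, and its value on `t_k = t - ∑_{0 ≤ j < k} τ_j` (`k ≥ 0`) is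
`- ∑_{0 ≤ j < k} z_j`, similarly for `k < 0`. -/
def lift {𝕜 : Type*} [RCLike 𝕜] (Z : VF 𝕜 ℤ) : VF 𝕜 DynVar :=
  vectorField fun
    | x => 0
    | t k => -tele (fun j => pull (Z (coord j))) k
    | dt _ => 0

/-- The family `∂/∂t_x, ∂/∂x, X̃; S₀, S₁; P_k (k ≥ 1); Q_{2k} (k ≥ 1)` in all variables. -/
def basisLx {𝕜 : Type*} [RCLike 𝕜] (α : 𝕜) : Fin 3 ⊕ Fin 2 ⊕ ℕ ⊕ ℕ → VF 𝕜 DynVar :=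
  Sum.elim ![X 𝕜, partialVF 𝕜 x, Xtilde 𝕜]
    (Sum.elim ![lift (S₀ α), lift (S₁ α)]
      (Sum.elim (fun k => lift (P α (k + 1))) (fun k => lift (Q α (2 * (k + 1))))))

/-! ### Solutions of chains -/

/-- The function `d(v, w) = A₁ (e^{α w} + e^{α v}) + A₂ (e^{-α v} + e^{-α w})`. -/
def dC (α A₁ A₂ : ℂ) (v w : ℂ) : ℂ :=
  A₁ * (Complex.exp (α * w) + Complex.exp (α * v)) +
    A₂ * (Complex.exp (-(α * v)) + Complex.exp (-(α * w)))

/-- `u(n, x)` solves the chain `u_{1x} = u_x + d(u, u_1)` for all `n` and all `x ∈ U`. -/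
def SolvesOn (d : ℂ → ℂ → ℂ) (U : Set ℂ) (u : ℤ → ℂ → ℂ) : Prop :=
  ∀ n : ℤ, ∀ x ∈ U, ∃ p : ℂ, HasDerivAt (u n) p x ∧
    HasDerivAt (u (n + 1)) (p + d (u n x) (u (n + 1) x)) x

end

end DarbouxChain

open DarbouxChain

/-!
The characteristic Lie algebra is analysed in the variables `τ_j = t_j - t_{j+1}`, where everything
follows from the action of the shift `D` on `S₀` and `S₁`.

*Recursions.* With `e = e^{ατ}` the shift conjugation multiplies `S₀` by `e` and `S₁` by `e⁻¹`.
These two relations, the values of `S₀`, `S₁` on `e^{±1}`, and one uniqueness principle suffice: a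
field without `∂/∂τ_{-1}` that the shift multiplies by a nonzero function is zero, because its
coefficients vanish one after the other (`eq_zero_of_conj`). They are collected in the structure
`ShiftSystem`. Brackets with `S₀` and `S₁` carry the two relations for the conjugates of
`[S₁, P_{2n-1}]` and `[S₀, P_{2n-1}]` over to `P_{2n+1}` (`ShiftSystem.Good.step`), and the
symmetry `α ↦ -α` exchanges `S₀` with `S₁` and halves the work (`ShiftSystem.mirror`). Solving the
recursions gives a triangular matrix with constant entries (`ShiftSystem.exists_triangular`). The
brackets of `S₀` and `S₁` with the fields `P_k`, `Q_{2k}` are read off from the definitions, and the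
Jacobi identity yields the spanning sets of the spaces `V_n` (`ShiftSystem.triSpan_eq`).

*Linear independence.* In a shortest linear relation over functions, the quotients `a` of the
coefficients satisfy equations `D a = e^{γτ} (a + β)` by the triangular form. Such an equation has
only the trivial solution, since `a` depends on finitely many variables (`shift_ratio`). Independence
over the domain of everywhere defined analytic functions is witnessed by finitely many coefficients
(`exists_left_inverse`), and by the identity theorem the same witness excludes relations with
analytic coefficients on any region (`fnIndep_of_linearIndependent`).

*The algebra `L_x`.* The field `X̃` equals `[X, K₀]`, and the components `e^{αt} S₀`, `e^{-αt} S₁` of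
`K₀` are eigenvectors of the bracket with `X̃`, so they lie in `L_x` (`eigenvector_mem`). Hence every
commutator of `S₀` and `S₁` lies in `L_x` up to an exponential of `t`, and `L_x` has the same span
over functions as `∂_{t_x}`, `∂_x`, `X̃`, `S₀`, `S₁`, `P_k`, `Q_{2k}` (`span_basisLx`). Infinite
dimension follows by passing to the field of fractions (`exists_linearIndependent_of_span`).

*Integrals.* The formal fields annihilating a function on a region form a Lie algebra closed under
multiplication by functions (`lie_mem_annihilator`). For an `x`-integral it contains `D_x`, hence
all `∂/∂(D_x ^ m t)`, hence `L_x`. Not only the fields `S₀, S₁, P_k, Q_{2k}` but also the rows of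
their coefficients are independent (`linearIndependent_rows`): a relation between `L + 1`
consecutive rows could be moved to all places by the shift, so that `L` of the components would
determine a field, contrary to the independence of `L + 1` of them. So a combination of the fields is
a multiple of `∂/∂τ_i` in any finite window (`exists_smul_lift_partialVF_mem`), and all partial
derivatives of the integral vanish.
-/

namespace DarbouxChain

set_option linter.unusedSectionVars false

/-! ### Calculus of locally analytic functions of finitely many variables -/

section Local

variable {𝕜 : Type*} [RCLike 𝕜] {ι : Type*}

theorem isOpen_image_restrict (s : Finset ι) {U : Set (ι → 𝕜)} (hU : IsOpen U) :
    IsOpen ((s.restrict : (ι → 𝕜) → (s → 𝕜)) '' U) := by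
  classical
  rw [isOpen_iff_mem_nhds]
  rintro _ ⟨p, hp, rfl⟩
  let ext : (s → 𝕜) → (ι → 𝕜) := fun q i => if h : i ∈ s then q ⟨i, h⟩ else p i
  have hext : Continuous ext := by
    refine continuous_pi fun i => ?_
    by_cases h : i ∈ s
    · simpa [ext, h] using continuous_apply _
    · simpa [ext, h] using continuous_const
  have h1 : ext (s.restrict p) = p := by
    funext i
    by_cases h : i ∈ s <;> simp [ext, h, Finset.restrict]
  have h2 : ext ⁻¹' U ∈ nhds (s.restrict p) :=
    hext.continuousAt.preimage_mem_nhds (by rw [h1]; exact hU.mem_nhds hp)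
  refine Filter.mem_of_superset h2 fun q hq => ⟨ext q, hq, ?_⟩
  funext i
  simp [ext, Finset.restrict]

theorem IsLocFun.continuousOn {U : Set (ι → 𝕜)} {F : (ι → 𝕜) → 𝕜} (hF : IsLocFun U F) :
    ContinuousOn F U := by
  obtain ⟨s, g, hg, h⟩ := hF
  have hr : Continuous (s.restrict : (ι → 𝕜) → (s → 𝕜)) :=
    continuous_pi fun i => continuous_apply _
  have : ContinuousOn (fun p => g (s.restrict p)) U :=
    hg.continuousOn.comp hr.continuousOn (Set.mapsTo_image _ _)
  exact this.congr h

theorem Fn.continuous (F : Fn 𝕜 ι) : Continuous F.1 :=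
  continuousOn_univ.1 F.2.continuousOn

/-- Identity theorem: a nonzero function does not vanish identically on a nonempty open set. -/
theorem Fn.exists_ne_zero {F : Fn 𝕜 ι} (hF : F ≠ 0) {U : Set (ι → 𝕜)} (hU : IsOpen U)
    (hne : U.Nonempty) : ∃ p ∈ U, F.1 p ≠ 0 := by
  obtain ⟨s, g, hg, h⟩ := isLocFun_univ_iff.1 F.2
  by_contra! hz
  obtain ⟨p, hp⟩ := hne
  apply hF
  have h0 : g =ᶠ[nhds (s.restrict p)] 0 := by
    filter_upwards [(isOpen_image_restrict s hU).mem_nhds ⟨p, hp, rfl⟩]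
    rintro _ ⟨q, hq, rfl⟩
    rw [← h]
    exact hz q hq
  have := hg.eqOn_zero_of_preconnected_of_eventuallyEq_zero isPreconnected_univ trivial h0
  refine Subtype.ext (funext fun q => ?_)
  rw [h]
  exact this trivial

/-- A function that is continuous on the open set `U` and annihilated there by a nonzero `d`
vanishes on `U`. -/
theorem Fn.eq_zero_of_mul_eq_zero {d : Fn 𝕜 ι} (hd : d ≠ 0) {U : Set (ι → 𝕜)} (hU : IsOpen U)
    {F : (ι → 𝕜) → 𝕜} (hF : ContinuousOn F U) (h : ∀ p ∈ U, d.1 p * F p = 0) :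
    ∀ p ∈ U, F p = 0 := by
  by_contra! hne
  obtain ⟨p, hp, hFp⟩ := hne
  have hV : IsOpen (U ∩ F ⁻¹' {0}ᶜ) := hF.isOpen_inter_preimage hU isOpen_compl_singleton
  obtain ⟨q, ⟨hqU, hq⟩, hdq⟩ := Fn.exists_ne_zero hd hV ⟨p, hp, hFp⟩
  exact (mul_ne_zero hdq hq) (h q hqU)

instance : Nontrivial (Fn 𝕜 ι) :=
  ⟨0, 1, fun h => zero_ne_one (congrFun (congrArg Subtype.val h) (0 : ι → 𝕜))⟩

instance : NoZeroDivisors (Fn 𝕜 ι) where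
  eq_zero_or_eq_zero_of_mul_eq_zero {F G} h := by
    by_cases hF : F = 0
    · exact Or.inl hF
    · refine Or.inr (Subtype.ext (funext fun p => ?_))
      exact Fn.eq_zero_of_mul_eq_zero hF isOpen_univ (Fn.continuous G).continuousOn
        (fun q _ => congrFun (congrArg Subtype.val h) q) p trivial

instance : IsDomain (Fn 𝕜 ι) := NoZeroDivisors.to_isDomain _

variable [DecidableEq ι]

theorem eventually_update_mem {U : Set (ι → 𝕜)} (hU : IsOpen U) {p : ι → 𝕜} (hp : p ∈ U)
    (i : ι) : ∀ᶠ x in nhds (p i), Function.update p i x ∈ U := by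
  have hc : Continuous fun x => Function.update p i x :=
    continuous_const.update i continuous_id
  exact hc.continuousAt.preimage_mem_nhds
    (by rw [Function.update_eq_self]; exact hU.mem_nhds hp)

theorem hasDerivAt_update_of_isOpen {U : Set (ι → 𝕜)} (hU : IsOpen U) (i : ι)
    {F : (ι → 𝕜) → 𝕜} {s : Finset ι} {g : (s → 𝕜) → 𝕜}
    (hg : AnalyticOnNhd 𝕜 g (s.restrict '' U))
    (h : ∀ p ∈ U, F p = g (s.restrict p)) {p : ι → 𝕜} (hp : p ∈ U) :
    HasDerivAt (fun x => F (Function.update p i x))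
      (fderiv 𝕜 g (s.restrict p) (s.restrict (Pi.single i (1 : 𝕜) : ι → 𝕜))) (p i) := by
  have h1 : HasDerivAt (fun x => s.restrict (Function.update p i x))
      (s.restrict (Pi.single i (1 : 𝕜) : ι → 𝕜)) (p i) := by
    rw [hasDerivAt_pi]
    intro j
    exact (hasDerivAt_pi.1 (hasDerivAt_update p i (p i))) j.1
  have hq : s.restrict (Function.update p i (p i)) ∈ s.restrict '' U := by
    rw [Function.update_eq_self]; exact ⟨p, hp, rfl⟩
  have h2 := (hg _ hq).differentiableAt.hasFDerivAt
  have h3 := h2.comp_hasDerivAt (p i) h1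
  rw [Function.update_eq_self] at h3
  refine h3.congr_of_eventuallyEq ?_
  filter_upwards [eventually_update_mem hU hp i] with x hx
  exact h _ hx

theorem IsLocFun.differentiableAt {U : Set (ι → 𝕜)} (hU : IsOpen U) {F : (ι → 𝕜) → 𝕜}
    (hF : IsLocFun U F) (i : ι) {p : ι → 𝕜} (hp : p ∈ U) :
    DifferentiableAt 𝕜 (fun x => F (Function.update p i x)) (p i) := by
  obtain ⟨s, g, hg, h⟩ := hF
  exact (hasDerivAt_update_of_isOpen hU i hg h hp).differentiableAt

theorem IsLocFun.pd {U : Set (ι → 𝕜)} (hU : IsOpen U) {F : (ι → 𝕜) → 𝕜}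
    (hF : IsLocFun U F) (i : ι) : IsLocFun U (pd i F) := by
  obtain ⟨s, g, hg, h⟩ := hF
  refine ⟨s, fun q => fderiv 𝕜 g q (s.restrict (Pi.single i (1 : 𝕜) : ι → 𝕜)), ?_, ?_⟩
  · intro q hq
    exact ((ContinuousLinearMap.apply 𝕜 𝕜
      (s.restrict (Pi.single i (1 : 𝕜) : ι → 𝕜))).analyticAt _).fun_comp (hg.fderiv q hq)
  · intro p hp
    exact (hasDerivAt_update_of_isOpen hU i hg h hp).deriv

theorem IsLocFun.exists_support {U : Set (ι → 𝕜)} (hU : IsOpen U) {F : (ι → 𝕜) → 𝕜}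
    (hF : IsLocFun U F) : ∃ s : Finset ι, ∀ i, i ∉ s → ∀ p ∈ U, DarbouxChain.pd i F p = 0 := by
  obtain ⟨s, g, hg, h⟩ := hF
  refine ⟨s, fun i hi p hp => ?_⟩
  have h0 : s.restrict (Pi.single i (1 : 𝕜) : ι → 𝕜) = 0 := by
    funext j
    have : (j : ι) ≠ i := fun e => hi (by rw [← e]; exact j.2)
    simp [Finset.restrict, this]
  have := (hasDerivAt_update_of_isOpen hU i hg h hp).deriv
  rw [h0, map_zero] at this
  exact this

theorem IsLocFun.pd_comm {U : Set (ι → 𝕜)} (hU : IsOpen U) {F : (ι → 𝕜) → 𝕜}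
    (hF : IsLocFun U F) (i j : ι) {p : ι → 𝕜} (hp : p ∈ U) :
    DarbouxChain.pd i (DarbouxChain.pd j F) p = DarbouxChain.pd j (DarbouxChain.pd i F) p := by
  obtain ⟨s, g, hg, h⟩ := hF
  have key : ∀ i j : ι, DarbouxChain.pd i (DarbouxChain.pd j F) p =
      fderiv 𝕜 (fderiv 𝕜 g) (s.restrict p) (s.restrict (Pi.single i (1 : 𝕜) : ι → 𝕜))
        (s.restrict (Pi.single j (1 : 𝕜) : ι → 𝕜)) := by
    intro i j
    have hg' : AnalyticOnNhd 𝕜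
        (fun q => fderiv 𝕜 g q (s.restrict (Pi.single j (1 : 𝕜) : ι → 𝕜)))
        (s.restrict '' U) := fun q hq =>
      ((ContinuousLinearMap.apply 𝕜 𝕜
        (s.restrict (Pi.single j (1 : 𝕜) : ι → 𝕜))).analyticAt _).fun_comp (hg.fderiv q hq)
    have h1 := (hasDerivAt_update_of_isOpen hU i (F := DarbouxChain.pd j F) hg'
      (fun q hq => (hasDerivAt_update_of_isOpen hU j hg h hq).deriv) hp).deriv
    refine h1.trans ?_
    have hd : DifferentiableAt 𝕜 (fderiv 𝕜 g) (s.restrict p) :=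
      (hg.fderiv _ ⟨p, hp, rfl⟩).differentiableAt
    rw [fderiv_clm_apply hd (differentiableAt_const _)]
    simp
  rw [key i j, key j i]
  exact ((hg _ ⟨p, hp, rfl⟩).contDiffAt (n := minSmoothness 𝕜 2)).isSymmSndFDerivAt le_rfl _ _

/-- An analytic function on a connected open set all of whose partial derivatives vanish is
constant. -/
theorem IsLocFun.eq_const {U : Set (ι → 𝕜)} (hU : IsOpen U) (hc : IsConnected U)
    {F : (ι → 𝕜) → 𝕜} (hF : IsLocFun U F)
    (h0 : ∀ i, ∀ p ∈ U, DarbouxChain.pd i F p = 0) : ∃ c : 𝕜, ∀ p ∈ U, F p = c := by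
  obtain ⟨s, g, hg, h⟩ := hF
  obtain ⟨p₀, hp₀⟩ := hc.nonempty
  have hr : Continuous (s.restrict : (ι → 𝕜) → (s → 𝕜)) :=
    continuous_pi fun i => continuous_apply _
  refine ⟨F p₀, fun p hp => ?_⟩
  rw [h p hp, h p₀ hp₀]
  refine (isOpen_image_restrict s hU).is_const_of_fderiv_eq_zero (𝕜 := 𝕜)
    (hc.isPreconnected.image _ hr.continuousOn) hg.differentiableOn ?_ ⟨p, hp, rfl⟩ ⟨p₀, hp₀, rfl⟩
  rintro _ ⟨q, hq, rfl⟩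
  refine ContinuousLinearMap.coe_injective (LinearMap.pi_ext' fun i => LinearMap.ext_ring ?_)
  have h1 := (hasDerivAt_update_of_isOpen hU (i : ι) hg h hq).deriv
  have h2 : s.restrict (Pi.single (i : ι) (1 : 𝕜) : ι → 𝕜) = Pi.single i 1 := by
    funext j
    by_cases hj : j = i
    · subst hj; simp [Finset.restrict]
    · have : (j : ι) ≠ i := fun e => hj (Subtype.ext e)
      simp [Finset.restrict, hj, this]
  rw [h2] at h1
  have h3 := h0 i q hq
  simp only [DarbouxChain.pd] at h3
  simpa [h3] using h1.symm

end Local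

/-! ### Formal vector fields -/

section Formal

variable {𝕜 : Type*} [RCLike 𝕜] {ι : Type*}

@[ext]
theorem Fn.ext {F G : Fn 𝕜 ι} (h : ∀ p, F.1 p = G.1 p) : F = G := Subtype.ext (funext h)

theorem expF_add (f g : Fn 𝕜 ι) : expF (f + g) = expF f * expF g :=
  Fn.ext fun _ => NormedSpace.exp_add

@[simp] theorem expF_zero : expF (0 : Fn 𝕜 ι) = 1 := Fn.ext fun _ => NormedSpace.exp_zero

theorem expF_mul_neg (f : Fn 𝕜 ι) : expF f * expF (-f) = 1 := by
  rw [← expF_add, add_neg_cancel, expF_zero]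

theorem expF_ne_zero (f : Fn 𝕜 ι) : expF f ≠ 0 := left_ne_zero_of_mul_eq_one (expF_mul_neg f)

theorem expF_add_one_ne_zero [Nonempty ι] (c : 𝕜) (i : ι) :
    expF (c • coord i : Fn 𝕜 ι) + 1 ≠ 0 := by
  intro h
  have := congrFun (congrArg Subtype.val h) (0 : ι → 𝕜)
  change NormedSpace.exp (c • (0 : 𝕜)) + 1 = 0 at this
  rw [smul_zero, NormedSpace.exp_zero] at this
  norm_num at this

variable [DecidableEq ι]

@[simp] theorem partialVF_apply (i : ι) (F : Fn 𝕜 ι) (p : ι → 𝕜) :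
    (partialVF 𝕜 i F).1 p = pd i F.1 p := rfl

theorem partialVF_coord (i j : ι) :
    partialVF 𝕜 i (coord j) = if i = j then 1 else 0 := by
  refine Fn.ext fun p => ?_
  change deriv (fun h => Function.update p i h j) (p i) = _
  by_cases h : i = j
  · subst h
    simp only [Function.update_self, if_true]
    exact deriv_id _
  · simp only [Function.update_of_ne (Ne.symm h), deriv_const, if_neg h]
    rfl

theorem partialVF_expF (i : ι) (f : Fn 𝕜 ι) :
    partialVF 𝕜 i (expF f) = partialVF 𝕜 i f * expF f := by
  refine Fn.ext fun p => ?_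
  have h1 := (differentiableAt_update i f p).hasDerivAt
  have h2 : HasDerivAt NormedSpace.exp (NormedSpace.exp (f.1 p)) (f.1 p) := hasDerivAt_exp
  rw [← Function.update_eq_self i p] at h2
  have := (h2.comp (p i) h1).deriv
  rw [Function.update_eq_self] at this
  exact this.trans (mul_comm _ _)

theorem partialVF_comm (i j : ι) (F : Fn 𝕜 ι) :
    partialVF 𝕜 i (partialVF 𝕜 j F) = partialVF 𝕜 j (partialVF 𝕜 i F) :=
  Fn.ext fun _ => F.2.pd_comm isOpen_univ i j trivial

theorem Fn.exists_support (F : Fn 𝕜 ι) :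
    ∃ s : Finset ι, ∀ i, i ∉ s → partialVF 𝕜 i F = 0 := by
  refine ⟨(pd_ne_zero_finite F).toFinset, fun i hi => Subtype.ext ?_⟩
  rw [Set.Finite.mem_toFinset, Set.mem_ofPred_eq, not_not] at hi
  exact hi

theorem vectorField_apply (a : ι → Fn 𝕜 ι) {F : Fn 𝕜 ι} {s : Finset ι}
    (hs : ∀ i, i ∉ s → partialVF 𝕜 i F = 0) :
    vectorField a F = ∑ i ∈ s, a i * partialVF 𝕜 i F := by
  change ∑ᶠ i, a i * partialVF 𝕜 i F = _
  refine finsum_eq_sum_of_support_subset _ fun i hi => ?_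
  by_contra h
  exact hi (by simp [hs i h])

@[simp] theorem vectorField_coord (a : ι → Fn 𝕜 ι) (i : ι) :
    vectorField a (coord i) = a i := by
  rw [vectorField_apply a (s := {i})]
  · simp [partialVF_coord]
  · intro j hj
    rw [partialVF_coord, if_neg (by simpa using hj)]

/-- The derivations of the algebra of functions that are formal series `∑ i, a i ∂_i`, that is,
that obey the chain rule. -/
def Formal (Z : VF 𝕜 ι) : Prop := Z = vectorField fun i => Z (coord i)

theorem formal_vectorField (a : ι → Fn 𝕜 ι) : Formal (vectorField a) := by
  unfold Formal
  simp

theorem Formal.apply {Z : VF 𝕜 ι} (hZ : Formal Z) {F : Fn 𝕜 ι} {s : Finset ι}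
    (hs : ∀ i, i ∉ s → partialVF 𝕜 i F = 0) :
    Z F = ∑ i ∈ s, Z (coord i) * partialVF 𝕜 i F := by
  conv_lhs => rw [hZ]
  exact vectorField_apply _ hs

theorem Formal.of_apply {Z : VF 𝕜 ι}
    (h : ∀ (F : Fn 𝕜 ι) (s : Finset ι), (∀ i, i ∉ s → partialVF 𝕜 i F = 0) →
      Z F = ∑ i ∈ s, Z (coord i) * partialVF 𝕜 i F) : Formal Z := by
  refine Derivation.ext fun F => ?_
  obtain ⟨s, hs⟩ := F.exists_support
  rw [vectorField_apply _ hs, h F s hs]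

theorem Formal.ext {Z W : VF 𝕜 ι} (hZ : Formal Z) (hW : Formal W)
    (h : ∀ i, Z (coord i) = W (coord i)) : Z = W := by
  rw [hZ, hW]
  simp only [h]

theorem formal_partialVF (i : ι) : Formal (partialVF 𝕜 i) := by
  refine Formal.of_apply fun F s hs => ?_
  simp only [partialVF_coord, ite_mul, one_mul, zero_mul, Finset.sum_ite_eq]
  split_ifs with h
  · rfl
  · exact hs i h

theorem formal_zero : Formal (0 : VF 𝕜 ι) :=
  Formal.of_apply fun F s _ => by simp

theorem Formal.add {Z W : VF 𝕜 ι} (hZ : Formal Z) (hW : Formal W) : Formal (Z + W) :=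
  Formal.of_apply fun F s hs => by
    simp only [Derivation.add_apply, hZ.apply hs, hW.apply hs, add_mul, Finset.sum_add_distrib]

theorem Formal.fsmul {Z : VF 𝕜 ι} (f : Fn 𝕜 ι) (hZ : Formal Z) : Formal (f • Z) :=
  Formal.of_apply fun F s hs => by
    simp only [Derivation.smul_apply, hZ.apply hs, smul_eq_mul, Finset.mul_sum, mul_assoc]

theorem Formal.smul {Z : VF 𝕜 ι} (c : 𝕜) (hZ : Formal Z) : Formal (c • Z) :=
  Formal.of_apply fun F s hs => by
    simp only [Derivation.smul_apply, hZ.apply hs, Finset.smul_sum, smul_mul_assoc]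

theorem Formal.sub {Z W : VF 𝕜 ι} (hZ : Formal Z) (hW : Formal W) : Formal (Z - W) :=
  Formal.of_apply fun F s hs => by
    simp only [Derivation.sub_apply, hZ.apply hs, hW.apply hs, sub_mul, Finset.sum_sub_distrib]

/-- The second order terms of a commutator cancel because partial derivatives commute. -/
theorem Formal.lie {Z W : VF 𝕜 ι} (hZ : Formal Z) (hW : Formal W) : Formal ⁅Z, W⁆ := by
  refine Formal.of_apply fun F s hs => ?_
  have hs' : ∀ i, ∀ j, j ∉ s → partialVF 𝕜 j (partialVF 𝕜 i F) = 0 := fun i j hj => by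
    rw [partialVF_comm, hs j hj, map_zero]
  have key : ∀ {Z W : VF 𝕜 ι}, Formal Z → Formal W → Z (W F) =
      ∑ i ∈ s, Z (W (coord i)) * partialVF 𝕜 i F +
        ∑ i ∈ s, ∑ j ∈ s, W (coord i) * Z (coord j) * partialVF 𝕜 j (partialVF 𝕜 i F) := by
    intro Z W hZ hW
    rw [hW.apply hs, map_sum, ← Finset.sum_add_distrib]
    refine Finset.sum_congr rfl fun i _ => ?_
    rw [Derivation.leibniz, hZ.apply (hs' i), smul_eq_mul, smul_eq_mul, Finset.mul_sum, add_comm,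
      mul_comm]
    simp only [mul_assoc]
  rw [Derivation.commutator_apply, key hZ hW, key hW hZ, Finset.sum_comm (s := s) (t := s)
    (f := fun i j => Z (coord i) * W (coord j) * partialVF 𝕜 j (partialVF 𝕜 i F))]
  have h2 : ∀ i ∈ s, ∀ j ∈ s, Z (coord j) * W (coord i) * partialVF 𝕜 i (partialVF 𝕜 j F) =
      W (coord i) * Z (coord j) * partialVF 𝕜 j (partialVF 𝕜 i F) := fun i _ j _ => by
    rw [partialVF_comm i j, mul_comm (Z _)]
  rw [Finset.sum_congr rfl fun i hi => Finset.sum_congr rfl (h2 i hi), add_sub_add_right_eq_sub,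
    ← Finset.sum_sub_distrib]
  refine Finset.sum_congr rfl fun i _ => ?_
  rw [Derivation.commutator_apply, sub_mul]

theorem Formal.apply_expF {Z : VF 𝕜 ι} (hZ : Formal Z) (f : Fn 𝕜 ι) :
    Z (expF f) = Z f * expF f := by
  obtain ⟨s, hs⟩ := f.exists_support
  rw [hZ.apply hs, hZ.apply (s := s) fun i hi => by rw [partialVF_expF, hs i hi, zero_mul],
    Finset.sum_mul]
  refine Finset.sum_congr rfl fun i _ => ?_
  rw [partialVF_expF, mul_assoc]

/-- The chain rule for a substitution. -/
theorem partialVF_subst {κ : Type*} [DecidableEq κ] (φ : ι → Fn 𝕜 κ) (k : κ) {F : Fn 𝕜 ι}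
    {s : Finset ι} (hs : ∀ i, i ∉ s → partialVF 𝕜 i F = 0) :
    partialVF 𝕜 k (subst φ F) =
      ∑ i ∈ s, partialVF 𝕜 k (φ i) * subst φ (partialVF 𝕜 i F) := by
  obtain ⟨s', g, hg, h⟩ := isLocFun_univ_iff.1 F.2
  have h0 : ∀ i, i ∉ s' → partialVF 𝕜 i F = 0 := by
    intro i hi
    refine Fn.ext fun p => ?_
    have h0 : s'.restrict (Pi.single i (1 : 𝕜) : ι → 𝕜) = 0 := by
      funext j
      have : (j : ι) ≠ i := fun e => hi (by rw [← e]; exact j.2)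
      simp [Finset.restrict, this]
    have := (hasDerivAt_comp_update i hg h p).deriv
    rw [h0, map_zero] at this
    exact this
  have hsum : ∑ i ∈ s, partialVF 𝕜 k (φ i) * subst φ (partialVF 𝕜 i F) =
      ∑ i ∈ s', partialVF 𝕜 k (φ i) * subst φ (partialVF 𝕜 i F) := by
    refine (Finset.sum_subset (s₂ := s ∪ s') Finset.subset_union_left fun i _ hi => ?_).trans
      (Finset.sum_subset (s₁ := s') Finset.subset_union_right fun i _ hi => ?_).symm
    · rw [hs i hi, map_zero, mul_zero]
    · rw [h0 i hi, map_zero, mul_zero]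
  rw [hsum]
  refine Fn.ext fun p => ?_
  let q : ι → 𝕜 := fun i => (φ i).1 p
  have h1 : HasDerivAt (fun x => fun i : s' => (φ i).1 (Function.update p k x))
      (fun i : s' => pd k (φ i).1 p) (p k) :=
    hasDerivAt_pi.2 fun i => (differentiableAt_update k (φ i) p).hasDerivAt
  have h2 := (hg (fun i : s' => (φ i).1 (Function.update p k (p k)))
    trivial).differentiableAt.hasFDerivAt
  have h3 := (h2.comp_hasDerivAt (p k) h1).deriv
  have h4 : pd k (subst φ F).1 p = fderiv 𝕜 g (s'.restrict q) (fun i : s' => pd k (φ i).1 p) := by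
    rw [Function.update_eq_self] at h3
    rw [show s'.restrict q = fun i : s' => (φ i).1 p from rfl, ← h3]
    refine congrArg (fun f => deriv f (p k)) (funext fun x => ?_)
    exact h _
  have h5 : (fun i : s' => pd k (φ i).1 p) =
      ∑ i : s', pd k (φ i).1 p • s'.restrict (Pi.single (i : ι) (1 : 𝕜) : ι → 𝕜) := by
    funext j
    rw [Finset.sum_apply, Finset.sum_eq_single j]
    · simp [Finset.restrict]
    · intro i _ hij
      have : (j : ι) ≠ i := fun e => hij (Subtype.ext e.symm)
      simp [Finset.restrict, this]
    · simp
  rw [partialVF_apply, h4, h5, map_sum, ← Finset.sum_coe_sort s']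
  have h6 : ∀ G : s' → Fn 𝕜 κ, (∑ i, G i).1 p = ∑ i, (G i).1 p := fun G => by
    rw [AddSubmonoidClass.coe_finsetSum, Finset.sum_apply]
  rw [h6]
  refine Finset.sum_congr rfl fun i _ => ?_
  rw [map_smul, smul_eq_mul]
  congr 1
  exact ((hasDerivAt_comp_update (i : ι) hg h q).deriv).symm

theorem Formal.apply_subst {κ : Type*} [DecidableEq κ] {Z : VF 𝕜 κ} (hZ : Formal Z)
    (φ : ι → Fn 𝕜 κ) {F : Fn 𝕜 ι} {s : Finset ι} (hs : ∀ i, i ∉ s → partialVF 𝕜 i F = 0) :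
    Z (subst φ F) = ∑ i ∈ s, Z (φ i) * subst φ (partialVF 𝕜 i F) := by
  classical
  choose σ hσ using fun i => (φ i).exists_support
  have hσ' : ∀ i ∈ s, ∀ k, k ∉ s.biUnion σ → partialVF 𝕜 k (φ i) = 0 := fun i hi k hk =>
    hσ i k fun h => hk (Finset.mem_biUnion.2 ⟨i, hi, h⟩)
  rw [hZ.apply (s := s.biUnion σ) fun k hk => by
    rw [partialVF_subst φ k hs]
    exact Finset.sum_eq_zero fun i hi => by rw [hσ' i hi k hk, zero_mul]]
  simp only [partialVF_subst φ _ hs, Finset.mul_sum]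
  rw [Finset.sum_comm]
  refine Finset.sum_congr rfl fun i hi => ?_
  rw [hZ.apply (hσ' i hi), Finset.sum_mul]
  simp only [mul_assoc]

omit [DecidableEq ι] in
theorem lie_fsmul (Z W : VF 𝕜 ι) (f : Fn 𝕜 ι) : ⁅Z, f • W⁆ = Z f • W + f • ⁅Z, W⁆ := by
  refine Derivation.ext fun F => ?_
  simp only [Derivation.commutator_apply, Derivation.add_apply, Derivation.smul_apply, smul_eq_mul,
    Derivation.leibniz]
  ring

omit [DecidableEq ι] in
theorem fsmul_lie (Z W : VF 𝕜 ι) (f : Fn 𝕜 ι) : ⁅f • Z, W⁆ = f • ⁅Z, W⁆ - W f • Z := by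
  refine Derivation.ext fun F => ?_
  simp only [Derivation.commutator_apply, Derivation.sub_apply, Derivation.smul_apply, smul_eq_mul,
    Derivation.leibniz]
  ring

end Formal

/-! ### The recursions in an abstract Lie algebra with a shift -/

section Abstract

variable {𝕜 R M : Type*} [Field 𝕜] [CommRing R] [Algebra 𝕜 R] [LieRing M] [LieAlgebra 𝕜 M]
  [Module R M] [IsScalarTower 𝕜 R M]

/-- The relations between `S₀`, `S₁`, the functions `e = e^{α τ}`, `e' = e^{-α τ}` and the
conjugation `σ` by the shift on which the recursions rest. The map `D` gives the action of fields on
functions; `T` is the space of fields that annihilate `τ_{-1}`, so that `σ` maps `T` to fields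
without `∂/∂τ`. The last axiom is the uniqueness principle for fields in `T`. -/
structure ShiftSystem (D : M → R → R) (σ : M →ₗ⁅𝕜⁆ M) (T : Submodule 𝕜 M) (α : 𝕜) (s₀ s₁ : M)
    (e e' : R) : Prop where
  mul_inv : e * e' = 1
  lie_smul : ∀ (Z W : M) (f : R), ⁅Z, f • W⁆ = D Z f • W + f • ⁅Z, W⁆
  D_smul : ∀ (f g : R) (Z : M), D (f • Z) g = f * D Z g
  map₀ : σ s₀ = e • s₀
  map₁ : σ s₁ = e' • s₁
  D₀ : D s₀ e = algebraMap 𝕜 R α * (e + 1)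
  D₁ : D s₁ e = algebraMap 𝕜 R α * (e + e ^ 2)
  D₀' : D s₀ e' = -algebraMap 𝕜 R α * (e' + e' ^ 2)
  D₁' : D s₁ e' = -algebraMap 𝕜 R α * (e' + 1)
  mem : ⁅s₀, s₁⁆ + α • s₀ + α • s₁ ∈ T
  lie_mem₀ : ∀ Z ∈ T, ⁅s₀, Z⁆ ∈ T
  lie_mem₁ : ∀ Z ∈ T, ⁅s₁, Z⁆ ∈ T
  D_map : ∀ Z ∈ T, D (σ Z) e = 0
  D_map' : ∀ Z ∈ T, D (σ Z) e' = 0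
  eq_zero : ∀ Z ∈ T, ∀ u : R, IsUnit u → σ Z = u • Z → Z = 0

namespace ShiftSystem

variable {D : M → R → R} {σ : M →ₗ⁅𝕜⁆ M} {T : Submodule 𝕜 M} {α : 𝕜} {s₀ s₁ : M} {e e' : R}

/-- The symmetry `α ↦ -α` exchanges `S₀` with `S₁`. -/
theorem mirror (h : ShiftSystem D σ T α s₀ s₁ e e') : ShiftSystem D σ T (-α) s₁ s₀ e' e where
  mul_inv := by rw [mul_comm]; exact h.mul_inv
  lie_smul := h.lie_smul
  D_smul := h.D_smul
  map₀ := h.map₁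
  map₁ := h.map₀
  D₀ := by rw [h.D₁', map_neg]
  D₁ := by rw [h.D₀', map_neg]
  D₀' := by rw [h.D₁, map_neg, neg_neg]
  D₁' := by rw [h.D₀, map_neg, neg_neg]
  mem := by
    have := T.neg_mem h.mem
    rw [← lie_skew]
    convert this using 1
    module
  lie_mem₀ := h.lie_mem₁
  lie_mem₁ := h.lie_mem₀
  D_map := h.D_map'
  D_map' := h.D_map
  eq_zero := h.eq_zero

theorem smul_smul_inv (h : ShiftSystem D σ T α s₀ s₁ e e') (Z : M) : e • e' • Z = Z := by
  rw [smul_smul, h.mul_inv, one_smul]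

theorem smul_inv_smul (h : ShiftSystem D σ T α s₀ s₁ e e') (Z : M) : e' • e • Z = Z := by
  rw [smul_smul, mul_comm, h.mul_inv, one_smul]

theorem smul_lie (h : ShiftSystem D σ T α s₀ s₁ e e') (Z W : M) (f : R) :
    ⁅f • Z, W⁆ = f • ⁅Z, W⁆ - D W f • Z := by
  rw [← lie_skew, h.lie_smul, ← lie_skew Z W]
  module

theorem map_lie₀ (h : ShiftSystem D σ T α s₀ s₁ e e') {Z : M} (hZ : Z ∈ T) :
    σ ⁅s₀, Z⁆ = e • ⁅s₀, σ Z⁆ := by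
  rw [LieHom.map_lie, h.map₀, h.smul_lie, h.D_map Z hZ, zero_smul, sub_zero]

theorem map_lie₁ (h : ShiftSystem D σ T α s₀ s₁ e e') {Z : M} (hZ : Z ∈ T) :
    σ ⁅s₁, Z⁆ = e' • ⁅s₁, σ Z⁆ := by
  rw [LieHom.map_lie, h.map₁, h.smul_lie, h.D_map' Z hZ, zero_smul, sub_zero]

/-- The shift conjugate of `P_1`, the start of the recursions. -/
theorem map_first (h : ShiftSystem D σ T α s₀ s₁ e e') :
    σ (⁅s₀, s₁⁆ + α • s₀ + α • s₁) =
      ⁅s₀, s₁⁆ + α • s₀ + α • s₁ - (2 * α) • (s₀ + s₁) := by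
  have h1 : σ ⁅s₀, s₁⁆ = ⁅s₀, s₁⁆ - algebraMap 𝕜 R α • (s₁ + e' • s₁ + s₀ + e • s₀) := by
    rw [LieHom.map_lie, h.map₀, h.map₁, h.smul_lie, h.lie_smul, h.D_smul, h.D₀', h.D₁]
    match_scalars
    · linear_combination (-algebraMap 𝕜 R α * (1 + e')) * h.mul_inv
    · linear_combination (1 : R) * h.mul_inv
    · linear_combination (-algebraMap 𝕜 R α * (1 + e)) * h.mul_inv
  rw [map_add, map_add, h1, map_smul, map_smul, h.map₀, h.map₁]
  match_scalars <;> (try simp only [map_ofNat]) <;> ring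

/-- The property of `p = P_{2n+1}` from which the next step of the recursions follows. -/
def Good (σ : M →ₗ⁅𝕜⁆ M) (T : Submodule 𝕜 M) (α : 𝕜) (s₀ s₁ : M) (e e' : R) (p : M) : Prop :=
  p ∈ T ∧ e • σ ⁅s₁, p⁆ - α • σ p = ⁅s₁, p⁆ + α • p ∧
    e' • σ ⁅s₀, p⁆ + α • σ p = ⁅s₀, p⁆ - α • p

theorem Good.mirror {p : M} (hp : Good σ T α s₀ s₁ e e' p) :
    Good σ T (-α) s₁ s₀ e' e p :=
  ⟨hp.1, by rw [neg_smul, neg_smul, sub_neg_eq_add, ← sub_eq_add_neg]; exact hp.2.2,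
    by rw [neg_smul, neg_smul, sub_neg_eq_add, ← sub_eq_add_neg]; exact hp.2.1⟩

/-- The shift conjugate of `P_2`, from which `P_1` is seen to be `Good`. -/
theorem map_second (h : ShiftSystem D σ T α s₀ s₁ e e') {p : M}
    (hp : p = ⁅s₀, s₁⁆ + α • s₀ + α • s₁) :
    e • σ ⁅s₁, p⁆ = ⁅s₁, p⁆ + (2 * α) • p - (2 * α ^ 2) • (s₀ + s₁) := by
  have hmem : p ∈ T := hp ▸ h.mem
  have h1 : ⁅s₀, s₁⁆ = p - α • s₀ - α • s₁ := by rw [hp]; abel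
  have h2 : σ p = p - (2 * α) • (s₀ + s₁) := by rw [hp]; exact h.map_first
  rw [h.map_lie₁ hmem, h.smul_smul_inv, h2, lie_sub, _root_.lie_smul, lie_add, lie_self,
    ← lie_skew s₁ s₀, h1]
  module

theorem good_first (h : ShiftSystem D σ T α s₀ s₁ e e') :
    Good σ T α s₀ s₁ e e' (⁅s₀, s₁⁆ + α • s₀ + α • s₁) := by
  have key : ∀ {α : 𝕜} {s₀ s₁ : M} {e e' : R}, ShiftSystem D σ T α s₀ s₁ e e' → ∀ p : M,
      p = ⁅s₀, s₁⁆ + α • s₀ + α • s₁ → e • σ ⁅s₁, p⁆ - α • σ p = ⁅s₁, p⁆ + α • p := by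
    intro α s₀ s₁ e e' h p hp
    rw [h.map_second hp, hp, h.map_first]
    module
  refine ⟨h.mem, key h _ rfl, ?_⟩
  have h1 := key h.mirror _ rfl
  have h2 : ⁅s₁, s₀⁆ + -α • s₁ + -α • s₀ = -(⁅s₀, s₁⁆ + α • s₀ + α • s₁) := by
    rw [← lie_skew s₁ s₀]; module
  rw [h2, map_neg, lie_neg, map_neg] at h1
  linear_combination (norm := module) -h1

/-- The relation `[S₁, P_{2n}] = -α P_{2n}`: the shift multiplies the difference of its sides by
`e^{-2ατ}`, so that the uniqueness principle applies. -/
theorem lie_even (h : ShiftSystem D σ T α s₀ s₁ e e') {p : M}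
    (hp : Good σ T α s₀ s₁ e e' p) : ⁅s₁, ⁅s₁, p⁆⁆ = -α • ⁅s₁, p⁆ := by
  obtain ⟨hT, h1, -⟩ := hp
  set y := ⁅s₁, p⁆ with hy
  have hyT : y ∈ T := h.lie_mem₁ p hT
  have h2 : ⁅s₁, σ p⁆ = e • σ y := by rw [hy, h.map_lie₁ hT, h.smul_smul_inv]
  have h3 := congrArg (fun Z => ⁅s₁, Z⁆) h1
  simp only [lie_sub, lie_add, _root_.lie_smul, h.lie_smul, h.D₁, h2, ← hy] at h3
  have h4 : σ (⁅s₁, y⁆ + α • y) = (e' ^ 2) • (⁅s₁, y⁆ + α • y) := by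
    rw [map_add, map_smul, h.map_lie₁ hyT]
    linear_combination (norm := skip) (e' ^ 2) • h3
    match_scalars
    · linear_combination -e' * h.mul_inv
    · linear_combination -algebraMap 𝕜 R α * (e * e' + 1) * h.mul_inv
    · ring
    · ring
  have h5 := h.eq_zero _ (T.add_mem (h.lie_mem₁ y hyT) (T.smul_mem α hyT)) _
    ((IsUnit.of_mul_eq_one_right _ h.mul_inv).pow 2) h4
  linear_combination (norm := module) h5

/-- One step of the first recursion. -/
theorem map_odd (h : ShiftSystem D σ T α s₀ s₁ e e') {p : M}
    (hp : Good σ T α s₀ s₁ e e' p) :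
    σ (⁅s₀, ⁅s₁, p⁆⁆ + α • ⁅s₁, p⁆) + (2 * α) • e • σ ⁅s₁, p⁆ =
      ⁅s₀, ⁅s₁, p⁆⁆ + α • ⁅s₁, p⁆ + (2 * α) • ⁅s₀, p⁆ := by
  obtain ⟨hT, h1, h1'⟩ := hp
  set y := ⁅s₁, p⁆ with hy
  set x := ⁅s₀, p⁆ with hx
  have hyT : y ∈ T := h.lie_mem₁ p hT
  have h2 : ⁅s₀, σ p⁆ = e' • σ x := by rw [hx, h.map_lie₀ hT, h.smul_inv_smul]
  have h3 := congrArg (fun Z => ⁅s₀, Z⁆) h1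
  simp only [lie_sub, lie_add, _root_.lie_smul, h.lie_smul, h.D₀, h2, ← hx] at h3
  rw [map_add, map_smul, h.map_lie₀ hyT]
  linear_combination (norm := skip) h3 + α • h1' + α • h1
  match_scalars <;> (try simp only [map_ofNat]) <;> ring

/-- The fields `P_{2n+1}` and `Q_{2n+1}` coincide, since the shift fixes their difference. -/
theorem odd_eq (h : ShiftSystem D σ T α s₀ s₁ e e') {p : M}
    (hp : Good σ T α s₀ s₁ e e' p) :
    ⁅s₀, ⁅s₁, p⁆⁆ + α • ⁅s₁, p⁆ = ⁅s₁, ⁅s₀, p⁆⁆ - α • ⁅s₀, p⁆ := by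
  have h1 := h.map_odd hp
  have h2 := h.mirror.map_odd hp.mirror
  obtain ⟨hT, h3, h3'⟩ := hp
  have hm : ⁅s₀, ⁅s₁, p⁆⁆ + α • ⁅s₁, p⁆ - (⁅s₁, ⁅s₀, p⁆⁆ + -α • ⁅s₀, p⁆) ∈ T :=
    T.sub_mem (T.add_mem (h.lie_mem₀ _ (h.lie_mem₁ _ hT)) (T.smul_mem _ (h.lie_mem₁ _ hT)))
      (T.add_mem (h.lie_mem₁ _ (h.lie_mem₀ _ hT)) (T.smul_mem _ (h.lie_mem₀ _ hT)))
  have h4 := h.eq_zero _ hm 1 isUnit_one (by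
    rw [map_sub]
    linear_combination (norm := skip) h1 - h2 - (2 * α) • h3 - (2 * α) • h3'
    match_scalars <;> (try simp only [map_ofNat]) <;> ring)
  linear_combination (norm := module) h4

/-- The recursions propagate from `P_{2n-1}` to `P_{2n+1}`. -/
theorem Good.step (h : ShiftSystem D σ T α s₀ s₁ e e') {p : M}
    (hp : Good σ T α s₀ s₁ e e' p) :
    Good σ T α s₀ s₁ e e' (⁅s₀, ⁅s₁, p⁆⁆ + α • ⁅s₁, p⁆) := by
  have key : ∀ {α : 𝕜} {s₀ s₁ : M} {e e' : R}, ShiftSystem D σ T α s₀ s₁ e e' → ∀ p z : M,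
      Good σ T α s₀ s₁ e e' p → z = ⁅s₀, ⁅s₁, p⁆⁆ + α • ⁅s₁, p⁆ →
      e • σ ⁅s₁, z⁆ - α • σ z = ⁅s₁, z⁆ + α • z := by
    intro α s₀ s₁ e e' h p z hp hz
    have hyT : ⁅s₁, p⁆ ∈ T := h.lie_mem₁ p hp.1
    have hzT : z ∈ T :=
      hz ▸ T.add_mem (h.lie_mem₀ _ hyT) (T.smul_mem _ hyT)
    have h1 := h.map_odd hp
    have h2 := h.lie_even hp
    have h3 := h.odd_eq hp
    rw [← hz] at h1 h3
    set y := ⁅s₁, p⁆ with hy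
    set x := ⁅s₀, p⁆ with hx
    have h4 : ⁅s₁, σ z⁆ = e • σ ⁅s₁, z⁆ := by rw [h.map_lie₁ hzT, h.smul_smul_inv]
    have h5 : ⁅s₁, σ y⁆ = -α • e • σ y := by
      have h6 := congrArg (fun Z => e • σ Z) h2
      simp only [h.map_lie₁ hyT, h.smul_smul_inv, map_smul] at h6
      rw [h6]
      module
    have h7 := congrArg (fun Z => ⁅s₁, Z⁆) h1
    simp only [lie_add, _root_.lie_smul, h.lie_smul, h.D₁, h4, h5] at h7
    linear_combination (norm := skip) h7 - α • h1 - (2 * α) • h3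
    match_scalars <;> (try simp only [map_ofNat]) <;> ring
  have hyT : ⁅s₁, p⁆ ∈ T := h.lie_mem₁ p hp.1
  refine ⟨T.add_mem (h.lie_mem₀ _ hyT) (T.smul_mem _ hyT), key h _ _ hp rfl, ?_⟩
  have h1 := key h.mirror _ _ hp.mirror rfl
  have h2 : ⁅s₁, ⁅s₀, p⁆⁆ + -α • ⁅s₀, p⁆ = ⁅s₀, ⁅s₁, p⁆⁆ + α • ⁅s₁, p⁆ := by
    rw [h.odd_eq hp]; module
  rw [h2] at h1
  linear_combination (norm := module) h1

end ShiftSystem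

end Abstract

/-! ### The sequences `P_k`, `Q_k` and the triangular form of the shift -/

section Sequences

variable {𝕜 R M : Type*} [Field 𝕜] [CommRing R] [Algebra 𝕜 R] [LieRing M] [LieAlgebra 𝕜 M]
  [Module R M] [IsScalarTower 𝕜 R M]

/-- The recursion for `P_k` in an arbitrary Lie algebra. -/
def pSeq (α : 𝕜) (s₀ s₁ : M) : ℕ → M
  | 0 => 0
  | 1 => ⁅s₀, s₁⁆ + α • s₀ + α • s₁
  | k + 2 => if Even k then ⁅s₁, pSeq α s₀ s₁ (k + 1)⁆
      else ⁅s₀, pSeq α s₀ s₁ (k + 1)⁆ + α • pSeq α s₀ s₁ (k + 1)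

/-- The recursion for `Q_k` in an arbitrary Lie algebra. -/
def qSeq (α : 𝕜) (s₀ s₁ : M) : ℕ → M
  | 0 => 0
  | 1 => pSeq α s₀ s₁ 1
  | k + 2 => if Even k then ⁅s₀, qSeq α s₀ s₁ (k + 1)⁆
      else ⁅s₁, qSeq α s₀ s₁ (k + 1)⁆ - α • qSeq α s₀ s₁ (k + 1)

/-- The sequence `S₀, S₁, P_1, P_2, Q_2, P_3, P_4, Q_4, P_5, …`. -/
def tri (α : 𝕜) (s₀ s₁ : M) (k : ℕ) : M :=
  if k % 3 = 0 then (if k = 0 then s₀ else pSeq α s₀ s₁ (2 * (k / 3)))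
  else if k % 3 = 1 then (if k = 1 then s₁ else qSeq α s₀ s₁ (2 * (k / 3)))
  else pSeq α s₀ s₁ (2 * (k / 3) + 1)

variable (α : 𝕜) (s₀ s₁ : M)

theorem pSeq_even (n : ℕ) : pSeq α s₀ s₁ (2 * n + 2) = ⁅s₁, pSeq α s₀ s₁ (2 * n + 1)⁆ := by
  rw [pSeq, if_pos (even_two_mul n)]

theorem pSeq_odd (n : ℕ) : pSeq α s₀ s₁ (2 * n + 3) =
    ⁅s₀, pSeq α s₀ s₁ (2 * n + 2)⁆ + α • pSeq α s₀ s₁ (2 * n + 2) := by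
  rw [show 2 * n + 3 = 2 * n + 1 + 2 from rfl, pSeq, if_neg (Nat.not_even_two_mul_add_one n)]

theorem qSeq_even (n : ℕ) : qSeq α s₀ s₁ (2 * n + 2) = ⁅s₀, qSeq α s₀ s₁ (2 * n + 1)⁆ := by
  rw [qSeq, if_pos (even_two_mul n)]

theorem qSeq_odd (n : ℕ) : qSeq α s₀ s₁ (2 * n + 3) =
    ⁅s₁, qSeq α s₀ s₁ (2 * n + 2)⁆ - α • qSeq α s₀ s₁ (2 * n + 2) := by
  rw [show 2 * n + 3 = 2 * n + 1 + 2 from rfl, qSeq, if_neg (Nat.not_even_two_mul_add_one n)]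

theorem tri_zero : tri α s₀ s₁ 0 = s₀ := by simp [tri]

theorem tri_one : tri α s₀ s₁ 1 = s₁ := by simp [tri]

theorem tri_odd (n : ℕ) : tri α s₀ s₁ (3 * n + 2) = pSeq α s₀ s₁ (2 * n + 1) := by
  rw [tri, if_neg (by omega), if_neg (by omega), show (3 * n + 2) / 3 = n by omega]

theorem tri_even (n : ℕ) : tri α s₀ s₁ (3 * n + 3) = pSeq α s₀ s₁ (2 * n + 2) := by
  rw [tri, if_pos (by omega), if_neg (by omega), show 2 * ((3 * n + 3) / 3) = 2 * n + 2 by omega]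

theorem tri_even' (n : ℕ) : tri α s₀ s₁ (3 * n + 4) = qSeq α s₀ s₁ (2 * n + 2) := by
  rw [tri, if_neg (by omega), if_pos (by omega), if_neg (by omega),
    show 2 * ((3 * n + 4) / 3) = 2 * n + 2 by omega]

theorem cases_mod_three {p : ℕ → Prop} (h0 : p 0) (h1 : p 1) (h2 : ∀ n, p (3 * n + 2))
    (h3 : ∀ n, p (3 * n + 3)) (h4 : ∀ n, p (3 * n + 4)) (N : ℕ) : p N := by
  rcases Nat.lt_or_ge N 2 with h | h
  · interval_cases N
    · exact h0
    · exact h1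
  · obtain ⟨m, rfl⟩ := Nat.exists_eq_add_of_le' h
    rcases (by omega : m % 3 = 0 ∨ m % 3 = 1 ∨ m % 3 = 2) with hm | hm | hm
    · rw [show m + 2 = 3 * (m / 3) + 2 by omega]; exact h2 _
    · rw [show m + 2 = 3 * (m / 3) + 3 by omega]; exact h3 _
    · rw [show m + 2 = 3 * (m / 3) + 4 by omega]; exact h4 _

/-- The coordinates of `σ P_{2n+1}` with respect to `tri`. -/
def oddRow (α : 𝕜) : ℕ → ℕ → 𝕜
  | 0, k => if k = 2 then 1 else -2 * α
  | n + 1, k => if k = 3 * n + 5 then 1 else if k = 3 * n + 4 then 2 * α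
      else if k = 3 * n + 3 then -2 * α
      else -2 * α * (α * (oddRow α n k + if k = 3 * n + 2 then 1 else 0))

/-- The coordinates with respect to `tri` of the remainder `R_{n+1}` in
`σ P_{2n+2} = e^{-α τ} (P_{2n+2} + R_{n+1})`. -/
def evenRow (α : 𝕜) (n k : ℕ) : 𝕜 := α * (oddRow α n k + if k = 3 * n + 2 then 1 else 0)

theorem oddRow_top (n : ℕ) : oddRow α n (3 * n + 2) = 1 := by
  cases n with
  | zero => simp [oddRow]
  | succ n => rw [oddRow, if_pos (by omega)]

theorem evenRow_top (n : ℕ) : evenRow α n (3 * n + 2) = 2 * α := by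
  rw [evenRow, oddRow_top, if_pos rfl]; ring

/-- Sums over `tri` regrouped into the fields `P_{2k}`, `Q_{2k}`, `P_{2k+1}`, `S₀`, `S₁`. -/
theorem sum_tri (c : ℕ → 𝕜) (n : ℕ) :
    ∑ k ∈ Finset.range (3 * n + 3), c k • tri α s₀ s₁ k =
      ∑ k ∈ Finset.Icc 1 n, (c (3 * k) • pSeq α s₀ s₁ (2 * k) +
          c (3 * k + 1) • qSeq α s₀ s₁ (2 * k))
        + ∑ k ∈ Finset.range (n + 1), c (3 * k + 2) • pSeq α s₀ s₁ (2 * k + 1)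
        + c 0 • s₀ + c 1 • s₁ := by
  induction n with
  | zero =>
    have := tri_odd α s₀ s₁ 0
    simp only [Nat.mul_zero, Nat.zero_add] at this
    simp only [Nat.mul_zero, Nat.zero_add, Finset.sum_range_succ, Finset.sum_range_zero, tri_zero,
      tri_one, this]
    rw [Finset.Icc_eq_empty (by omega), Finset.sum_empty]
    abel
  | succ n ih =>
    rw [show 3 * (n + 1) + 3 = 3 * n + 3 + 1 + 1 + 1 by ring, Finset.sum_range_succ,
      Finset.sum_range_succ, Finset.sum_range_succ, ih, Finset.sum_range_succ _ (n + 1),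
      Finset.sum_Icc_succ_top (by omega), tri_even, show 3 * n + 3 + 1 = 3 * n + 4 by ring,
      tri_even', show 3 * n + 4 + 1 = 3 * (n + 1) + 2 by ring, tri_odd]
    rw [show 3 * (n + 1) = 3 * n + 3 by ring, show 2 * (n + 1) = 2 * n + 2 by ring]
    abel

variable {α s₀ s₁}

namespace ShiftSystem

variable {D : M → R → R} {σ : M →ₗ⁅𝕜⁆ M} {T : Submodule 𝕜 M} {e e' : R}

theorem good (h : ShiftSystem D σ T α s₀ s₁ e e') (n : ℕ) :
    Good σ T α s₀ s₁ e e' (pSeq α s₀ s₁ (2 * n + 1)) := by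
  induction n with
  | zero => exact h.good_first
  | succ n ih =>
    rw [show 2 * (n + 1) + 1 = 2 * n + 3 by ring, pSeq_odd, pSeq_even]
    exact ih.step h

theorem qSeq_eq (h : ShiftSystem D σ T α s₀ s₁ e e') (n : ℕ) :
    pSeq α s₀ s₁ (2 * n + 1) = qSeq α s₀ s₁ (2 * n + 1) := by
  induction n with
  | zero => rfl
  | succ n ih =>
    rw [show 2 * (n + 1) + 1 = 2 * n + 3 by ring, pSeq_odd, pSeq_even, qSeq_odd, qSeq_even, ← ih]
    exact h.odd_eq (h.good n)

theorem qSeq_even' (h : ShiftSystem D σ T α s₀ s₁ e e') (n : ℕ) :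
    qSeq α s₀ s₁ (2 * n + 2) = ⁅s₀, pSeq α s₀ s₁ (2 * n + 1)⁆ := by
  rw [qSeq_even, h.qSeq_eq]

theorem pSeq_mem (h : ShiftSystem D σ T α s₀ s₁ e e') : ∀ k : ℕ, pSeq α s₀ s₁ k ∈ T := by
  intro k
  match k with
  | 0 => exact T.zero_mem
  | k + 1 =>
    rcases Nat.even_or_odd' k with ⟨n, rfl | rfl⟩
    · exact (h.good n).1
    · rw [show 2 * n + 1 + 1 = 2 * n + 2 by ring, pSeq_even]
      exact h.lie_mem₁ _ (h.good n).1

theorem qSeq_mem (h : ShiftSystem D σ T α s₀ s₁ e e') : ∀ k : ℕ, qSeq α s₀ s₁ k ∈ T := by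
  intro k
  match k with
  | 0 => exact T.zero_mem
  | k + 1 =>
    rcases Nat.even_or_odd' k with ⟨n, rfl | rfl⟩
    · rw [← h.qSeq_eq]
      exact (h.good n).1
    · rw [show 2 * n + 1 + 1 = 2 * n + 2 by ring, h.qSeq_even']
      exact h.lie_mem₀ _ (h.good n).1

theorem map_pSeq_even (h : ShiftSystem D σ T α s₀ s₁ e e') (n : ℕ) :
    e • σ (pSeq α s₀ s₁ (2 * n + 2)) - α • σ (pSeq α s₀ s₁ (2 * n + 1)) =
      pSeq α s₀ s₁ (2 * n + 2) + α • pSeq α s₀ s₁ (2 * n + 1) := by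
  rw [pSeq_even]
  exact (h.good n).2.1

theorem map_qSeq_even (h : ShiftSystem D σ T α s₀ s₁ e e') (n : ℕ) :
    e' • σ (qSeq α s₀ s₁ (2 * n + 2)) + α • σ (pSeq α s₀ s₁ (2 * n + 1)) =
      qSeq α s₀ s₁ (2 * n + 2) - α • pSeq α s₀ s₁ (2 * n + 1) := by
  rw [h.qSeq_even']
  exact (h.good n).2.2

theorem map_pSeq_odd (h : ShiftSystem D σ T α s₀ s₁ e e') (n : ℕ) :
    σ (pSeq α s₀ s₁ (2 * n + 3)) + (2 * α) • e • σ (pSeq α s₀ s₁ (2 * n + 2)) =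
      pSeq α s₀ s₁ (2 * n + 3) + (2 * α) • qSeq α s₀ s₁ (2 * n + 2) := by
  rw [pSeq_odd, pSeq_even, h.qSeq_even']
  exact h.map_odd (h.good n)

theorem map_qSeq_odd (h : ShiftSystem D σ T α s₀ s₁ e e') (n : ℕ) :
    σ (qSeq α s₀ s₁ (2 * n + 3)) - (2 * α) • e' • σ (qSeq α s₀ s₁ (2 * n + 2)) =
      qSeq α s₀ s₁ (2 * n + 3) - (2 * α) • pSeq α s₀ s₁ (2 * n + 2) := by
  rw [qSeq_odd, h.qSeq_even', pSeq_even]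
  have := h.mirror.map_odd (h.good n).mirror
  rw [neg_smul, ← sub_eq_add_neg] at this
  linear_combination (norm := module) this

theorem lie_pSeq_even (h : ShiftSystem D σ T α s₀ s₁ e e') (n : ℕ) :
    ⁅s₁, pSeq α s₀ s₁ (2 * n + 2)⁆ = -α • pSeq α s₀ s₁ (2 * n + 2) := by
  rw [pSeq_even]
  exact h.lie_even (h.good n)

theorem lie_qSeq_even (h : ShiftSystem D σ T α s₀ s₁ e e') (n : ℕ) :
    ⁅s₀, qSeq α s₀ s₁ (2 * n + 2)⁆ = α • qSeq α s₀ s₁ (2 * n + 2) := by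
  rw [h.qSeq_even']
  have := h.mirror.lie_even (h.good n).mirror
  rwa [neg_neg] at this

theorem map_odd_row (h : ShiftSystem D σ T α s₀ s₁ e e') (n : ℕ) :
    σ (pSeq α s₀ s₁ (2 * n + 1)) =
      ∑ k ∈ Finset.range (3 * n + 3), oddRow α n k • tri α s₀ s₁ k := by
  induction n with
  | zero =>
    rw [sum_tri, show pSeq α s₀ s₁ (2 * 0 + 1) = ⁅s₀, s₁⁆ + α • s₀ + α • s₁ from rfl, h.map_first,
      Finset.Icc_eq_empty (by omega)]
    simp [oddRow, pSeq]
    module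
  | succ n ih =>
    have h1 := h.map_pSeq_even n
    have h2 := h.map_pSeq_odd n
    have h3 : ∑ k ∈ Finset.range (3 * n + 3), oddRow α (n + 1) k • tri α s₀ s₁ k =
        (-2 * α * α) • (σ (pSeq α s₀ s₁ (2 * n + 1)) + pSeq α s₀ s₁ (2 * n + 1)) := by
      rw [ih, Finset.sum_range_succ _ (3 * n + 2), Finset.sum_range_succ _ (3 * n + 2), tri_odd,
        smul_add, smul_add,
        Finset.smul_sum, oddRow_top, add_assoc]
      congr 1
      · refine Finset.sum_congr rfl fun k hk => ?_
        rw [Finset.mem_range] at hk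
        rw [oddRow, if_neg (by omega), if_neg (by omega), if_neg (by omega), if_neg (by omega),
          smul_smul]
        congr 1
        ring
      · rw [oddRow, if_neg (by omega), if_neg (by omega), if_neg (by omega), if_pos rfl, oddRow_top]
        module
    rw [show 3 * (n + 1) + 3 = 3 * n + 3 + 1 + 1 + 1 by ring, Finset.sum_range_succ,
      Finset.sum_range_succ, Finset.sum_range_succ, h3, tri_even,
      show 3 * n + 3 + 1 = 3 * n + 4 by ring, tri_even',
      show 3 * n + 4 + 1 = 3 * (n + 1) + 2 by ring, tri_odd,
      show 2 * (n + 1) + 1 = 2 * n + 3 by ring, oddRow_top]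
    have h4 : oddRow α (n + 1) (3 * n + 4) = 2 * α := by
      rw [oddRow, if_neg (by omega), if_pos rfl]
    have h5 : oddRow α (n + 1) (3 * n + 3) = -2 * α := by
      rw [oddRow, if_neg (by omega), if_neg (by omega), if_pos rfl]
    rw [h4, h5]
    linear_combination (norm := module) h2 - (2 * α) • h1

theorem sum_evenRow (h : ShiftSystem D σ T α s₀ s₁ e e') (n : ℕ) :
    ∑ k ∈ Finset.range (3 * n + 3), evenRow α n k • tri α s₀ s₁ k =
      α • (σ (pSeq α s₀ s₁ (2 * n + 1)) + pSeq α s₀ s₁ (2 * n + 1)) := by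
  rw [h.map_odd_row, ← tri_odd, smul_add, Finset.smul_sum]
  simp only [evenRow, mul_add, add_smul, Finset.sum_add_distrib, mul_smul]
  congr 1
  rw [Finset.sum_eq_single (3 * n + 2)]
  · rw [if_pos rfl, one_smul]
  · intro k _ hk
    rw [if_neg hk, zero_smul, smul_zero]
  · intro hk
    simp at hk

theorem map_even_row (h : ShiftSystem D σ T α s₀ s₁ e e') (n : ℕ) :
    σ (pSeq α s₀ s₁ (2 * n + 2)) = e' • (pSeq α s₀ s₁ (2 * n + 2) +
      ∑ k ∈ Finset.range (3 * n + 3), evenRow α n k • tri α s₀ s₁ k) := by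
  rw [h.sum_evenRow, ← h.smul_inv_smul (σ (pSeq α s₀ s₁ (2 * n + 2)))]
  congr 1
  linear_combination (norm := module) h.map_pSeq_even n

theorem map_even_row' (h : ShiftSystem D σ T α s₀ s₁ e e') (n : ℕ) :
    σ (qSeq α s₀ s₁ (2 * n + 2)) = e • (qSeq α s₀ s₁ (2 * n + 2) -
      ∑ k ∈ Finset.range (3 * n + 3), evenRow α n k • tri α s₀ s₁ k) := by
  rw [h.sum_evenRow, ← h.smul_smul_inv (σ (qSeq α s₀ s₁ (2 * n + 2)))]
  congr 1
  linear_combination (norm := module) h.map_qSeq_even n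

/-- The shift acts on the sequence `tri` by a triangular matrix with constant entries, up to
functional factors `e^{±α τ}` or `1` of the rows. The entries listed last are the ones that decide
about linear independence. -/
theorem exists_triangular (h : ShiftSystem D σ T α s₀ s₁ e e') :
    ∃ (u : ℕ → R) (C : ℕ → ℕ → 𝕜),
      (∀ N, σ (tri α s₀ s₁ N) = u N • ∑ k ∈ Finset.range (N + 1), C N k • tri α s₀ s₁ k) ∧
      (∀ N, IsUnit (u N)) ∧ (∀ N, C N N = 1) ∧ u 0 = e ∧ u 1 = e' ∧ C 1 0 = 0 ∧
      (∀ n, u (3 * n + 2) = 1 ∧ u (3 * n + 3) = e' ∧ u (3 * n + 4) = e) ∧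
      (∀ n, C (3 * n + 2) (3 * n + 1) = 2 * α ∨ C (3 * n + 2) (3 * n + 1) = -2 * α) ∧
      ∀ n, C (3 * n + 3) (3 * n + 2) = 2 * α ∧ C (3 * n + 4) (3 * n + 3) = 0 ∧
        C (3 * n + 4) (3 * n + 2) = -2 * α := by
  have he : IsUnit e := IsUnit.of_mul_eq_one _ h.mul_inv
  have he' : IsUnit e' := IsUnit.of_mul_eq_one_right _ h.mul_inv
  have key : ∀ N, ∃ (u : R) (C : ℕ → 𝕜),
      σ (tri α s₀ s₁ N) = u • ∑ k ∈ Finset.range (N + 1), C k • tri α s₀ s₁ k ∧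
      IsUnit u ∧ C N = 1 ∧ (N = 0 → u = e) ∧ (N = 1 → u = e' ∧ C 0 = 0) ∧
      (∀ n, N = 3 * n + 2 → u = 1 ∧ (C (3 * n + 1) = 2 * α ∨ C (3 * n + 1) = -2 * α)) ∧
      (∀ n, N = 3 * n + 3 → u = e' ∧ C (3 * n + 2) = 2 * α) ∧
      ∀ n, N = 3 * n + 4 → u = e ∧ C (3 * n + 3) = 0 ∧ C (3 * n + 2) = -2 * α := by
    refine cases_mod_three ?_ ?_ ?_ ?_ ?_
    · refine ⟨e, fun _ => 1, ?_, he, rfl, fun _ => rfl, by omega, by omega, by omega, by omega⟩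
      simp [tri_zero, h.map₀]
    · refine ⟨e', fun k => if k = 1 then 1 else 0, ?_, he', rfl, by omega,
        fun _ => ⟨rfl, if_neg (by omega)⟩, by omega, by omega, by omega⟩
      simp [tri_one, h.map₁]
    · intro n
      refine ⟨1, oddRow α n, ?_, isUnit_one, oddRow_top α n, by omega, by omega, ?_, by omega,
        by omega⟩
      · rw [tri_odd, h.map_odd_row, one_smul]
      · rintro m hm
        obtain rfl : n = m := by omega
        refine ⟨rfl, ?_⟩
        cases n with
        | zero => right; simp [oddRow]
        | succ n => left; rw [oddRow, if_neg (by omega), if_pos (by omega)]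
    · intro n
      refine ⟨e', fun k => if k = 3 * n + 3 then 1 else evenRow α n k, ?_, he', if_pos rfl,
        by omega, by omega, by omega, ?_, by omega⟩
      · beta_reduce
        rw [tri_even, h.map_even_row, Finset.sum_range_succ _ (3 * n + 3), if_pos rfl, one_smul,
          tri_even, add_comm]
        congr 2
        refine Finset.sum_congr rfl fun k hk => ?_
        rw [Finset.mem_range] at hk
        rw [if_neg (by omega)]
      · rintro m hm
        obtain rfl : n = m := by omega
        refine ⟨rfl, ?_⟩
        dsimp only
        rw [if_neg (by omega), evenRow_top]
    · intro n
      refine ⟨e, fun k => if k = 3 * n + 4 then 1 else if k = 3 * n + 3 then 0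
        else -evenRow α n k, ?_, he, if_pos rfl, by omega, by omega, by omega, by omega, ?_⟩
      · beta_reduce
        rw [tri_even', h.map_even_row', Finset.sum_range_succ _ (3 * n + 4), if_pos rfl, one_smul,
          tri_even', Finset.sum_range_succ _ (3 * n + 3), if_neg (by omega), if_pos rfl, zero_smul,
          add_zero, sub_eq_add_neg, add_comm, ← Finset.sum_neg_distrib]
        congr 2
        refine Finset.sum_congr rfl fun k hk => ?_
        rw [Finset.mem_range] at hk
        rw [if_neg (by omega), if_neg (by omega), neg_smul]
      · rintro m hm
        obtain rfl : n = m := by omega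
        refine ⟨rfl, ?_, ?_⟩
        · dsimp only
          rw [if_neg (by omega), if_pos rfl]
        · dsimp only
          rw [if_neg (by omega), if_neg (by omega), evenRow_top, neg_mul]
  choose u C h1 h2 h3 h4 h5 h6 h7 h8 using key
  exact ⟨u, C, h1, h2, h3, h4 0 rfl, (h5 1 rfl).1, (h5 1 rfl).2,
    fun n => ⟨(h6 _ n rfl).1, (h7 _ n rfl).1, (h8 _ n rfl).1⟩, fun n => (h6 _ n rfl).2,
    fun n => ⟨(h7 _ n rfl).2, (h8 _ n rfl).2⟩⟩

end ShiftSystem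

/-! ### The filtration of the Lie algebra by multiplicity -/

/-- The span of the fields `tri` of multiplicity at most `n`, that is, of
`S₀, S₁, P_1, …, P_n, Q_2, Q_4, …, Q_{2⌊n/2⌋}`. -/
def triSpan (α : 𝕜) (s₀ s₁ : M) (n : ℕ) : Submodule 𝕜 M :=
  Submodule.span 𝕜 {Z | ∃ k < n + n / 2 + 2, tri α s₀ s₁ k = Z}

/-- Multiple commutators of `s₀`, `s₁`, graded by the number of brackets. -/
inductive Comm (s₀ s₁ : M) : ℕ → M → Prop
  | left : Comm s₀ s₁ 0 s₀
  | right : Comm s₀ s₁ 0 s₁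
  | bracket {m n : ℕ} {Y Z : M} :
      Comm s₀ s₁ m Y → Comm s₀ s₁ n Z → Comm s₀ s₁ (m + n + 1) ⁅Y, Z⁆

theorem tri_mem_triSpan {n k : ℕ} (hk : k < n + n / 2 + 2) :
    tri α s₀ s₁ k ∈ triSpan α s₀ s₁ n := Submodule.subset_span ⟨k, hk, rfl⟩

theorem triSpan_mono {m n : ℕ} (h : m ≤ n) : triSpan α s₀ s₁ m ≤ triSpan α s₀ s₁ n := by
  refine Submodule.span_mono ?_
  rintro _ ⟨k, hk, rfl⟩
  exact ⟨k, by omega, rfl⟩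

/-- The span of the multiple commutators formed with at most `n` brackets. -/
def commSpan (𝕜 : Type*) {M : Type*} [Field 𝕜] [LieRing M] [LieAlgebra 𝕜 M] (s₀ s₁ : M) (n : ℕ) :
    Submodule 𝕜 M := Submodule.span 𝕜 {Z | ∃ m ≤ n, Comm s₀ s₁ m Z}

theorem commSpan_mono {m n : ℕ} (h : m ≤ n) : commSpan 𝕜 s₀ s₁ m ≤ commSpan 𝕜 s₀ s₁ n := by
  refine Submodule.span_mono ?_
  rintro _ ⟨k, hk, hZ⟩
  exact ⟨k, by omega, hZ⟩

theorem lie_mem_commSpan {Y : M} (hY : Comm s₀ s₁ 0 Y) {n : ℕ} {Z : M}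
    (hZ : Z ∈ commSpan 𝕜 s₀ s₁ n) : ⁅Y, Z⁆ ∈ commSpan 𝕜 s₀ s₁ (n + 1) := by
  induction hZ using Submodule.span_induction with
  | mem Z h =>
    obtain ⟨m, hm, h⟩ := h
    exact Submodule.subset_span ⟨0 + m + 1, by omega, hY.bracket h⟩
  | zero => rw [lie_zero]; exact Submodule.zero_mem _
  | add Z W _ _ hZ hW => rw [lie_add]; exact Submodule.add_mem _ hZ hW
  | smul c Z _ hZ => rw [lie_smul]; exact Submodule.smul_mem _ c hZ

theorem pSeq_mem_commSpan : ∀ k : ℕ, pSeq α s₀ s₁ k ∈ commSpan 𝕜 s₀ s₁ k := by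
  have h0 : s₀ ∈ commSpan 𝕜 s₀ s₁ 1 := Submodule.subset_span ⟨0, by omega, Comm.left⟩
  have h1 : s₁ ∈ commSpan 𝕜 s₀ s₁ 1 := Submodule.subset_span ⟨0, by omega, Comm.right⟩
  have h2 : ⁅s₀, s₁⁆ ∈ commSpan 𝕜 s₀ s₁ 1 :=
    Submodule.subset_span ⟨0 + 0 + 1, by omega, Comm.left.bracket Comm.right⟩
  intro k
  induction k using Nat.strong_induction_on with
  | _ k ih =>
    match k with
    | 0 => exact Submodule.zero_mem _
    | 1 => exact Submodule.add_mem _ (Submodule.add_mem _ h2 (Submodule.smul_mem _ _ h0))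
            (Submodule.smul_mem _ _ h1)
    | k + 2 =>
      have hk := ih (k + 1) (by omega)
      rw [pSeq]
      split_ifs
      · exact lie_mem_commSpan Comm.right hk
      · exact Submodule.add_mem _ (lie_mem_commSpan Comm.left hk)
          (Submodule.smul_mem _ _ (commSpan_mono (by omega) hk))

namespace ShiftSystem

variable {D : M → R → R} {σ : M →ₗ⁅𝕜⁆ M} {T : Submodule 𝕜 M} {e e' : R}

theorem lie_tri₀ (h : ShiftSystem D σ T α s₀ s₁ e e') (n : ℕ) (k : ℕ)
    (hk : k < n + n / 2 + 2) : ⁅s₀, tri α s₀ s₁ k⁆ ∈ triSpan α s₀ s₁ (n + 1) := by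
  revert hk
  refine cases_mod_three (p := fun k => k < n + n / 2 + 2 →
    ⁅s₀, tri α s₀ s₁ k⁆ ∈ triSpan α s₀ s₁ (n + 1)) ?_ ?_ ?_ ?_ ?_ k
  · intro _
    rw [tri_zero, lie_self]
    exact Submodule.zero_mem _
  · intro _
    have h1 : ⁅s₀, s₁⁆ = tri α s₀ s₁ 2 - α • tri α s₀ s₁ 0 - α • tri α s₀ s₁ 1 := by
      have := tri_odd α s₀ s₁ 0
      simp only [Nat.mul_zero, Nat.zero_add] at this
      rw [this, tri_zero, tri_one, pSeq]
      abel
    rw [tri_one, h1]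
    exact Submodule.sub_mem _ (Submodule.sub_mem _ (tri_mem_triSpan (by omega))
      (Submodule.smul_mem _ _ (tri_mem_triSpan (by omega))))
      (Submodule.smul_mem _ _ (tri_mem_triSpan (by omega)))
  · intro j hj
    rw [tri_odd, ← h.qSeq_even', ← tri_even']
    exact tri_mem_triSpan (by omega)
  · intro j hj
    have h1 : ⁅s₀, tri α s₀ s₁ (3 * j + 3)⁆ =
        tri α s₀ s₁ (3 * (j + 1) + 2) - α • tri α s₀ s₁ (3 * j + 3) := by
      rw [tri_odd, tri_even, show 2 * (j + 1) + 1 = 2 * j + 3 by ring, pSeq_odd]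
      abel
    rw [h1]
    exact Submodule.sub_mem _ (tri_mem_triSpan (by omega))
      (Submodule.smul_mem _ _ (tri_mem_triSpan (by omega)))
  · intro j hj
    rw [tri_even', h.lie_qSeq_even, ← tri_even']
    exact Submodule.smul_mem _ _ (tri_mem_triSpan (by omega))

theorem lie_tri₁ (h : ShiftSystem D σ T α s₀ s₁ e e') (n : ℕ) (k : ℕ)
    (hk : k < n + n / 2 + 2) : ⁅s₁, tri α s₀ s₁ k⁆ ∈ triSpan α s₀ s₁ (n + 1) := by
  revert hk
  refine cases_mod_three (p := fun k => k < n + n / 2 + 2 →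
    ⁅s₁, tri α s₀ s₁ k⁆ ∈ triSpan α s₀ s₁ (n + 1)) ?_ ?_ ?_ ?_ ?_ k
  · intro _
    rw [tri_zero, ← lie_skew]
    have := h.lie_tri₀ n 1 (by omega)
    rw [tri_one] at this
    exact Submodule.neg_mem _ this
  · intro _
    rw [tri_one, lie_self]
    exact Submodule.zero_mem _
  · intro j hj
    rw [tri_odd, ← pSeq_even, ← tri_even]
    exact tri_mem_triSpan (by omega)
  · intro j hj
    rw [tri_even, h.lie_pSeq_even, ← tri_even]
    exact Submodule.smul_mem _ _ (tri_mem_triSpan (by omega))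
  · intro j hj
    have h1 : ⁅s₁, tri α s₀ s₁ (3 * j + 4)⁆ =
        tri α s₀ s₁ (3 * (j + 1) + 2) + α • tri α s₀ s₁ (3 * j + 4) := by
      rw [tri_odd, tri_even', h.qSeq_eq, show 2 * (j + 1) + 1 = 2 * j + 3 by ring, qSeq_odd]
      abel
    rw [h1]
    exact Submodule.add_mem _ (tri_mem_triSpan (by omega))
      (Submodule.smul_mem _ _ (tri_mem_triSpan (by omega)))

/-- It suffices to check on the spanning fields that `⁅Y, ·⁆` raises the filtration by `j`. -/
theorem lie_mem_triSpan {Y : M} {j : ℕ}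
    (hY : ∀ (n k : ℕ), k < n + n / 2 + 2 → ⁅Y, tri α s₀ s₁ k⁆ ∈ triSpan α s₀ s₁ (n + j))
    (n : ℕ) {Z : M} (hZ : Z ∈ triSpan α s₀ s₁ n) : ⁅Y, Z⁆ ∈ triSpan α s₀ s₁ (n + j) := by
  induction hZ using Submodule.span_induction with
  | mem Z h =>
    obtain ⟨k, hk, rfl⟩ := h
    exact hY n k hk
  | zero => rw [lie_zero]; exact Submodule.zero_mem _
  | add Z W _ _ hZ hW => rw [lie_add]; exact Submodule.add_mem _ hZ hW
  | smul c Z _ hZ => rw [_root_.lie_smul]; exact Submodule.smul_mem _ c hZ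

/-- A commutator of multiplicity `m` lies in the `m`-th step of the filtration and raises it by
`m + 1`, by the Jacobi identity. -/
theorem comm_lie (h : ShiftSystem D σ T α s₀ s₁ e e') {m : ℕ} {Y : M} (hY : Comm s₀ s₁ m Y) :
    Y ∈ triSpan α s₀ s₁ m ∧
      ∀ n, ∀ Z ∈ triSpan α s₀ s₁ n, ⁅Y, Z⁆ ∈ triSpan α s₀ s₁ (n + m + 1) := by
  induction hY with
  | left =>
    refine ⟨?_, fun n Z hZ => lie_mem_triSpan h.lie_tri₀ n hZ⟩
    have := tri_mem_triSpan (α := α) (s₀ := s₀) (s₁ := s₁) (n := 0) (k := 0) (by omega)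
    rwa [tri_zero] at this
  | right =>
    refine ⟨?_, fun n Z hZ => lie_mem_triSpan h.lie_tri₁ n hZ⟩
    have := tri_mem_triSpan (α := α) (s₀ := s₀) (s₁ := s₁) (n := 0) (k := 1) (by omega)
    rwa [tri_one] at this
  | @bracket m n Y Z _ _ hY hZ =>
    refine ⟨triSpan_mono (by omega) (hY.2 n Z hZ.1), fun k W hW => ?_⟩
    rw [lie_lie]
    exact Submodule.sub_mem _ (triSpan_mono (by omega) (hY.2 _ _ (hZ.2 k W hW)))
      (triSpan_mono (by omega) (hZ.2 _ _ (hY.2 k W hW)))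

/-- The filtration by the fields `tri` is the filtration by multiplicity of commutators. -/
theorem triSpan_eq (h : ShiftSystem D σ T α s₀ s₁ e e') (n : ℕ) :
    triSpan α s₀ s₁ n = commSpan 𝕜 s₀ s₁ n := by
  refine le_antisymm (Submodule.span_le.2 ?_) (Submodule.span_le.2 ?_)
  · rintro _ ⟨k, hk, rfl⟩
    revert hk
    refine cases_mod_three (p := fun k => k < n + n / 2 + 2 →
      tri α s₀ s₁ k ∈ commSpan 𝕜 s₀ s₁ n) ?_ ?_ ?_ ?_ ?_ k
    · intro _
      rw [tri_zero]
      exact Submodule.subset_span ⟨0, by omega, Comm.left⟩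
    · intro _
      rw [tri_one]
      exact Submodule.subset_span ⟨0, by omega, Comm.right⟩
    · intro j hj
      rw [tri_odd]
      exact commSpan_mono (by omega) (pSeq_mem_commSpan _)
    · intro j hj
      rw [tri_even]
      exact commSpan_mono (by omega) (pSeq_mem_commSpan _)
    · intro j hj
      rw [tri_even', h.qSeq_even']
      exact commSpan_mono (by omega) (lie_mem_commSpan Comm.left (pSeq_mem_commSpan _))
  · rintro Z ⟨m, hm, hZ⟩
    exact triSpan_mono hm (h.comm_lie hZ).1

end ShiftSystem

end Sequences

/-! ### The fields `S₀`, `S₁` and conjugation by the shift -/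

section Concrete

variable {𝕜 : Type*} [RCLike 𝕜]

@[simp] theorem shift_coord (j : ℤ) : shift 𝕜 (coord j) = coord (j + 1) := rfl

theorem shift_expF (f : Fn 𝕜 ℤ) : shift 𝕜 (expF f) = expF (shift 𝕜 f) := rfl

theorem conj_apply (Z : VF 𝕜 ℤ) (F : Fn 𝕜 ℤ) :
    conj Z F = shift 𝕜 (Z ((shift 𝕜).symm F)) := rfl

theorem conj_coord (Z : VF 𝕜 ℤ) (j : ℤ) : conj Z (coord j) = shift 𝕜 (Z (coord (j - 1))) := rfl

theorem partialVF_shift (i : ℤ) (F : Fn 𝕜 ℤ) :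
    partialVF 𝕜 i (shift 𝕜 F) = shift 𝕜 (partialVF 𝕜 (i - 1) F) := by
  refine Fn.ext fun p => ?_
  change deriv (fun h => F.1 fun j => Function.update p i h (j + 1)) (p i) =
    deriv (fun h => F.1 (Function.update (fun j => p (j + 1)) (i - 1) h)) (p (i - 1 + 1))
  rw [sub_add_cancel]
  congr 1
  funext h
  refine congrArg F.1 (funext fun j => ?_)
  by_cases hj : j = i - 1
  · subst hj; simp
  · rw [Function.update_of_ne hj, Function.update_of_ne (by omega)]

theorem partialVF_shift_symm (i : ℤ) (F : Fn 𝕜 ℤ) :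
    partialVF 𝕜 i ((shift 𝕜).symm F) = (shift 𝕜).symm (partialVF 𝕜 (i + 1) F) := by
  have := partialVF_shift (i + 1) ((shift 𝕜).symm F)
  rw [AlgEquiv.apply_symm_apply, add_sub_cancel_right] at this
  rw [this, AlgEquiv.symm_apply_apply]

theorem Formal.conj {Z : VF 𝕜 ℤ} (hZ : Formal Z) : Formal (conj Z) := by
  refine Formal.of_apply fun F s hs => ?_
  have hs' : ∀ i, i ∉ s.map (Equiv.subRight (1 : ℤ)).toEmbedding →
      partialVF 𝕜 i ((shift 𝕜).symm F) = 0 := by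
    intro i hi
    rw [partialVF_shift_symm, hs, map_zero]
    intro h
    exact hi (Finset.mem_map.2 ⟨i + 1, h, by simp⟩)
  rw [conj_apply, hZ.apply hs', map_sum, Finset.sum_map]
  refine Finset.sum_congr rfl fun i _ => ?_
  rw [map_mul, conj_coord, partialVF_shift_symm, AlgEquiv.apply_symm_apply]
  simp

/-- Conjugation by the shift as a homomorphism of Lie algebras. -/
def conjHom (𝕜 : Type*) [RCLike 𝕜] : VF 𝕜 ℤ →ₗ⁅𝕜⁆ VF 𝕜 ℤ where
  toFun := DarbouxChain.conj
  map_add' Z W := Derivation.ext fun F => map_add (shift 𝕜) _ _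
  map_smul' c Z := Derivation.ext fun F => map_smul (shift 𝕜) c _
  map_lie' {Z W} := Derivation.ext fun F => by
    change shift 𝕜 (⁅Z, W⁆ ((shift 𝕜).symm F)) = _
    rw [Derivation.commutator_apply, Derivation.commutator_apply, map_sub]
    simp only [conj_apply, AlgEquiv.symm_apply_apply]

theorem rho_zero : (rho 0 : Fn 𝕜 ℤ) = 0 := by rw [rho, tele_zero, neg_zero]

theorem rho_add_one (j : ℤ) : (rho (j + 1) : Fn 𝕜 ℤ) = rho j - coord j := by
  rw [rho, rho, tele_add_one]; ring

theorem rho_neg_one : (rho (-1) : Fn 𝕜 ℤ) = coord (-1) := by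
  have := rho_add_one (𝕜 := 𝕜) (-1)
  rw [show (-1 : ℤ) + 1 = 0 by norm_num, rho_zero] at this
  linear_combination -this

/-- Two sequences indexed by `ℤ` with the same value at `0` and the same increments coincide. -/
theorem int_ext {A : Type*} [AddCommGroup A] {f g : ℤ → A} (h0 : f 0 = g 0)
    (h : ∀ j, f (j + 1) - f j = g (j + 1) - g j) (j : ℤ) : f j = g j := by
  have h' : ∀ j, f j = g j ↔ f (j + 1) = g (j + 1) := fun j => by
    have := h j
    constructor
    · intro e; rw [e] at this; exact sub_left_injective this
    · intro e; rw [e] at this; exact sub_right_injective this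
  induction j using Int.induction_on with
  | zero => exact h0
  | succ n ih => exact (h' _).1 ih
  | pred n ih => refine (h' _).2 ?_; rw [sub_add_cancel]; exact ih

theorem shift_rho (j : ℤ) : shift 𝕜 (rho j) = rho (j + 1) + coord 0 := by
  refine int_ext (f := fun j => shift 𝕜 (rho j)) (g := fun j => rho (j + 1) + coord 0) ?_ ?_ j
  · simp only [rho_add_one, rho_zero, map_zero]; ring
  · intro j
    simp only [rho_add_one, map_sub, shift_coord]; ring

/-- The function `e^{α ρ_j}`. -/
noncomputable def expRho (α : 𝕜) (j : ℤ) : Fn 𝕜 ℤ := expF (α • rho j)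

theorem smul_coord_mul (α : 𝕜) (f g : Fn 𝕜 ℤ) :
    expF (α • f) * expF (α • g) = expF (α • (f + g)) := by
  rw [smul_add, expF_add]

theorem expRho_zero (α : 𝕜) : expRho α 0 = 1 := by
  rw [expRho, rho_zero, smul_zero, expF_zero]

theorem expRho_one (α : 𝕜) : expRho α 1 = eTau (-α) := by
  rw [expRho, show (1 : ℤ) = 0 + 1 by norm_num, rho_add_one, rho_zero, zero_sub, smul_neg, eTau,
    neg_smul]

theorem shift_expRho (α : 𝕜) (j : ℤ) : shift 𝕜 (expRho α j) = eTau α * expRho α (j + 1) := by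
  rw [expRho, shift_expF, map_smul, shift_rho, expRho, eTau, smul_coord_mul, add_comm]

theorem S₀_coord (α : 𝕜) (j : ℤ) : S₀ α (coord j) = expRho α (j + 1) + expRho α j := by
  rw [S₀, vectorField_coord, add_mul, one_mul, ← expF_add, expRho, rho_add_one, smul_sub,
    sub_eq_neg_add, expRho]

theorem S₁_eq (α : 𝕜) : S₁ α = S₀ (-α) := by
  rw [S₀, S₁]
  congr 1
  funext j
  rw [neg_smul, neg_neg, neg_smul]

theorem formal_S₀ (α : 𝕜) : Formal (S₀ α) := formal_vectorField _

theorem formal_S₁ (α : 𝕜) : Formal (S₁ α) := formal_vectorField _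

theorem eTau_mul (α : 𝕜) : eTau α * eTau (-α) = 1 := by
  rw [eTau, eTau, neg_smul, expF_mul_neg]

theorem conj_S₀ (α : 𝕜) : conj (S₀ α) = eTau α • S₀ α := by
  refine (formal_S₀ α).conj.ext ((formal_S₀ α).fsmul _) fun j => ?_
  rw [conj_coord, S₀_coord, map_add, shift_expRho, shift_expRho, Derivation.smul_apply, S₀_coord,
    smul_eq_mul, sub_add_cancel, mul_add]

theorem conj_S₁ (α : 𝕜) : conj (S₁ α) = eTau (-α) • S₁ α := by
  rw [S₁_eq, conj_S₀]

theorem Formal.apply_eTau {Z : VF 𝕜 ℤ} (hZ : Formal Z) (α : 𝕜) :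
    Z (eTau α) = algebraMap 𝕜 (Fn 𝕜 ℤ) α * Z (coord 0) * eTau α := by
  rw [eTau, hZ.apply_expF, Derivation.map_smul, Algebra.smul_def]

theorem S₀_eTau (α : 𝕜) :
    S₀ α (eTau α) = algebraMap 𝕜 (Fn 𝕜 ℤ) α * (eTau α + 1) := by
  rw [(formal_S₀ α).apply_eTau, S₀_coord, expRho_zero, show (0 : ℤ) + 1 = 1 by norm_num, expRho_one]
  linear_combination algebraMap 𝕜 (Fn 𝕜 ℤ) α * eTau_mul α

theorem S₀_eTau_neg (α : 𝕜) :
    S₀ α (eTau (-α)) = -algebraMap 𝕜 (Fn 𝕜 ℤ) α * (eTau (-α) + eTau (-α) ^ 2) := by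
  rw [(formal_S₀ α).apply_eTau, S₀_coord, expRho_zero, show (0 : ℤ) + 1 = 1 by norm_num, expRho_one,
    map_neg]
  ring

theorem S₀_coord_neg_one (α : 𝕜) : S₀ α (coord (-1)) = 1 + expF (α • coord (-1)) := by
  rw [S₀_coord, show (-1 : ℤ) + 1 = 0 by norm_num, expRho_zero, expRho, rho_neg_one]

/-- The formal vector fields that annihilate `τ_{-1}`. -/
def tauFree (𝕜 : Type*) [RCLike 𝕜] : Submodule 𝕜 (VF 𝕜 ℤ) where
  carrier := {Z | Formal Z ∧ Z (coord (-1)) = 0}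
  add_mem' {Z W} hZ hW := ⟨hZ.1.add hW.1, by rw [Derivation.add_apply, hZ.2, hW.2, add_zero]⟩
  zero_mem' := ⟨formal_zero, rfl⟩
  smul_mem' c Z hZ := ⟨hZ.1.smul c, by rw [Derivation.smul_apply, hZ.2, smul_zero]⟩

theorem S₀_lie_mem {α : 𝕜} {Z : VF 𝕜 ℤ} (hZ : Z ∈ tauFree 𝕜) : ⁅S₀ α, Z⁆ ∈ tauFree 𝕜 := by
  refine ⟨(formal_S₀ α).lie hZ.1, ?_⟩
  rw [Derivation.commutator_apply, hZ.2, map_zero, S₀_coord_neg_one, map_add,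
    Derivation.map_one_eq_zero, hZ.1.apply_expF, Derivation.map_smul, hZ.2]
  simp

theorem conj_eTau {Z : VF 𝕜 ℤ} (hZ : Z ∈ tauFree 𝕜) (α : 𝕜) : conj Z (eTau α) = 0 := by
  rw [hZ.1.conj.apply_eTau, conj_coord, zero_sub, hZ.2, map_zero, mul_zero, zero_mul]

/-- A field without `∂/∂τ_{-1}` that the shift multiplies by a nonzero function vanishes: its
coefficients vanish successively in both directions. -/
theorem eq_zero_of_conj {Z : VF 𝕜 ℤ} (hZ : Z ∈ tauFree 𝕜) {u : Fn 𝕜 ℤ} (hu : u ≠ 0)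
    (h : conj Z = u • Z) : Z = 0 := by
  have key : ∀ j, shift 𝕜 (Z (coord j)) = u * Z (coord (j + 1)) := fun j => by
    have := congrArg (fun W : VF 𝕜 ℤ => W (coord (j + 1))) h
    simp only [conj_coord, add_sub_cancel_right] at this
    exact this
  refine hZ.1.ext formal_zero fun j => ?_
  change Z (coord j) = 0
  have : ∀ j : ℤ, Z (coord (j - 1)) = 0 := by
    intro j
    induction j using Int.induction_on with
    | zero => rw [zero_sub]; exact hZ.2
    | succ n ih =>
      have h1 := key (n - 1)
      rw [ih, map_zero, sub_add_cancel] at h1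
      rw [add_sub_cancel_right]
      exact (mul_eq_zero.1 h1.symm).resolve_left hu
    | pred n ih =>
      have h1 := key (-n - 1 - 1)
      rw [sub_add_cancel, ih, mul_zero] at h1
      exact (map_eq_zero_iff _ (shift 𝕜).injective).1 h1
  have h2 := this (j + 1)
  rwa [add_sub_cancel_right] at h2

theorem first_mem (α : 𝕜) : ⁅S₀ α, S₁ α⁆ + α • S₀ α + α • S₁ α ∈ tauFree 𝕜 := by
  refine ⟨(((formal_S₀ α).lie (formal_S₁ α)).add ((formal_S₀ α).smul α)).add
    ((formal_S₁ α).smul α), ?_⟩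
  have h1 : expF (α • coord (-1)) * expF (-α • coord (-1)) = (1 : Fn 𝕜 ℤ) := by
    rw [neg_smul, expF_mul_neg]
  rw [Derivation.add_apply, Derivation.add_apply, Derivation.smul_apply, Derivation.smul_apply,
    Derivation.commutator_apply, S₁_eq, S₀_coord_neg_one, S₀_coord_neg_one, map_add, map_add,
    Derivation.map_one_eq_zero, Derivation.map_one_eq_zero, (formal_S₀ α).apply_expF,
    (formal_S₀ (-α)).apply_expF, Derivation.map_smul, Derivation.map_smul, S₀_coord_neg_one,
    S₀_coord_neg_one]
  simp only [Algebra.smul_def (A := Fn 𝕜 ℤ), map_neg] at h1 ⊢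
  linear_combination (-2 * algebraMap 𝕜 (Fn 𝕜 ℤ) α) * h1

/-- The module structure of vector fields over functions, on the additive group underlying the Lie
ring of vector fields. -/
@[reducible] def vfModule (𝕜 : Type*) [RCLike 𝕜] (ι : Type*) :
    @Module (Fn 𝕜 ι) (VF 𝕜 ι) _
      (inferInstance : LieRing (VF 𝕜 ι)).toAddCommGroup.toAddCommMonoid :=
  inferInstanceAs (Module (Fn 𝕜 ι) (VF 𝕜 ι))

attribute [local instance] vfModule

theorem shiftSystem (α : 𝕜) :
    ShiftSystem (fun (Z : VF 𝕜 ℤ) (f : Fn 𝕜 ℤ) => Z f) (conjHom 𝕜) (tauFree 𝕜) α (S₀ α) (S₁ α)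
      (eTau α) (eTau (-α)) where
  mul_inv := eTau_mul α
  lie_smul := lie_fsmul
  D_smul _ _ _ := rfl
  map₀ := conj_S₀ α
  map₁ := conj_S₁ α
  D₀ := S₀_eTau α
  D₁ := by
    have := S₀_eTau_neg (-α)
    rw [neg_neg, map_neg, neg_neg] at this
    rw [S₁_eq, this]
  D₀' := S₀_eTau_neg α
  D₁' := by
    have := S₀_eTau (-α)
    rw [map_neg] at this
    rw [S₁_eq, this]
  mem := first_mem α
  lie_mem₀ _ hZ := S₀_lie_mem hZ
  lie_mem₁ _ hZ := by rw [S₁_eq]; exact S₀_lie_mem hZ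
  D_map _ hZ := conj_eTau hZ α
  D_map' _ hZ := conj_eTau hZ (-α)
  eq_zero _ hZ _ hu h := eq_zero_of_conj hZ hu.ne_zero h

theorem P_eq (α : 𝕜) : ∀ k : ℕ, P α k = pSeq α (S₀ α) (S₁ α) k
  | 0 => rfl
  | 1 => rfl
  | k + 2 => by
    rw [P, pSeq, P_eq α (k + 1)]

theorem Q_eq (α : 𝕜) : ∀ k : ℕ, Q α k = qSeq α (S₀ α) (S₁ α) k
  | 0 => rfl
  | 1 => rfl
  | k + 2 => by
    rw [Q, qSeq, Q_eq α (k + 1)]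

theorem isCommutator_iff (α : 𝕜) (n : ℕ) (Z : VF 𝕜 ℤ) :
    IsCommutator α n Z ↔ Comm (S₀ α) (S₁ α) n Z := by
  constructor <;> intro h
  · induction h with
    | left => exact Comm.left
    | right => exact Comm.right
    | bracket _ _ h1 h2 => exact h1.bracket h2
  · induction h with
    | left => exact IsCommutator.left
    | right => exact IsCommutator.right
    | bracket _ _ h1 h2 => exact h1.bracket h2

theorem V_eq (α : 𝕜) (n : ℕ) : V α n = triSpan α (S₀ α) (S₁ α) n := by
  refine Eq.trans ?_ ((shiftSystem α).triSpan_eq n).symm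
  simp only [V, commSpan, isCommutator_iff]

end Concrete

/-! ### Linear independence over a domain and over functions -/

section Certificate

variable {R : Type*} [CommRing R] [IsDomain R]

/-- Finitely many vectors with infinitely many components, linearly independent over a domain, are
separated by finitely many components: some matrix with finitely many columns inverts them from the
left up to a nonzero factor. -/
theorem exists_left_inverse {J I : Type*} [Fintype J] [DecidableEq J] {v : J → I → R}
    (hv : LinearIndependent R v) :
    ∃ (s : Finset I) (b : J → I → R) (d : R), d ≠ 0 ∧
      ∀ j k, ∑ i ∈ s, b j i * v k i = if j = k then d else 0 := by
  classical
  let K := FractionRing R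
  let φ : R →+* K := algebraMap R K
  have hφ : Function.Injective φ := IsFractionRing.injective R K
  let m : (I → R) →ₗ[R] (I → K) := (Algebra.linearMap R K).compLeft I
  have hm : LinearMap.ker m = ⊥ := by
    rw [LinearMap.ker_eq_bot]
    intro x y h
    funext i
    exact hφ (congrFun h i)
  have hv' : LinearIndependent K (fun k : J => m (v k)) :=
    (hv.map' m hm).localization K (nonZeroDivisors R)
  -- The columns span `K ^ J`, since a functional vanishing on them is a linear relation.
  have hspan : Submodule.span K (Set.range fun (i : I) (k : J) => φ (v k i)) = ⊤ := by
    by_contra hne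
    obtain ⟨f, hf, hker⟩ := Submodule.exists_le_ker_of_lt_top _ (lt_top_iff_ne_top.2 hne)
    apply hf
    have hrel : ∑ k, f (Pi.single k 1) • m (v k) = 0 := by
      funext i
      have h1 : f (fun k => φ (v k i)) = 0 := hker (Submodule.subset_span ⟨i, rfl⟩)
      rw [LinearMap.pi_apply_eq_sum_univ f] at h1
      rw [Finset.sum_apply, Pi.zero_apply, ← h1]
      refine Finset.sum_congr rfl fun k _ => ?_
      rw [Pi.smul_apply, smul_eq_mul, smul_eq_mul, mul_comm]
      refine congrArg₂ _ rfl (congrArg f ?_)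
      funext l
      simp [Pi.single_apply, eq_comm]
    have h2 := Fintype.linearIndependent_iff.1 hv' _ hrel
    exact LinearMap.pi_ext' fun k => LinearMap.ext_ring (h2 k)
  have hc : ∀ j : J, ∃ c : I →₀ K, (c.sum fun i a => a • fun k : J => φ (v k i)) = Pi.single j 1 :=
    fun j => Finsupp.mem_span_range_iff_exists_finsupp.1 (by rw [hspan]; trivial)
  choose c hc using hc
  let s : Finset I := Finset.univ.biUnion fun j => (c j).support
  obtain ⟨d, hd⟩ := IsLocalization.exist_integer_multiples_of_finset (nonZeroDivisors R)
    ((Finset.univ ×ˢ s).image fun x : J × I => c x.1 x.2)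
  have hd' : ∀ j, ∀ i, ∃ b : R, i ∈ s → φ b = φ d * c j i := by
    intro j i
    by_cases hi : i ∈ s
    · obtain ⟨b, hb⟩ := hd (c j i) (Finset.mem_image.2 ⟨(j, i), by simp [hi], rfl⟩)
      refine ⟨b, fun _ => hb.trans ?_⟩
      exact Algebra.smul_def _ _
    · exact ⟨0, fun h => absurd h hi⟩
  choose b hb using hd'
  refine ⟨s, b, d, nonZeroDivisors.coe_ne_zero d, fun j k => hφ ?_⟩
  have h1 := congrFun (hc j) k
  rw [Finsupp.sum, Finset.sum_apply, Finset.sum_subset (s₂ := s)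
    (Finset.subset_biUnion_of_mem (fun j => (c j).support) (Finset.mem_univ j)) (by
      intro i _ hi
      rw [Finsupp.notMem_support_iff.1 hi, zero_smul, Pi.zero_apply])] at h1
  rw [map_sum]
  have h2 : ∑ i ∈ s, φ (b j i * v k i) = φ d * (Pi.single j (1 : K) : J → K) k := by
    rw [← h1, Finset.mul_sum]
    refine Finset.sum_congr rfl fun i hi => ?_
    rw [map_mul, hb j i hi, Pi.smul_apply, smul_eq_mul, mul_assoc]
  rw [h2, Pi.single_apply]
  by_cases hjk : j = k
  · rw [if_pos hjk.symm, if_pos hjk, mul_one]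
  · rw [if_neg fun h => hjk h.symm, if_neg hjk, mul_zero, map_zero]

end Certificate

section Independence

variable {𝕜 : Type*} [RCLike 𝕜]

/-- The coefficients of a vector field. -/
def coeffs {ι : Type*} (Z : VF 𝕜 ι) : ι → Fn 𝕜 ι := fun i => Z (coord i)

theorem Fn.sum_apply {ι J : Type*} (s : Finset J) (G : J → Fn 𝕜 ι) (p : ι → 𝕜) :
    (∑ i ∈ s, G i).1 p = ∑ i ∈ s, (G i).1 p := by
  rw [AddSubmonoidClass.coe_finsetSum, Finset.sum_apply]

/-- Linear independence of the coefficients over the ring of everywhere defined functions excludes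
linear relations on any region. -/
theorem fnIndep_of_linearIndependent {ι J : Type*} {Z : J → VF 𝕜 ι}
    (h : LinearIndependent (Fn 𝕜 ι) fun j => coeffs (Z j)) : FnIndep Z := by
  classical
  intro K U hU _ hdep
  obtain ⟨s, b, d, hd, hb⟩ := exists_left_inverse (h.comp (fun j : K => (j : J))
    Subtype.val_injective)
  obtain ⟨c, hc, ⟨j, p, hp, hne⟩, hrel⟩ := hdep s
  refine hne (Fn.eq_zero_of_mul_eq_zero hd hU (hc j).continuousOn (fun q hq => ?_) p hp)
  have h1 : ∑ i ∈ s, (b j i).1 q * ∑ k : K, c k q * (Z k (coord i)).1 q = 0 :=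
    Finset.sum_eq_zero fun i hi => by rw [hrel q hq i hi, mul_zero]
  simp only [Finset.mul_sum] at h1
  rw [Finset.sum_comm] at h1
  have h2 : ∀ k : K, ∑ i ∈ s, (b j i).1 q * (c k q * (Z k (coord i)).1 q) =
      c k q * (if j = k then d else 0 : Fn 𝕜 ι).1 q := by
    intro k
    rw [← hb j k, Fn.sum_apply, Finset.mul_sum]
    refine Finset.sum_congr rfl fun i _ => ?_
    change _ = c k q * ((b j i).1 q * (Z k (coord i)).1 q)
    ring
  simp only [h2] at h1
  rw [Finset.sum_eq_single j] at h1
  · rw [if_pos rfl] at h1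
    rw [mul_comm]
    exact h1
  · intro k _ hk
    rw [if_neg (Ne.symm hk)]
    exact mul_zero _
  · intro hj
    exact absurd (Finset.mem_univ j) hj

theorem eTau_add (a b : 𝕜) : eTau a * eTau b = eTau (a + b) := by
  rw [eTau, eTau, eTau, ← expF_add, add_smul]

theorem partialVF_eTau (i : ℤ) (γ : 𝕜) : partialVF 𝕜 i (eTau γ) =
    if i = 0 then algebraMap 𝕜 (Fn 𝕜 ℤ) γ * eTau γ else 0 := by
  rw [(formal_partialVF i).apply_eTau, partialVF_coord]
  split_ifs <;> simp

/-- The equation `D a = e^{γ τ} (a + β)` for a quotient `a = f / g` of functions has only the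
solution `a = 0`, and this only for `β = 0`. The derivatives `∂_i a` with `i ≠ 0` satisfy
`D (∂_{i-1} a) = e^{γ τ} ∂_i a`, hence vanish as `a` depends on finitely many variables; then so
does the derivative `γ e^{γ τ} (a + β)` of the right-hand side in `τ_0`. -/
theorem shift_ratio {f g : Fn 𝕜 ℤ} {γ β : 𝕜} (hγ : γ ≠ 0) (hg : g ≠ 0)
    (h : shift 𝕜 f * g = eTau γ * (shift 𝕜 g * (f + algebraMap 𝕜 (Fn 𝕜 ℤ) β * g))) :
    f = 0 ∧ β = 0 := by
  set D := shift 𝕜 with hD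
  have hDinj : Function.Injective D := (shift 𝕜).injective
  have hDg : D g ≠ 0 := fun h0 => hg (hDinj (by rw [h0, map_zero]))
  have he : (eTau γ : Fn 𝕜 ℤ) ≠ 0 := expF_ne_zero _
  set W : ℤ → Fn 𝕜 ℤ := fun i => partialVF 𝕜 i f * g - f * partialVF 𝕜 i g with hW
  set b : Fn 𝕜 ℤ := algebraMap 𝕜 (Fn 𝕜 ℤ) β with hb
  have key : ∀ i, g ^ 2 * D (W (i - 1)) = eTau γ * (D g) ^ 2 * W i +
      partialVF 𝕜 i (eTau γ) * ((D g) ^ 2 * (f + b * g) * g) := by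
    intro i
    have hd := congrArg (partialVF 𝕜 i) h
    simp only [Derivation.leibniz, map_add, smul_eq_mul, hD, partialVF_shift, hb,
      Derivation.map_algebraMap, mul_zero, add_zero] at hd
    simp only [hW, map_sub, map_mul, hD]
    linear_combination (g * shift 𝕜 g) * hd -
      (g * shift 𝕜 (partialVF 𝕜 (i - 1) g) + shift 𝕜 g * partialVF 𝕜 i g) * h
  have hiff : ∀ i, i ≠ 0 → (W (i - 1) = 0 ↔ W i = 0) := by
    intro i hi
    have hk := key i
    rw [partialVF_eTau, if_neg hi, zero_mul, add_zero] at hk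
    constructor
    · intro h0
      rw [h0, map_zero, mul_zero] at hk
      exact (mul_eq_zero.1 hk.symm).resolve_left (mul_ne_zero he (pow_ne_zero 2 hDg))
    · intro h0
      rw [h0, mul_zero] at hk
      exact (map_eq_zero_iff D hDinj).1 ((mul_eq_zero.1 hk).resolve_left (pow_ne_zero 2 hg))
  have hfin : {i | W i ≠ 0}.Finite := by
    obtain ⟨s, hs⟩ := f.exists_support
    obtain ⟨t, ht⟩ := g.exists_support
    refine (s ∪ t).finite_toSet.subset fun i hi => ?_
    by_contra hst
    rw [Finset.mem_coe, Finset.mem_union, not_or] at hst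
    exact hi (by simp only [hW, hs i hst.1, ht i hst.2]; ring)
  have h0 : W 0 = 0 := by
    by_contra hne
    have : ∀ n : ℕ, W n ≠ 0 := by
      intro n
      induction n with
      | zero => exact hne
      | succ n ih =>
        intro h1
        refine ih ?_
        have := (hiff (n + 1) (by omega)).2 (by exact_mod_cast h1)
        rwa [add_sub_cancel_right] at this
    exact Set.infinite_of_injective_forall_mem (f := fun n : ℕ => (n : ℤ))
      Nat.cast_injective this hfin
  have h1 : W (0 - 1) = 0 := by
    by_contra hne
    have : ∀ n : ℕ, W (0 - 1 - n) ≠ 0 := by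
      intro n
      induction n with
      | zero => simpa using hne
      | succ n ih =>
        intro h1
        refine ih ((hiff _ (by omega)).1 ?_)
        convert h1 using 2
        push_cast
        ring
    exact Set.infinite_of_injective_forall_mem (f := fun n : ℕ => (0 - 1 - n : ℤ))
      (fun a b hab => by simpa using hab) this hfin
  have h2 := key 0
  rw [h0, h1, map_zero, mul_zero, mul_zero, zero_add, partialVF_eTau, if_pos rfl] at h2
  have hγ' : algebraMap 𝕜 (Fn 𝕜 ℤ) γ ≠ 0 := by
    rwa [Ne, map_eq_zero_iff _ (algebraMap 𝕜 (Fn 𝕜 ℤ)).injective]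
  have h3 : f + b * g = 0 := by
    have h4 := (mul_eq_zero.1 h2.symm).resolve_left (mul_ne_zero hγ' he)
    have h5 := (mul_eq_zero.1 h4).resolve_right hg
    exact (mul_eq_zero.1 h5).resolve_left (pow_ne_zero 2 hDg)
  rw [h3, mul_zero, mul_zero] at h
  have hf : f = 0 := (map_eq_zero_iff D hDinj).1 ((mul_eq_zero.1 h).resolve_right hg)
  refine ⟨hf, ?_⟩
  rw [hf, zero_add] at h3
  exact (map_eq_zero_iff _ (algebraMap 𝕜 (Fn 𝕜 ℤ)).injective).1
    ((mul_eq_zero.1 h3).resolve_right hg)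

/-- Evaluation of vector fields at a function, as an additive map. -/
def evalAt {ι : Type*} (F : Fn 𝕜 ι) : VF 𝕜 ι →+ Fn 𝕜 ι where
  toFun Z := Z F
  map_zero' := rfl
  map_add' _ _ := rfl

theorem sum_apply_coord {ι J : Type*} (s : Finset J) (Z : J → VF 𝕜 ι) (F : Fn 𝕜 ι) :
    (∑ j ∈ s, Z j) F = ∑ j ∈ s, Z j F := map_sum (evalAt F) Z s

/-- A linear relation of minimal length between vectors on which the shift acts by a triangular
matrix: subtracting from its shift a multiple of the relation itself leaves a shorter relation, whose
coefficients therefore vanish. -/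
theorem shift_relation {v : ℕ → ℤ → Fn 𝕜 ℤ} {u : ℕ → Fn 𝕜 ℤ} {C : ℕ → ℕ → Fn 𝕜 ℤ}
    (hv : ∀ N i, shift 𝕜 (v N (i - 1)) = u N * ∑ k ∈ Finset.range (N + 1), C N k * v k i)
    (hC : ∀ N, C N N = 1) {N : ℕ}
    (ih : ∀ f : ℕ → Fn 𝕜 ℤ, (∀ i, ∑ k ∈ Finset.range N, f k * v k i = 0) → ∀ k < N, f k = 0)
    {f : ℕ → Fn 𝕜 ℤ} (hf : ∀ i, ∑ k ∈ Finset.range (N + 1), f k * v k i = 0) {j : ℕ} (hj : j < N) :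
    f N * ∑ k ∈ Finset.Icc j N, shift 𝕜 (f k) * u k * C k j = shift 𝕜 (f N) * u N * f j := by
  set h : ℕ → Fn 𝕜 ℤ := fun j => ∑ k ∈ Finset.Icc j N, shift 𝕜 (f k) * u k * C k j with hh
  have h1 : ∀ i, ∑ j ∈ Finset.range (N + 1), h j * v j i = 0 := by
    intro i
    have h2 := congrArg (shift 𝕜) (hf (i - 1))
    rw [map_sum, map_zero] at h2
    rw [← h2]
    simp only [map_mul, hv, hh, Finset.sum_mul, Finset.mul_sum]
    rw [Finset.sum_sigma', Finset.sum_sigma']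
    refine Finset.sum_bij' (fun x _ => ⟨x.2, x.1⟩) (fun x _ => ⟨x.2, x.1⟩) ?_ ?_ ?_ ?_ ?_
    · rintro ⟨a, b⟩ hab
      simp only [Finset.mem_sigma, Finset.mem_range, Finset.mem_Icc] at hab ⊢
      omega
    · rintro ⟨a, b⟩ hab
      simp only [Finset.mem_sigma, Finset.mem_range, Finset.mem_Icc] at hab ⊢
      omega
    · intro _ _; rfl
    · intro _ _; rfl
    · rintro ⟨a, b⟩ _
      dsimp only
      ring
  have hN : h N = shift 𝕜 (f N) * u N := by
    simp only [hh, Finset.Icc_self, Finset.sum_singleton, hC, mul_one]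
  have h3 := ih (fun j => f N * h j - h N * f j) (fun i => by
    have h4 : ∑ j ∈ Finset.range (N + 1), (f N * h j - h N * f j) * v j i = 0 := by
      have h5 : ∀ j, (f N * h j - h N * f j) * v j i =
          f N * (h j * v j i) - h N * (f j * v j i) := fun j => by ring
      simp only [h5]
      rw [Finset.sum_sub_distrib, ← Finset.mul_sum, ← Finset.mul_sum, h1, hf, mul_zero, mul_zero,
        sub_zero]
    rw [Finset.sum_range_succ] at h4
    rw [← h4]
    ring) j hj
  rw [hN] at h3
  exact sub_eq_zero.1 h3

/-- The vectors of coefficients of `S₀, S₁, P_1, P_2, Q_2, P_3, …`. -/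
noncomputable def triCoeff (α : 𝕜) (k : ℕ) (i : ℤ) : Fn 𝕜 ℤ := tri α (S₀ α) (S₁ α) k (coord i)

attribute [local instance] vfModule in
/-- The triangular action of the shift on the vectors `triCoeff`. -/
theorem exists_triCoeff (α : 𝕜) : ∃ (u : ℕ → Fn 𝕜 ℤ) (C : ℕ → ℕ → 𝕜),
    (∀ N i, shift 𝕜 (triCoeff α N (i - 1)) = u N * ∑ k ∈ Finset.range (N + 1),
      algebraMap 𝕜 (Fn 𝕜 ℤ) (C N k) * triCoeff α k i) ∧
      (∀ N, u N ≠ 0) ∧ (∀ N, C N N = 1) ∧ u 0 = eTau α ∧ u 1 = eTau (-α) ∧ C 1 0 = 0 ∧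
      (∀ n, u (3 * n + 2) = 1 ∧ u (3 * n + 3) = eTau (-α) ∧ u (3 * n + 4) = eTau α) ∧
      (∀ n, C (3 * n + 2) (3 * n + 1) = 2 * α ∨ C (3 * n + 2) (3 * n + 1) = -2 * α) ∧
      ∀ n, C (3 * n + 3) (3 * n + 2) = 2 * α ∧ C (3 * n + 4) (3 * n + 3) = 0 ∧
        C (3 * n + 4) (3 * n + 2) = -2 * α := by
  obtain ⟨u, C, h1, h2, h3⟩ := (shiftSystem α).exists_triangular
  refine ⟨u, C, fun N i => ?_, fun N => (h2 N).ne_zero, h3⟩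
  have h4 : conj (tri α (S₀ α) (S₁ α) N) (coord i) =
      (u N • ∑ k ∈ Finset.range (N + 1), C N k • tri α (S₀ α) (S₁ α) k) (coord i) :=
    congrArg (evalAt (coord i)) (h1 N)
  refine h4.trans ?_
  change u N * (∑ k ∈ Finset.range (N + 1), C N k • tri α (S₀ α) (S₁ α) k) (coord i) = _
  congr 1
  refine (sum_apply_coord _ _ _).trans (Finset.sum_congr rfl fun k _ => ?_)
  exact Algebra.smul_def (A := Fn 𝕜 ℤ) (C N k) (triCoeff α k i)

theorem triCoeff_zero_ne (α : 𝕜) : triCoeff α 0 (-1) ≠ 0 := by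
  rw [triCoeff, tri_zero, S₀_coord_neg_one, add_comm]
  exact expF_add_one_ne_zero _ _

theorem triCoeff_one_ne (α : 𝕜) : triCoeff α 1 (-1) ≠ 0 := by
  rw [triCoeff, tri_one, S₁_eq, S₀_coord_neg_one, add_comm]
  exact expF_add_one_ne_zero _ _

/-- There is no relation between the first `N` vectors. By induction, the quotients of its
coefficients by the leading one would satisfy equations `D a = e^{γ τ} (a + β)`, which
`shift_ratio` excludes. -/
theorem triCoeff_relation {α : 𝕜} (hα : α ≠ 0) (N : ℕ) :
    ∀ f : ℕ → Fn 𝕜 ℤ, (∀ i, ∑ k ∈ Finset.range N, f k * triCoeff α k i = 0) →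
      ∀ k < N, f k = 0 := by
  obtain ⟨u, C, hv, hu, hC, hu0, hu1, hC1, hun, hC2, hC3⟩ := exists_triCoeff α
  have h2α : 2 * α ≠ 0 := mul_ne_zero two_ne_zero hα
  induction N with
  | zero => intro f _ k hk; omega
  | succ N ih =>
    intro f hf
    suffices hN : f N = 0 by
      intro k hk
      rcases Nat.lt_succ_iff_lt_or_eq.1 hk with hk | rfl
      · refine ih f (fun i => ?_) k hk
        have := hf i
        rwa [Finset.sum_range_succ, hN, zero_mul, add_zero] at this
      · exact hN
    by_contra hg
    have hrel := fun j hj => shift_relation (C := fun N k => algebraMap 𝕜 (Fn 𝕜 ℤ) (C N k)) hv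
      (fun N => by rw [hC, map_one]) ih hf (j := j) hj
    have e1 := eTau_mul α
    revert ih hf hg hrel
    refine cases_mod_three (p := fun N => (∀ f : ℕ → Fn 𝕜 ℤ,
      (∀ i, ∑ k ∈ Finset.range N, f k * triCoeff α k i = 0) → ∀ k < N, f k = 0) →
      (∀ i, ∑ k ∈ Finset.range (N + 1), f k * triCoeff α k i = 0) → ¬f N = 0 →
      (∀ j, j < N → f N * ∑ k ∈ Finset.Icc j N,
        shift 𝕜 (f k) * u k * algebraMap 𝕜 (Fn 𝕜 ℤ) (C k j) =
        shift 𝕜 (f N) * u N * f j) → False) ?_ ?_ ?_ ?_ ?_ N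
    · intro _ hf hg _
      have := hf (-1)
      rw [Finset.sum_range_one] at this
      exact (mul_ne_zero hg (triCoeff_zero_ne α)) this
    · intro _ hf hg hrel
      have h1 := hrel 0 one_pos
      rw [Finset.sum_Icc_succ_top (by omega), Finset.Icc_self, Finset.sum_singleton, Nat.zero_add,
        hC, hC1, hu0, hu1, map_zero, map_one] at h1
      have h2 := eTau_add (-α) (-α)
      have h3 := (shift_ratio (f := f 0) (γ := -α + -α) (β := 0)
        (by rw [← neg_add, ← two_mul]; exact neg_ne_zero.2 h2α) hg (by
          rw [← h2, map_zero]
          linear_combination (eTau (-α)) * h1 - shift 𝕜 (f 0) * f 1 * e1)).1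
      have h4 := hf (-1)
      rw [Finset.sum_range_succ, Finset.sum_range_one, h3, zero_mul, zero_add] at h4
      exact (mul_ne_zero hg (triCoeff_one_ne α)) h4
    · intro n _ hf hg hrel
      have h1 := hrel (3 * n + 1) (by omega)
      rw [Finset.sum_Icc_succ_top (by omega), Finset.Icc_self, Finset.sum_singleton,
        hC, (hun n).1, map_one] at h1
      have hu' : u (3 * n + 1) = eTau α ∨ u (3 * n + 1) = eTau (-α) := by
        cases n with
        | zero => exact Or.inr hu1
        | succ n => exact Or.inl (hun n).2.2
      have hγ : ∃ γ : 𝕜, γ ≠ 0 ∧ eTau γ * u (3 * n + 1) = 1 := by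
        rcases hu' with h | h
        · exact ⟨-α, neg_ne_zero.2 hα, by rw [h, mul_comm, e1]⟩
        · exact ⟨α, hα, by rw [h, e1]⟩
      obtain ⟨γ, hγ0, hγ⟩ := hγ
      have hc : C (3 * n + 2) (3 * n + 1) ≠ 0 := by
        rcases hC2 n with h | h
        · rwa [h]
        · rw [h, neg_mul]; exact neg_ne_zero.2 h2α
      refine hc (neg_eq_zero.1 (shift_ratio (f := f (3 * n + 1))
        (β := -C (3 * n + 2) (3 * n + 1)) hγ0 hg ?_).2)
      rw [map_neg]
      linear_combination (eTau γ) * h1 - shift 𝕜 (f (3 * n + 1)) * f (3 * n + 2) * hγ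
    · intro n _ hf hg hrel
      have h1 := hrel (3 * n + 2) (by omega)
      rw [Finset.sum_Icc_succ_top (by omega), Finset.Icc_self, Finset.sum_singleton,
        hC, (hun n).1, (hun n).2.1, map_one, (hC3 n).1] at h1
      refine neg_ne_zero.2 h2α (shift_ratio (f := f (3 * n + 2)) (β := -(2 * α))
        (neg_ne_zero.2 hα) hg ?_).2
      rw [map_neg]
      linear_combination h1
    · intro n _ hf hg hrel
      have h1 := hrel (3 * n + 3) (by omega)
      rw [Finset.sum_Icc_succ_top (by omega), Finset.Icc_self, Finset.sum_singleton,
        hC, (hun n).2.1, (hun n).2.2, map_one, (hC3 n).2.1, map_zero] at h1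
      have h3 := (shift_ratio (f := f (3 * n + 3)) (γ := α + α) (β := 0) (by rwa [← two_mul]) hg (by
        rw [← eTau_add, map_zero]
        linear_combination (eTau α) * h1 -
          shift 𝕜 (f (3 * n + 3)) * f (3 * n + 4) * e1)).1
      have h2 := hrel (3 * n + 2) (by omega)
      rw [Finset.sum_Icc_succ_top (by omega), Finset.sum_Icc_succ_top (by omega), Finset.Icc_self,
        Finset.sum_singleton, hC, (hun n).1, (hun n).2.2, map_one, (hC3 n).2.2, h3, map_zero] at h2
      refine h2α (shift_ratio (f := f (3 * n + 2)) (β := 2 * α) hα hg ?_).2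
      rw [neg_mul, map_neg] at h2
      linear_combination h2

/-- The vector fields `S₀, S₁, P_k, Q_{2k}` are linearly independent over the ring of functions of
the variables `τ_j`. -/
theorem linearIndependent_triCoeff {α : 𝕜} (hα : α ≠ 0) :
    LinearIndependent (Fn 𝕜 ℤ) (triCoeff α) := by
  rw [linearIndependent_iff']
  intro s g hg k hk
  have h1 := triCoeff_relation hα (s.sup id + 1) (fun k => if k ∈ s then g k else 0) (fun i => by
    have h2 := congrFun hg i
    rw [Finset.sum_apply] at h2
    have hs : s ⊆ Finset.range (s.sup id + 1) := fun j hj =>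
      Finset.mem_range.2 (Nat.lt_succ_of_le (Finset.le_sup (f := id) hj))
    rw [← Finset.sum_subset hs fun j _ hj => by rw [if_neg hj, zero_mul]]
    refine (Finset.sum_congr rfl fun j hj => ?_).trans h2
    rw [if_pos hj]
    rfl) k
    (Nat.lt_succ_of_le (Finset.le_sup (f := id) hk))
  rwa [if_pos hk] at h1

end Independence

/-! ### Shift conjugates in terms of `S₀`, `S₁`, `P_k`, `Q_k` -/

namespace ShiftSystem

variable {𝕜 R M : Type*} [Field 𝕜] [CommRing R] [Algebra 𝕜 R] [LieRing M] [LieAlgebra 𝕜 M]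
  [Module R M] [IsScalarTower 𝕜 R M]
variable {D : M → R → R} {σ : M →ₗ⁅𝕜⁆ M} {T : Submodule 𝕜 M} {α : 𝕜} {s₀ s₁ : M} {e e' : R}

theorem map_pSeq_one (h : ShiftSystem D σ T α s₀ s₁ e e') :
    σ (pSeq α s₀ s₁ 1) = pSeq α s₀ s₁ 1 - (2 * α) • (s₀ + s₁) := h.map_first

theorem map_pSeq_two (h : ShiftSystem D σ T α s₀ s₁ e e') :
    σ (pSeq α s₀ s₁ 2) =
      e' • (pSeq α s₀ s₁ 2 + (2 * α) • pSeq α s₀ s₁ 1 - (2 * α ^ 2) • (s₀ + s₁)) := by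
  have h1 := h.map_pSeq_even 0
  simp only [Nat.mul_zero, Nat.zero_add, h.map_pSeq_one] at h1
  rw [← h.smul_inv_smul (σ (pSeq α s₀ s₁ 2))]
  congr 1
  linear_combination (norm := skip) h1
  match_scalars <;> (try simp only [map_ofNat]) <;> ring

theorem map_qSeq_two (h : ShiftSystem D σ T α s₀ s₁ e e') :
    σ (qSeq α s₀ s₁ 2) =
      e • (qSeq α s₀ s₁ 2 - (2 * α) • pSeq α s₀ s₁ 1 + (2 * α ^ 2) • (s₀ + s₁)) := by
  have h1 := h.map_qSeq_even 0
  simp only [Nat.mul_zero, Nat.zero_add, h.map_pSeq_one] at h1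
  rw [← h.smul_smul_inv (σ (qSeq α s₀ s₁ 2))]
  congr 1
  linear_combination (norm := skip) h1
  match_scalars <;> (try simp only [map_ofNat]) <;> ring

theorem recursions (h : ShiftSystem D σ T α s₀ s₁ e e') (n : ℕ) (hn : 1 ≤ n) :
    σ (pSeq α s₀ s₁ (2 * n + 1)) + ((2 * α) • e) • σ (pSeq α s₀ s₁ (2 * n))
        = pSeq α s₀ s₁ (2 * n + 1) + (2 * α) • qSeq α s₀ s₁ (2 * n) ∧
      e • σ (pSeq α s₀ s₁ (2 * n + 2)) - α • σ (pSeq α s₀ s₁ (2 * n + 1))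
        = pSeq α s₀ s₁ (2 * n + 2) + α • qSeq α s₀ s₁ (2 * n + 1) ∧
      σ (qSeq α s₀ s₁ (2 * n + 1)) - ((2 * α) • e') • σ (qSeq α s₀ s₁ (2 * n))
        = qSeq α s₀ s₁ (2 * n + 1) - (2 * α) • pSeq α s₀ s₁ (2 * n) ∧
      e' • σ (qSeq α s₀ s₁ (2 * n + 2)) + α • σ (qSeq α s₀ s₁ (2 * n + 1))
        = qSeq α s₀ s₁ (2 * n + 2) - α • pSeq α s₀ s₁ (2 * n + 1) ∧
      pSeq α s₀ s₁ (2 * n + 1) = qSeq α s₀ s₁ (2 * n + 1) ∧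
      ⁅s₁, pSeq α s₀ s₁ (2 * n + 2)⁆ = -α • pSeq α s₀ s₁ (2 * n + 2) ∧
      ⁅s₀, qSeq α s₀ s₁ (2 * n + 2)⁆ = α • qSeq α s₀ s₁ (2 * n + 2) := by
  obtain ⟨m, rfl⟩ := Nat.exists_eq_add_of_le' hn
  refine ⟨?_, ?_, ?_, ?_, h.qSeq_eq _, h.lie_pSeq_even _, h.lie_qSeq_even _⟩
  · rw [smul_assoc]; exact h.map_pSeq_odd m
  · rw [← h.qSeq_eq]; exact h.map_pSeq_even (m + 1)
  · rw [smul_assoc]; exact h.map_qSeq_odd m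
  · rw [← h.qSeq_eq]; exact h.map_qSeq_even (m + 1)

theorem map_add_map (h : ShiftSystem D σ T α s₀ s₁ e e') (n : ℕ) (hn : 1 ≤ n) :
    e' • σ (qSeq α s₀ s₁ (2 * n)) + e • σ (pSeq α s₀ s₁ (2 * n)) =
      qSeq α s₀ s₁ (2 * n) + pSeq α s₀ s₁ (2 * n) := by
  obtain ⟨m, rfl⟩ := Nat.exists_eq_add_of_le' hn
  rw [show 2 * (m + 1) = 2 * m + 2 by ring]
  linear_combination (norm := module) h.map_pSeq_even m + h.map_qSeq_even m

/-- The rows of the triangular matrix of the shift, in terms of `P_k` and `Q_k`. -/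
theorem exists_coefficients (h : ShiftSystem D σ T α s₀ s₁ e e') :
    ∃ μ ν : ℕ → ℕ → 𝕜,
      (∀ n : ℕ,
        σ (pSeq α s₀ s₁ (2 * n + 1)) = pSeq α s₀ s₁ (2 * n + 1)
          + ∑ k ∈ Finset.Icc 1 n, (μ (2 * n + 1) (2 * k) • pSeq α s₀ s₁ (2 * k)
              + ν (2 * n + 1) (2 * k) • qSeq α s₀ s₁ (2 * k))
          + ∑ k ∈ Finset.range n, μ (2 * n + 1) (2 * k + 1) • pSeq α s₀ s₁ (2 * k + 1)
          + μ (2 * n + 1) 0 • s₀ + ν (2 * n + 1) 0 • s₁) ∧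
      (∀ n : ℕ, 1 ≤ n →
        σ (pSeq α s₀ s₁ (2 * n)) = e' • (pSeq α s₀ s₁ (2 * n)
          + ∑ k ∈ Finset.Icc 1 (n - 1), (μ (2 * n) (2 * k) • pSeq α s₀ s₁ (2 * k)
              + ν (2 * n) (2 * k) • qSeq α s₀ s₁ (2 * k))
          + ∑ k ∈ Finset.range n, μ (2 * n) (2 * k + 1) • pSeq α s₀ s₁ (2 * k + 1)
          + μ (2 * n) 0 • s₀ + ν (2 * n) 0 • s₁) ∧
        σ (qSeq α s₀ s₁ (2 * n)) = e • (qSeq α s₀ s₁ (2 * n)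
          - ∑ k ∈ Finset.Icc 1 (n - 1), (μ (2 * n) (2 * k) • pSeq α s₀ s₁ (2 * k)
              + ν (2 * n) (2 * k) • qSeq α s₀ s₁ (2 * k))
          - ∑ k ∈ Finset.range n, μ (2 * n) (2 * k + 1) • pSeq α s₀ s₁ (2 * k + 1)
          - μ (2 * n) 0 • s₀ - ν (2 * n) 0 • s₁) ∧
        μ (2 * n + 1) (2 * n) = -2 * α ∧
        ν (2 * n + 1) (2 * n) = 2 * α ∧
        μ (2 * n) (2 * n - 1) = 2 * α) := by
  -- Row `m` is a row of `oddRow` or `evenRow`, read through the position of `P_k` in `tri`.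
  let row : ℕ → ℕ → 𝕜 := fun m => if Even m then evenRow α (m / 2 - 1) else oddRow α (m / 2)
  refine ⟨fun m k => row m (3 * (k / 2) + 2 * (k % 2)), fun m k => row m (3 * (k / 2) + 1),
    fun n => ?_, fun n hn => ?_⟩
  · have hrow : row (2 * n + 1) = oddRow α n := by
      simp only [row, if_neg (Nat.not_even_two_mul_add_one n)]
      congr 1
      omega
    have i1 : ∀ k, 3 * (2 * k / 2) + 2 * (2 * k % 2) = 3 * k := fun k => by omega
    have i2 : ∀ k, 3 * (2 * k / 2) + 1 = 3 * k + 1 := fun k => by omega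
    have i3 : ∀ k, 3 * ((2 * k + 1) / 2) + 2 * ((2 * k + 1) % 2) = 3 * k + 2 := fun k => by omega
    simp only [hrow, i1, i2, i3, Nat.zero_div, Nat.zero_mod, Nat.mul_zero, Nat.add_zero,
      Nat.zero_add]
    rw [h.map_odd_row, sum_tri, Finset.sum_range_succ, oddRow_top]
    module
  · obtain ⟨m, rfl⟩ := Nat.exists_eq_add_of_le' hn
    have hrow : row (2 * (m + 1)) = evenRow α m := by
      simp only [row, if_pos (even_two_mul (m + 1))]
      congr 1
      omega
    have hrow' : row (2 * (m + 1) + 1) = oddRow α (m + 1) := by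
      simp only [row, if_neg (Nat.not_even_two_mul_add_one (m + 1))]
      congr 1
      omega
    have i1 : ∀ k, 3 * (2 * k / 2) + 2 * (2 * k % 2) = 3 * k := fun k => by omega
    have i2 : ∀ k, 3 * (2 * k / 2) + 1 = 3 * k + 1 := fun k => by omega
    have i3 : ∀ k, 3 * ((2 * k + 1) / 2) + 2 * ((2 * k + 1) % 2) = 3 * k + 2 := fun k => by omega
    have i4 : 3 * ((2 * (m + 1) - 1) / 2) + 2 * ((2 * (m + 1) - 1) % 2) = 3 * m + 2 := by omega
    simp only [hrow, hrow', i1, i2, i3, i4, Nat.zero_div, Nat.zero_mod, Nat.mul_zero, Nat.add_zero,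
      Nat.zero_add, Nat.add_sub_cancel]
    refine ⟨?_, ?_, ?_, ?_, evenRow_top α m⟩
    · rw [show 2 * (m + 1) = 2 * m + 2 by ring, h.map_even_row, sum_tri]
      congr 1
      module
    · rw [show 2 * (m + 1) = 2 * m + 2 by ring, h.map_even_row', sum_tri]
      congr 1
      module
    · rw [oddRow, if_neg (by omega), if_neg (by omega), if_pos (by omega)]
    · rw [oddRow, if_neg (by omega), if_pos (by omega)]

end ShiftSystem

section TauPart

variable {𝕜 : Type*} [RCLike 𝕜]

attribute [local instance] vfModule in
theorem P_mem (α : 𝕜) (k : ℕ) : P α k ∈ tauFree 𝕜 := by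
  rw [P_eq]
  exact (shiftSystem α).pSeq_mem k

attribute [local instance] vfModule in
theorem Q_mem (α : 𝕜) (k : ℕ) : Q α k ∈ tauFree 𝕜 := by
  rw [Q_eq]
  exact (shiftSystem α).qSeq_mem k

theorem conj_coord_zero {Z : VF 𝕜 ℤ} (hZ : Z ∈ tauFree 𝕜) : conj Z (coord 0) = 0 := by
  rw [conj_coord, zero_sub, hZ.2, map_zero]

/-- The position of the members of `basisV` and `basisLx` in the sequence `tri`. -/
def triIndex : Fin 2 ⊕ ℕ ⊕ ℕ → ℕ :=
  Sum.elim (fun i => i) (Sum.elim (fun k => 3 * ((k + 1) / 2) + 2 * ((k + 1) % 2))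
    (fun k => 3 * k + 4))

theorem triIndex_injective : Function.Injective triIndex := by
  rintro (a | a | a) (b | b | b) h <;>
    simp only [triIndex, Sum.elim_inl, Sum.elim_inr] at h
  · exact congrArg _ (Fin.ext h)
  · omega
  · omega
  · omega
  · rw [show a = b by omega]
  · omega
  · omega
  · omega
  · rw [show a = b by omega]

/-- The family `S₀, S₁; P_k (k ≥ 1); Q_{2k} (k ≥ 1)`. -/
noncomputable def tauBasis (α : 𝕜) : Fin 2 ⊕ ℕ ⊕ ℕ → VF 𝕜 ℤ :=
  Sum.elim ![S₀ α, S₁ α] (Sum.elim (fun k => P α (k + 1)) (fun k => Q α (2 * (k + 1))))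

theorem tauBasis_eq (α : 𝕜) (x : Fin 2 ⊕ ℕ ⊕ ℕ) :
    tauBasis α x = tri α (S₀ α) (S₁ α) (triIndex x) := by
  rcases x with i | k | k
  · fin_cases i
    · exact (tri_zero _ _ _).symm
    · exact (tri_one _ _ _).symm
  · change P α (k + 1) = tri _ _ _ (3 * ((k + 1) / 2) + 2 * ((k + 1) % 2))
    rw [P_eq]
    rcases Nat.even_or_odd' k with ⟨n, rfl | rfl⟩
    · rw [show 3 * ((2 * n + 1) / 2) + 2 * ((2 * n + 1) % 2) = 3 * n + 2 by omega, tri_odd]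
    · rw [show 3 * ((2 * n + 1 + 1) / 2) + 2 * ((2 * n + 1 + 1) % 2) = 3 * n + 3 by omega, tri_even]
  · change Q α (2 * (k + 1)) = tri _ _ _ (3 * k + 4)
    rw [Q_eq, tri_even', show 2 * (k + 1) = 2 * k + 2 by ring]

theorem exists_triIndex (k : ℕ) : ∃ x, triIndex x = k := by
  refine cases_mod_three (p := fun k => ∃ x, triIndex x = k) ⟨Sum.inl 0, rfl⟩ ⟨Sum.inl 1, rfl⟩ (fun n => ?_) (fun n => ?_)
    (fun n => ⟨Sum.inr (Sum.inr n), rfl⟩) k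
  · refine ⟨Sum.inr (Sum.inl (2 * n)), ?_⟩
    simp only [triIndex, Sum.elim_inl, Sum.elim_inr]
    omega
  · refine ⟨Sum.inr (Sum.inl (2 * n + 1)), ?_⟩
    simp only [triIndex, Sum.elim_inl, Sum.elim_inr]
    omega

theorem linearIndependent_tauBasis {α : 𝕜} (hα : α ≠ 0) :
    LinearIndependent (Fn 𝕜 ℤ) fun x => coeffs (tauBasis α x) := by
  have h : (fun x => coeffs (tauBasis α x)) = triCoeff α ∘ triIndex :=
    funext fun x => by rw [tauBasis_eq]; rfl
  rw [h]
  exact (linearIndependent_triCoeff hα).comp triIndex triIndex_injective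

/-- The inclusion of the index set of `basisV α n`. -/
def basisVIndex (n : ℕ) : Fin 2 ⊕ Fin n ⊕ Fin (n / 2) → Fin 2 ⊕ ℕ ⊕ ℕ :=
  Sum.map id (Sum.map Fin.val Fin.val)

theorem basisVIndex_injective (n : ℕ) : Function.Injective (basisVIndex n) :=
  Function.injective_id.sumMap (Fin.val_injective.sumMap Fin.val_injective)

theorem basisV_eq (α : 𝕜) (n : ℕ) (x : Fin 2 ⊕ Fin n ⊕ Fin (n / 2)) :
    basisV α n x = tauBasis α (basisVIndex n x) := by
  rcases x with i | k | k <;> rfl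

theorem linearIndependent_coeffs_basisV {α : 𝕜} (hα : α ≠ 0) (n : ℕ) :
    LinearIndependent (Fn 𝕜 ℤ) fun x => coeffs (basisV α n x) := by
  have h : (fun x => coeffs (basisV α n x)) =
      (fun x => coeffs (tauBasis α x)) ∘ basisVIndex n :=
    funext fun x => by rw [basisV_eq]; rfl
  rw [h]
  exact (linearIndependent_tauBasis hα).comp _ (basisVIndex_injective n)

/-- The coefficients of a vector field, as a linear map over the constants. -/
def coeffsHom (𝕜 : Type*) [RCLike 𝕜] (ι : Type*) : VF 𝕜 ι →ₗ[𝕜] (ι → Fn 𝕜 ι) where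
  toFun := coeffs
  map_add' _ _ := rfl
  map_smul' _ _ := rfl

/-- Linear independence of the coefficients over functions implies linear independence of the
vector fields over the constants. -/
theorem linearIndependent_of_coeffs {ι J : Type*} {Z : J → VF 𝕜 ι}
    (h : LinearIndependent (Fn 𝕜 ι) fun j => coeffs (Z j)) : LinearIndependent 𝕜 Z := by
  refine LinearIndependent.of_comp (coeffsHom 𝕜 ι) (h.restrict_scalars ?_)
  intro a b hab
  simp only [Algebra.smul_def, mul_one] at hab
  exact (algebraMap 𝕜 (Fn 𝕜 ι)).injective hab

theorem span_basisV (α : 𝕜) (n : ℕ) :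
    Submodule.span 𝕜 (Set.range (basisV α n)) = V α n := by
  rw [V_eq]
  refine congrArg (Submodule.span 𝕜) (Set.ext fun Z => ?_)
  constructor
  · rintro ⟨x, rfl⟩
    refine ⟨triIndex (basisVIndex n x), ?_, by rw [basisV_eq, tauBasis_eq]⟩
    rcases x with i | k | k <;>
      simp only [basisVIndex, triIndex, Sum.map_inl, Sum.map_inr, Sum.elim_inl, Sum.elim_inr, id]
      <;> omega
  · rintro ⟨k, hk, rfl⟩
    obtain ⟨x, rfl⟩ := exists_triIndex k
    rw [← tauBasis_eq]
    rcases x with i | k | k <;> simp only [triIndex, Sum.elim_inl, Sum.elim_inr] at hk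
    · exact ⟨Sum.inl i, rfl⟩
    · exact ⟨Sum.inr (Sum.inl ⟨k, by omega⟩), rfl⟩
    · exact ⟨Sum.inr (Sum.inr ⟨k, by omega⟩), rfl⟩

theorem finrank_V {α : 𝕜} (hα : α ≠ 0) (n : ℕ) :
    Module.finrank 𝕜 (V α n) = 2 + n + n / 2 := by
  rw [← span_basisV, finrank_span_eq_card
    (linearIndependent_of_coeffs (linearIndependent_coeffs_basisV hα n))]
  simp [add_assoc]

end TauPart

section TauMain

variable {𝕜 : Type*} [RCLike 𝕜]

attribute [local instance] vfModule in
theorem conj_P_one (α : 𝕜) : conj (P α 1) = P α 1 - (2 * α) • (S₀ α + S₁ α) :=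
  (shiftSystem α).map_pSeq_one

attribute [local instance] vfModule in
theorem conj_P_two (α : 𝕜) : conj (P α 2) = eTau (-α) •
    (P α 2 + (2 * α) • P α 1 - (2 * α ^ 2) • (S₀ α + S₁ α)) := by
  rw [P_eq α 2]
  exact (shiftSystem α).map_pSeq_two

attribute [local instance] vfModule in
theorem conj_Q_two (α : 𝕜) : conj (Q α 2) = eTau α •
    (Q α 2 - (2 * α) • P α 1 + (2 * α ^ 2) • (S₀ α + S₁ α)) := by
  rw [Q_eq α 2]
  exact (shiftSystem α).map_qSeq_two

attribute [local instance] vfModule in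
theorem lie_S₁_P_even (α : 𝕜) (n : ℕ) :
    ⁅S₁ α, P α (2 * n + 2)⁆ = -α • P α (2 * n + 2) := by
  rw [P_eq]
  exact (shiftSystem α).lie_pSeq_even n

attribute [local instance] vfModule in
theorem lie_S₀_Q_even (α : 𝕜) (n : ℕ) :
    ⁅S₀ α, Q α (2 * n + 2)⁆ = α • Q α (2 * n + 2) := by
  rw [Q_eq]
  exact (shiftSystem α).lie_qSeq_even n

attribute [local instance] vfModule in
theorem conj_recursions (α : 𝕜) (n : ℕ) (hn : 1 ≤ n) :
    conj (P α (2 * n + 1)) + ((2 * α) • eTau α) • conj (P α (2 * n))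
        = P α (2 * n + 1) + (2 * α) • Q α (2 * n) ∧
      eTau α • conj (P α (2 * n + 2)) - α • conj (P α (2 * n + 1))
        = P α (2 * n + 2) + α • Q α (2 * n + 1) ∧
      conj (Q α (2 * n + 1)) - ((2 * α) • eTau (-α)) • conj (Q α (2 * n))
        = Q α (2 * n + 1) - (2 * α) • P α (2 * n) ∧
      eTau (-α) • conj (Q α (2 * n + 2)) + α • conj (Q α (2 * n + 1))
        = Q α (2 * n + 2) - α • P α (2 * n + 1) ∧
      P α (2 * n + 1) = Q α (2 * n + 1) ∧
      ⁅S₁ α, P α (2 * n + 2)⁆ = -α • P α (2 * n + 2) ∧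
      ⁅S₀ α, Q α (2 * n + 2)⁆ = α • Q α (2 * n + 2) := by
  simp only [P_eq, Q_eq]
  exact (shiftSystem α).recursions n hn

attribute [local instance] vfModule in
theorem conj_Q_add_conj_P (α : 𝕜) (n : ℕ) (hn : 1 ≤ n) :
    eTau (-α) • conj (Q α (2 * n)) + eTau α • conj (P α (2 * n))
        = Q α (2 * n) + P α (2 * n) := by
  rw [P_eq, Q_eq]
  exact (shiftSystem α).map_add_map n hn

attribute [local instance] vfModule in
theorem exists_conj_coefficients (α : 𝕜) : ∃ μ ν : ℕ → ℕ → 𝕜,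
    (∀ n : ℕ,
      conj (P α (2 * n + 1)) = P α (2 * n + 1)
        + ∑ k ∈ Finset.Icc 1 n,
            (μ (2 * n + 1) (2 * k) • P α (2 * k) + ν (2 * n + 1) (2 * k) • Q α (2 * k))
        + ∑ k ∈ Finset.range n, μ (2 * n + 1) (2 * k + 1) • P α (2 * k + 1)
        + μ (2 * n + 1) 0 • S₀ α + ν (2 * n + 1) 0 • S₁ α) ∧
    (∀ n : ℕ, 1 ≤ n →
      conj (P α (2 * n)) = eTau (-α) • (P α (2 * n)
        + ∑ k ∈ Finset.Icc 1 (n - 1),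
            (μ (2 * n) (2 * k) • P α (2 * k) + ν (2 * n) (2 * k) • Q α (2 * k))
        + ∑ k ∈ Finset.range n, μ (2 * n) (2 * k + 1) • P α (2 * k + 1)
        + μ (2 * n) 0 • S₀ α + ν (2 * n) 0 • S₁ α) ∧
      conj (Q α (2 * n)) = eTau α • (Q α (2 * n)
        - ∑ k ∈ Finset.Icc 1 (n - 1),
            (μ (2 * n) (2 * k) • P α (2 * k) + ν (2 * n) (2 * k) • Q α (2 * k))
        - ∑ k ∈ Finset.range n, μ (2 * n) (2 * k + 1) • P α (2 * k + 1)
        - μ (2 * n) 0 • S₀ α - ν (2 * n) 0 • S₁ α) ∧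
      μ (2 * n + 1) (2 * n) = -2 * α ∧
      ν (2 * n + 1) (2 * n) = 2 * α ∧
      μ (2 * n) (2 * n - 1) = 2 * α) := by
  simp only [P_eq, Q_eq]
  exact (shiftSystem α).exists_coefficients

end TauMain

/-! ### Passage to the variables `x`, `t`, `τ_j`, `D_x ^ m t` -/

section Lift

variable {𝕜 : Type*} [RCLike 𝕜]

theorem pull_apply (F : Fn 𝕜 ℤ) (p : DynVar → 𝕜) :
    (pull F).1 p = F.1 fun j => p (DynVar.t j) - p (DynVar.t (j + 1)) := rfl

theorem pull_coord (j : ℤ) :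
    pull (coord j : Fn 𝕜 ℤ) = coord (DynVar.t j) - coord (DynVar.t (j + 1)) := rfl

/-- Every sequence is the sequence of differences `t_j - t_{j+1}` of another one. -/
theorem pull_injective : Function.Injective (pull : Fn 𝕜 ℤ →ₐ[𝕜] Fn 𝕜 DynVar) := by
  intro F G h
  refine Fn.ext fun p => ?_
  let q : DynVar → 𝕜
    | .x => 0
    | .t k => -tele p k
    | .dt _ => 0
  have h1 : (fun j => q (DynVar.t j) - q (DynVar.t (j + 1))) = p := by
    funext j
    change -tele p j - -tele p (j + 1) = p j
    rw [tele_add_one]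
    ring
  have h2 : (pull F).1 q = (pull G).1 q := by rw [h]
  rwa [pull_apply, pull_apply, h1] at h2

theorem pull_rho (j : ℤ) :
    pull (rho j : Fn 𝕜 ℤ) = coord (DynVar.t j) - coord (DynVar.t 0) := by
  refine int_ext (f := fun j => pull (rho j : Fn 𝕜 ℤ))
    (g := fun j => coord (DynVar.t j) - coord (DynVar.t 0)) ?_ ?_ j
  · simp only [rho_zero, map_zero, sub_self]
  · intro j
    simp only [rho_add_one, map_sub, pull_coord]
    ring

theorem eT_mul_pull_expRho (α : 𝕜) (j : ℤ) :
    eT α * pull (expRho α j) = expF (α • coord (DynVar.t j)) := by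
  have h : pull (expRho α j) = expF (α • pull (rho j)) := by
    rw [← map_smul]
    rfl
  rw [h, pull_rho, eT, ← expF_add, ← smul_add, add_sub_cancel]

theorem eT_mul (a b : 𝕜) : eT a * eT b = eT (a + b) := by
  rw [eT, eT, eT, ← expF_add, add_smul]

theorem eT_neg_mul (a : 𝕜) : eT (-a) * eT a = 1 := by
  rw [eT_mul, neg_add_cancel, eT, zero_smul, expF_zero]

theorem Formal.apply_eT {Z : VF 𝕜 DynVar} (hZ : Formal Z) (β : 𝕜) :
    Z (eT β) = β • (Z (coord (DynVar.t 0)) * eT β) := by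
  rw [eT, hZ.apply_expF, Derivation.map_smul, smul_mul_assoc]

/-- Formal vector fields are determined by their values on the coordinates `x`, `t`, `τ_j`,
`D_x ^ m t`. -/
theorem Formal.ext_dyn {Z W : VF 𝕜 DynVar} (hZ : Formal Z) (hW : Formal W)
    (hx : Z (coord DynVar.x) = W (coord DynVar.x))
    (ht : Z (coord (DynVar.t 0)) = W (coord (DynVar.t 0)))
    (hτ : ∀ j, Z (pull (coord j)) = W (pull (coord j)))
    (hdt : ∀ m, Z (coord (DynVar.dt m)) = W (coord (DynVar.dt m))) : Z = W := by
  refine hZ.ext hW fun i => ?_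
  rcases i with _ | k | m
  · exact hx
  · refine int_ext (f := fun k => Z (coord (DynVar.t k))) (g := fun k => W (coord (DynVar.t k)))
      ht (fun j => ?_) k
    have := hτ j
    rw [pull_coord, map_sub, map_sub] at this
    linear_combination -this
  · exact hdt m

theorem lift_x (Z : VF 𝕜 ℤ) : lift Z (coord DynVar.x) = 0 := vectorField_coord _ _

theorem lift_dt (Z : VF 𝕜 ℤ) (m : ℕ) : lift Z (coord (DynVar.dt m)) = 0 := vectorField_coord _ _

theorem lift_t (Z : VF 𝕜 ℤ) (k : ℤ) :
    lift Z (coord (DynVar.t k)) = -tele (fun j => pull (Z (coord j))) k := vectorField_coord _ _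

theorem lift_t_zero (Z : VF 𝕜 ℤ) : lift Z (coord (DynVar.t 0)) = 0 := by
  rw [lift_t, tele_zero, neg_zero]

theorem formal_lift (Z : VF 𝕜 ℤ) : Formal (lift Z) := formal_vectorField _

theorem lift_pull_coord (Z : VF 𝕜 ℤ) (j : ℤ) : lift Z (pull (coord j)) = pull (Z (coord j)) := by
  rw [pull_coord, map_sub, lift_t, lift_t, tele_add_one]
  ring

theorem lift_pull {Z : VF 𝕜 ℤ} (hZ : Formal Z) (F : Fn 𝕜 ℤ) :
    lift Z (pull F) = pull (Z F) := by
  obtain ⟨s, hs⟩ := F.exists_support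
  rw [hZ.apply hs, map_sum, pull, (formal_lift Z).apply_subst _ hs]
  refine Finset.sum_congr rfl fun i _ => ?_
  rw [map_mul]
  congr 1
  exact lift_pull_coord Z i

/-- A formal vector field that annihilates the `τ_j` annihilates all functions of them. -/
theorem Formal.apply_pull_eq_zero {W : VF 𝕜 DynVar} (hW : Formal W)
    (h : ∀ j, W (pull (coord j)) = 0) (F : Fn 𝕜 ℤ) : W (pull F) = 0 := by
  obtain ⟨s, hs⟩ := F.exists_support
  rw [pull, hW.apply_subst _ hs]
  refine Finset.sum_eq_zero fun i _ => ?_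
  have h1 := h i
  rw [pull_coord] at h1
  rw [h1, zero_mul]

/-- The passage from vector fields in the `τ_j` to vector fields in all variables, as a linear map
over the constants. -/
noncomputable def liftHom (𝕜 : Type*) [RCLike 𝕜] : VF 𝕜 ℤ →ₗ[𝕜] VF 𝕜 DynVar where
  toFun := lift
  map_add' Z W := by
    refine (formal_lift _).ext_dyn ((formal_lift _).add (formal_lift _)) ?_ ?_ (fun j => ?_)
      (fun m => ?_)
    · simp only [Derivation.add_apply, lift_x, add_zero]
    · simp only [Derivation.add_apply, lift_t_zero, add_zero]
    · simp only [Derivation.add_apply, lift_pull_coord, map_add]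
    · simp only [Derivation.add_apply, lift_dt, add_zero]
  map_smul' c Z := by
    refine (formal_lift _).ext_dyn ((formal_lift _).smul c) ?_ ?_ (fun j => ?_) (fun m => ?_)
    · simp only [Derivation.smul_apply, lift_x, smul_zero]
    · simp only [Derivation.smul_apply, lift_t_zero, smul_zero]
    · simp only [Derivation.smul_apply, lift_pull_coord, map_smul, RingHom.id_apply]
    · simp only [Derivation.smul_apply, lift_dt, smul_zero]

theorem lift_lie {Z W : VF 𝕜 ℤ} (hZ : Formal Z) (hW : Formal W) :
    lift ⁅Z, W⁆ = ⁅lift Z, lift W⁆ := by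
  refine (formal_lift _).ext_dyn ((formal_lift _).lie (formal_lift _)) ?_ ?_ (fun j => ?_)
    (fun m => ?_)
  · simp only [Derivation.commutator_apply, lift_x, map_zero, sub_self]
  · simp only [Derivation.commutator_apply, lift_t_zero, map_zero, sub_self]
  · simp only [Derivation.commutator_apply, lift_pull_coord, lift_pull hZ, lift_pull hW, map_sub]
  · simp only [Derivation.commutator_apply, lift_dt, map_zero, sub_self]

theorem Xtilde_x : Xtilde 𝕜 (coord DynVar.x) = 0 := vectorField_coord _ _

theorem Xtilde_t (k : ℤ) : Xtilde 𝕜 (coord (DynVar.t k)) = 1 := vectorField_coord _ _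

theorem Xtilde_dt (m : ℕ) : Xtilde 𝕜 (coord (DynVar.dt m)) = 0 := vectorField_coord _ _

theorem formal_Xtilde : Formal (Xtilde 𝕜) := formal_vectorField _

theorem formal_X : Formal (X 𝕜) := formal_partialVF _

/-- The fields `∂/∂t_x`, `∂/∂x`, `X̃`, which do not involve the `∂/∂τ_j`. -/
noncomputable def baseVF (𝕜 : Type*) [RCLike 𝕜] : Fin 3 → VF 𝕜 DynVar :=
  ![X 𝕜, partialVF 𝕜 DynVar.x, Xtilde 𝕜]

theorem formal_baseVF (a : Fin 3) : Formal (baseVF 𝕜 a) := by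
  fin_cases a
  · exact formal_X
  · exact formal_partialVF _
  · exact formal_Xtilde

theorem baseVF_pull_coord (a : Fin 3) (j : ℤ) : baseVF 𝕜 a (pull (coord j)) = 0 := by
  rw [pull_coord, map_sub]
  fin_cases a
  · change partialVF 𝕜 _ _ - partialVF 𝕜 _ _ = _
    rw [partialVF_coord, partialVF_coord, if_neg (by simp), if_neg (by simp), sub_self]
  · change partialVF 𝕜 _ _ - partialVF 𝕜 _ _ = _
    rw [partialVF_coord, partialVF_coord, if_neg (by simp), if_neg (by simp), sub_self]
  · change Xtilde 𝕜 _ - Xtilde 𝕜 _ = _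
    rw [Xtilde_t, Xtilde_t, sub_self]

theorem baseVF_const (a : Fin 3) (i : DynVar) : ∃ c : 𝕜, baseVF 𝕜 a (coord i) = algebraMap _ _ c := by
  fin_cases a
  · refine ⟨if DynVar.dt 0 = i then 1 else 0, (partialVF_coord _ _).trans ?_⟩
    split_ifs <;> simp
  · refine ⟨if DynVar.x = i then 1 else 0, (partialVF_coord _ _).trans ?_⟩
    split_ifs <;> simp
  · rcases i with _ | k | m
    · exact ⟨0, by rw [map_zero]; exact Xtilde_x⟩
    · exact ⟨1, by rw [map_one]; exact Xtilde_t k⟩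
    · exact ⟨0, by rw [map_zero]; exact Xtilde_dt m⟩

theorem baseVF_lie (a b : Fin 3) : ⁅baseVF 𝕜 a, baseVF 𝕜 b⁆ = 0 := by
  refine ((formal_baseVF a).lie (formal_baseVF b)).ext formal_zero fun i => ?_
  obtain ⟨c, hc⟩ := baseVF_const (𝕜 := 𝕜) a i
  obtain ⟨d, hd⟩ := baseVF_const (𝕜 := 𝕜) b i
  rw [Derivation.commutator_apply, hc, hd, Derivation.map_algebraMap, Derivation.map_algebraMap,
    sub_self]
  rfl

theorem baseVF_lie_lift (a : Fin 3) (Z : VF 𝕜 ℤ) : ⁅baseVF 𝕜 a, lift Z⁆ = 0 := by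
  have h : ∀ i, lift Z (baseVF 𝕜 a (coord i)) = 0 := fun i => by
    obtain ⟨c, hc⟩ := baseVF_const (𝕜 := 𝕜) a i
    rw [hc, Derivation.map_algebraMap]
  refine ((formal_baseVF a).lie (formal_lift Z)).ext_dyn formal_zero ?_ ?_ (fun j => ?_)
    (fun m => ?_)
  · rw [Derivation.commutator_apply, h, lift_x, map_zero, sub_self]; rfl
  · rw [Derivation.commutator_apply, h, lift_t_zero, map_zero, sub_self]; rfl
  · rw [Derivation.commutator_apply, baseVF_pull_coord, lift_pull_coord,
      (formal_baseVF a).apply_pull_eq_zero (baseVF_pull_coord a), map_zero, sub_self]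
    rfl
  · rw [Derivation.commutator_apply, h, lift_dt, map_zero, sub_self]; rfl

/-- The increments `d(t_j, t_{j+1})` are the coefficients of `A₁ e^{αt} S₀ + A₂ e^{-αt} S₁`. -/
theorem dF_eq (α A₁ A₂ : 𝕜) (j : ℤ) : dF α A₁ A₂ j =
    A₁ • (eT α * pull (S₀ α (coord j))) + A₂ • (eT (-α) * pull (S₁ α (coord j))) := by
  have h := fun j => eT_mul_pull_expRho (-α) j
  simp only [neg_smul] at h
  rw [S₁_eq, S₀_coord, S₀_coord, map_add, map_add, mul_add, mul_add, eT_mul_pull_expRho,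
    eT_mul_pull_expRho, h, h, dF, add_comm (expF (-(α • coord (DynVar.t j))))]

theorem K₀_x (α A₁ A₂ : 𝕜) : K₀ α A₁ A₂ (coord DynVar.x) = 1 := vectorField_coord _ _

theorem K₀_t (α A₁ A₂ : 𝕜) (k : ℤ) : K₀ α A₁ A₂ (coord (DynVar.t k)) = vel α A₁ A₂ k :=
  vectorField_coord _ _

theorem K₀_dt (α A₁ A₂ : 𝕜) (m : ℕ) : K₀ α A₁ A₂ (coord (DynVar.dt m)) = 0 :=
  vectorField_coord _ _

theorem formal_K₀ (α A₁ A₂ : 𝕜) : Formal (K₀ α A₁ A₂) := formal_vectorField _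

theorem K₀_eq (α A₁ A₂ : 𝕜) : K₀ α A₁ A₂ =
    partialVF 𝕜 DynVar.x + (coord (DynVar.dt 0) : Fn 𝕜 DynVar) • Xtilde 𝕜
        - (A₁ • eT α) • lift (S₀ α) - (A₂ • eT (-α)) • lift (S₁ α) := by
  refine (formal_K₀ α A₁ A₂).ext_dyn
    ((((formal_partialVF _).add (formal_Xtilde.fsmul _)).sub ((formal_lift _).fsmul _)).sub
      ((formal_lift _).fsmul _)) ?_ ?_ (fun j => ?_) (fun m => ?_)
  · simp [Derivation.sub_apply, Derivation.add_apply, Derivation.smul_apply, K₀_x, Xtilde_x, lift_x,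
      partialVF_coord]
  · simp [Derivation.sub_apply, Derivation.add_apply, Derivation.smul_apply, K₀_t, Xtilde_t,
      lift_t_zero, partialVF_coord, vel_zero]
  · have h1 : K₀ α A₁ A₂ (pull (coord j)) = -dF α A₁ A₂ j := by
      rw [pull_coord, map_sub, K₀_t, K₀_t, vel_add_one]
      ring
    have h2 : partialVF 𝕜 DynVar.x (pull (coord j)) = 0 := baseVF_pull_coord 1 j
    have h3 : Xtilde 𝕜 (pull (coord j)) = 0 := baseVF_pull_coord 2 j
    simp only [Derivation.sub_apply, Derivation.add_apply, Derivation.smul_apply, smul_eq_mul,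
      h1, h2, h3, lift_pull_coord, dF_eq, smul_mul_assoc]
    ring
  · simp [Derivation.sub_apply, Derivation.add_apply, Derivation.smul_apply, K₀_dt, Xtilde_dt,
      lift_dt, partialVF_coord]

end Lift

/-! ### The span of the characteristic Lie algebra -/

section LieAlgebraic

variable {𝕜 M : Type*} [Field 𝕜] [LieRing M] [LieAlgebra 𝕜 M]

/-- If an element of a Lie subalgebra is a combination of eigenvectors of the derivation `⁅x, ·⁆`
with the distinct eigenvalues `0`, `α`, `-α`, and `x` lies in the subalgebra, then so do the
components for `α` and `-α`. -/
theorem eigenvector_mem [NeZero (2 : 𝕜)] {L : LieSubalgebra 𝕜 M} {x k c a b : M} {α A B : 𝕜}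
    (hα : α ≠ 0) (hA : A ≠ 0) (hB : B ≠ 0) (hx : x ∈ L) (hk : k ∈ L) (hk' : k = c - A • a - B • b)
    (hc : ⁅x, c⁆ = 0) (ha : ⁅x, a⁆ = α • a) (hb : ⁅x, b⁆ = -α • b) : a ∈ L ∧ b ∈ L := by
  have h1 : ⁅x, k⁆ = (B * α) • b - (A * α) • a := by
    rw [hk', lie_sub, lie_sub, lie_smul, lie_smul, hc, ha, hb]
    module
  have h2 : ⁅x, ⁅x, k⁆⁆ = -(B * α ^ 2) • b - (A * α ^ 2) • a := by
    rw [h1, lie_sub, lie_smul, lie_smul, ha, hb]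
    module
  have m1 : ⁅x, k⁆ ∈ L := L.lie_mem hx hk
  have m2 : ⁅x, ⁅x, k⁆⁆ ∈ L := L.lie_mem hx m1
  have two : (2 : 𝕜) ≠ 0 := NeZero.ne 2
  constructor
  · have : a = (-(2 * A * α ^ 2)⁻¹) • (α • ⁅x, k⁆ + ⁅x, ⁅x, k⁆⁆) := by
      rw [h2, h1]
      match_scalars <;> field_simp <;> ring
    rw [this]
    exact L.smul_mem _ (L.add_mem (L.smul_mem _ m1) m2)
  · have : b = (2 * B * α ^ 2)⁻¹ • (α • ⁅x, k⁆ - ⁅x, ⁅x, k⁆⁆) := by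
      rw [h2, h1]
      match_scalars <;> field_simp <;> ring
    rw [this]
    exact L.smul_mem _ (L.sub_mem (L.smul_mem _ m1) m2)

theorem lie_mem_commSpan_add {s₀ s₁ : M} {m n : ℕ} {Y Z : M} (hY : Y ∈ commSpan 𝕜 s₀ s₁ m)
    (hZ : Z ∈ commSpan 𝕜 s₀ s₁ n) : ⁅Y, Z⁆ ∈ commSpan 𝕜 s₀ s₁ (m + n + 1) := by
  induction hY, hZ using Submodule.span_induction₂ with
  | mem_mem Y Z hY hZ =>
    obtain ⟨j, hj, hY⟩ := hY
    obtain ⟨k, hk, hZ⟩ := hZ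
    exact Submodule.subset_span ⟨j + k + 1, by omega, hY.bracket hZ⟩
  | zero_left W _ => rw [zero_lie]; exact Submodule.zero_mem _
  | zero_right Z _ => rw [lie_zero]; exact Submodule.zero_mem _
  | add_left Y Z W _ _ _ h1 h2 => rw [add_lie]; exact Submodule.add_mem _ h1 h2
  | add_right Y Z W _ _ _ h1 h2 => rw [lie_add]; exact Submodule.add_mem _ h1 h2
  | smul_left f Z W hZ hW h1 => rw [smul_lie]; exact Submodule.smul_mem _ _ h1
  | smul_right f Z W hZ hW h1 => rw [lie_smul]; exact Submodule.smul_mem _ _ h1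

end LieAlgebraic

section Span

variable {𝕜 : Type*} [RCLike 𝕜]

theorem X_mem (α A₁ A₂ : 𝕜) : X 𝕜 ∈ Lx α A₁ A₂ :=
  LieSubalgebra.subset_lieSpan (by simp)

theorem K₀_mem (α A₁ A₂ : 𝕜) : K₀ α A₁ A₂ ∈ Lx α A₁ A₂ :=
  LieSubalgebra.subset_lieSpan (by simp)

theorem X_lie_K₀ (α A₁ A₂ : 𝕜) : ⁅X 𝕜, K₀ α A₁ A₂⁆ = Xtilde 𝕜 := by
  have hX0 : X 𝕜 (coord (DynVar.dt 0)) = 1 := by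
    rw [X, partialVF_coord, if_pos rfl]
  have hXt : ∀ k, X 𝕜 (coord (DynVar.t k)) = 0 := fun k => by
    rw [X, partialVF_coord, if_neg (by simp)]
  have hXx : X 𝕜 (coord DynVar.x) = 0 := by
    rw [X, partialVF_coord, if_neg (by simp)]
  have hXdt : ∀ m, K₀ α A₁ A₂ (X 𝕜 (coord (DynVar.dt m))) = 0 := fun m => by
    rw [X, partialVF_coord]
    split_ifs <;> simp
  have hXpull := (formal_X (𝕜 := 𝕜)).apply_pull_eq_zero (baseVF_pull_coord 0)
  refine (formal_X.lie (formal_K₀ α A₁ A₂)).ext_dyn formal_Xtilde ?_ ?_ (fun j => ?_) (fun m => ?_)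
  · rw [Derivation.commutator_apply, K₀_x, hXx, map_zero, Derivation.map_one_eq_zero, sub_zero,
      Xtilde_x]
  · rw [Derivation.commutator_apply, K₀_t, hXt, vel_zero, map_zero, hX0, sub_zero, Xtilde_t]
  · have h1 : K₀ α A₁ A₂ (pull (coord j)) = -dF α A₁ A₂ j := by
      rw [pull_coord, map_sub, K₀_t, K₀_t, vel_add_one]
      ring
    have h3 : Xtilde 𝕜 (pull (coord j)) = 0 := baseVF_pull_coord 2 j
    have h4 : X 𝕜 (pull (coord j)) = 0 := baseVF_pull_coord 0 j
    rw [Derivation.commutator_apply, h1, h3, h4, map_zero, map_neg, dF_eq, map_add,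
      Derivation.map_smul, Derivation.map_smul, Derivation.leibniz, Derivation.leibniz, hXpull,
      hXpull, formal_X.apply_eT, formal_X.apply_eT, hXt]
    simp
  · rw [Derivation.commutator_apply, K₀_dt, map_zero, hXdt, sub_self, Xtilde_dt]

theorem Xtilde_mem (α A₁ A₂ : 𝕜) : Xtilde 𝕜 ∈ Lx α A₁ A₂ := by
  rw [← X_lie_K₀ α A₁ A₂]
  exact LieSubalgebra.lie_mem _ (X_mem α A₁ A₂) (K₀_mem α A₁ A₂)

theorem Xtilde_lie_eT_smul_lift (β : 𝕜) (Z : VF 𝕜 ℤ) :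
    ⁅Xtilde 𝕜, eT β • lift Z⁆ = β • (eT β • lift Z) := by
  have h : ⁅Xtilde 𝕜, lift Z⁆ = 0 := baseVF_lie_lift 2 Z
  rw [lie_fsmul, h, formal_Xtilde.apply_eT, Xtilde_t, one_mul]
  refine Derivation.ext fun F => ?_
  simp only [Derivation.add_apply, Derivation.smul_apply, Derivation.zero_apply, smul_eq_mul,
    mul_zero, add_zero, smul_mul_assoc]

theorem eT_smul_lift_mem {α A₁ A₂ : 𝕜} (hα : α ≠ 0) (hA₁ : A₁ ≠ 0) (hA₂ : A₂ ≠ 0) :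
    eT α • lift (S₀ α) ∈ Lx α A₁ A₂ ∧ eT (-α) • lift (S₁ α) ∈ Lx α A₁ A₂ := by
  have h0 : ⁅Xtilde 𝕜, partialVF 𝕜 DynVar.x⁆ = 0 := baseVF_lie 2 1
  have h1 : ⁅Xtilde 𝕜, Xtilde 𝕜⁆ = 0 := lie_self (L := VF 𝕜 DynVar) _
  refine eigenvector_mem (x := Xtilde 𝕜) (k := K₀ α A₁ A₂)
    (c := partialVF 𝕜 DynVar.x + (coord (DynVar.dt 0) : Fn 𝕜 DynVar) • Xtilde 𝕜) hα hA₁ hA₂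
    (Xtilde_mem α A₁ A₂) (K₀_mem α A₁ A₂) ?_ ?_ (Xtilde_lie_eT_smul_lift α _)
    (Xtilde_lie_eT_smul_lift (-α) _)
  · rw [K₀_eq]
    refine Derivation.ext fun F => ?_
    simp only [Derivation.sub_apply, Derivation.add_apply, Derivation.smul_apply, smul_eq_mul,
      smul_mul_assoc]
  · refine Derivation.ext fun F => ?_
    have h0' := congrArg (fun W : VF 𝕜 DynVar => W F) h0
    have h2 : ⁅Xtilde 𝕜, (coord (DynVar.dt 0) : Fn 𝕜 DynVar) • Xtilde 𝕜⁆ F = 0 := by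
      rw [lie_fsmul, Xtilde_dt, h1]
      simp only [Derivation.add_apply, Derivation.smul_apply, Derivation.zero_apply, smul_eq_mul,
        mul_zero, zero_mul, add_zero]
    rw [Derivation.commutator_apply] at h2 ⊢
    simp only [Derivation.commutator_apply] at h0'
    simp only [Derivation.add_apply, map_add, Derivation.zero_apply] at h0' h2 ⊢
    linear_combination h0' + h2

/-- Up to an exponential of `t`, every commutator of `S₀` and `S₁` lies in `L_x`. -/
theorem exists_eT_smul_lift_mem {α A₁ A₂ : 𝕜} (hα : α ≠ 0) (hA₁ : A₁ ≠ 0) (hA₂ : A₂ ≠ 0) {m : ℕ}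
    {Y : VF 𝕜 ℤ} (hY : IsCommutator α m Y) :
    Formal Y ∧ ∃ β : 𝕜, eT β • lift Y ∈ Lx α A₁ A₂ := by
  induction hY with
  | left => exact ⟨formal_S₀ α, α, (eT_smul_lift_mem hα hA₁ hA₂).1⟩
  | right => exact ⟨formal_S₁ α, -α, (eT_smul_lift_mem hα hA₁ hA₂).2⟩
  | @bracket m n Y Z _ _ hY hZ =>
    obtain ⟨fY, β, hβ⟩ := hY
    obtain ⟨fZ, γ, hγ⟩ := hZ
    refine ⟨fY.lie fZ, β + γ, ?_⟩
    have h : eT (β + γ) • lift ⁅Y, Z⁆ = ⁅eT β • lift Y, eT γ • lift Z⁆ := by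
      have h1 : ∀ W : VF 𝕜 ℤ, ∀ δ : 𝕜, lift W (eT δ) = 0 := fun W δ => by
        rw [(formal_lift W).apply_eT, lift_t_zero, zero_mul, smul_zero]
      rw [lift_lie fY fZ, ← eT_mul]
      refine Derivation.ext fun F => ?_
      simp only [Derivation.commutator_apply, Derivation.smul_apply, smul_eq_mul,
        Derivation.leibniz, h1]
      ring
    rw [h]
    exact LieSubalgebra.lie_mem _ hβ hγ

theorem basisLx_inl (α : 𝕜) (a : Fin 3) : basisLx α (Sum.inl a) = baseVF 𝕜 a := rfl

theorem basisLx_inr (α : 𝕜) (x : Fin 2 ⊕ ℕ ⊕ ℕ) :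
    basisLx α (Sum.inr x) = lift (tauBasis α x) := by
  rcases x with i | k | k
  · fin_cases i <;> rfl
  · rfl
  · rfl

theorem tauBasis_mem_V (α : 𝕜) (x : Fin 2 ⊕ ℕ ⊕ ℕ) : ∃ n, tauBasis α x ∈ V α n := by
  rcases x with i | k | k
  · refine ⟨0, ?_⟩
    rw [← span_basisV]
    exact Submodule.subset_span ⟨Sum.inl i, basisV_eq _ _ _⟩
  · refine ⟨k + 1, ?_⟩
    rw [← span_basisV]
    exact Submodule.subset_span ⟨Sum.inr (Sum.inl ⟨k, by omega⟩), basisV_eq _ _ _⟩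
  · refine ⟨2 * (k + 1), ?_⟩
    rw [← span_basisV]
    exact Submodule.subset_span ⟨Sum.inr (Sum.inr ⟨k, by omega⟩), basisV_eq _ _ _⟩

theorem formal_of_isCommutator {α : 𝕜} {m : ℕ} {Y : VF 𝕜 ℤ} (h : IsCommutator α m Y) :
    Formal Y := by
  induction h with
  | left => exact formal_S₀ α
  | right => exact formal_S₁ α
  | bracket _ _ h1 h2 => exact h1.lie h2

/-- The union of the spaces `V_n` is closed under brackets. -/
theorem lie_mem_V {α : 𝕜} {m n : ℕ} {Y Z : VF 𝕜 ℤ} (hY : Y ∈ V α m) (hZ : Z ∈ V α n) :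
    ⁅Y, Z⁆ ∈ V α (m + n + 1) := by
  have h : ∀ n, V α n = commSpan 𝕜 (S₀ α) (S₁ α) n := fun n => by
    simp only [V, commSpan, isCommutator_iff]
  rw [h] at hY hZ ⊢
  exact lie_mem_commSpan_add hY hZ

theorem formal_of_mem_V {α : 𝕜} {n : ℕ} {Y : VF 𝕜 ℤ} (hY : Y ∈ V α n) : Formal Y := by
  refine Submodule.span_induction (p := fun Y _ => Formal Y) ?_ formal_zero
    (fun _ _ _ _ h1 h2 => h1.add h2) (fun c _ _ h => h.smul c) hY
  rintro Y ⟨m, _, hY⟩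
  exact formal_of_isCommutator hY

/-- A space of vector fields closed under multiplication by functions contains the lifts of `V_n`
if it contains the lifts of a spanning set. -/
theorem lift_mem_of_span {B : Submodule (Fn 𝕜 DynVar) (VF 𝕜 DynVar)} {s : Set (VF 𝕜 ℤ)}
    (h : ∀ Z ∈ s, lift Z ∈ B) {Y : VF 𝕜 ℤ} (hY : Y ∈ Submodule.span 𝕜 s) : lift Y ∈ B := by
  have : Submodule.span 𝕜 s ≤ (B.restrictScalars 𝕜).comap (liftHom 𝕜) :=
    Submodule.span_le.2 h
  exact this hY

theorem K₀_mem_iff {α A₁ A₂ : 𝕜} {B : Submodule (Fn 𝕜 DynVar) (VF 𝕜 DynVar)} (h : Xtilde 𝕜 ∈ B)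
    (h₀ : lift (S₀ α) ∈ B) (h₁ : lift (S₁ α) ∈ B) :
    K₀ α A₁ A₂ ∈ B ↔ partialVF 𝕜 DynVar.x ∈ B := by
  have e1 : K₀ α A₁ A₂ = partialVF 𝕜 DynVar.x + (coord (DynVar.dt 0) : Fn 𝕜 DynVar) • Xtilde 𝕜 +
      (-(A₁ • eT α)) • lift (S₀ α) + (-(A₂ • eT (-α))) • lift (S₁ α) := by
    rw [K₀_eq]
    refine Derivation.ext fun F => ?_
    simp only [Derivation.sub_apply, Derivation.add_apply, Derivation.smul_apply, smul_eq_mul]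
    ring
  have e2 : partialVF 𝕜 DynVar.x = K₀ α A₁ A₂ + (-coord (DynVar.dt 0) : Fn 𝕜 DynVar) • Xtilde 𝕜 +
      (A₁ • eT α) • lift (S₀ α) + (A₂ • eT (-α)) • lift (S₁ α) := by
    rw [K₀_eq]
    refine Derivation.ext fun F => ?_
    simp only [Derivation.sub_apply, Derivation.add_apply, Derivation.smul_apply, smul_eq_mul]
    ring
  constructor
  · intro hK
    rw [e2]
    exact B.add_mem (B.add_mem (B.add_mem hK (B.smul_mem _ h)) (B.smul_mem _ h₀)) (B.smul_mem _ h₁)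
  · intro hx
    rw [e1]
    exact B.add_mem (B.add_mem (B.add_mem hx (B.smul_mem _ h)) (B.smul_mem _ h₀)) (B.smul_mem _ h₁)

/-- The span over functions of a set of vector fields is closed under brackets as soon as it
contains the brackets of the members of the set. -/
theorem lie_mem_span {ι : Type*} {s : Set (VF 𝕜 ι)}
    (h : ∀ Z ∈ s, ∀ W ∈ s, ⁅Z, W⁆ ∈ Submodule.span (Fn 𝕜 ι) s) {Z W : VF 𝕜 ι}
    (hZ : Z ∈ Submodule.span (Fn 𝕜 ι) s) (hW : W ∈ Submodule.span (Fn 𝕜 ι) s) :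
    ⁅Z, W⁆ ∈ Submodule.span (Fn 𝕜 ι) s := by
  have e1 : ∀ W : VF 𝕜 ι, ⁅(0 : VF 𝕜 ι), W⁆ = 0 := fun W =>
    Derivation.ext fun F => by simp [Derivation.commutator_apply]
  have e2 : ∀ W : VF 𝕜 ι, ⁅W, (0 : VF 𝕜 ι)⁆ = 0 := fun W =>
    Derivation.ext fun F => by simp [Derivation.commutator_apply]
  have e3 : ∀ Y Z W : VF 𝕜 ι, ⁅Y + Z, W⁆ = ⁅Y, W⁆ + ⁅Z, W⁆ := fun Y Z W =>
    Derivation.ext fun F => by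
      simp only [Derivation.commutator_apply, Derivation.add_apply, map_add]; ring
  have e4 : ∀ Y Z W : VF 𝕜 ι, ⁅Y, Z + W⁆ = ⁅Y, Z⁆ + ⁅Y, W⁆ := fun Y Z W =>
    Derivation.ext fun F => by
      simp only [Derivation.commutator_apply, Derivation.add_apply, map_add]; ring
  have e5 : ∀ (f : Fn 𝕜 ι) (Z W : VF 𝕜 ι), ⁅f • Z, W⁆ = f • ⁅Z, W⁆ + (-W f) • Z := by
    intro f Z W
    rw [fsmul_lie]
    refine Derivation.ext fun F => ?_
    simp only [Derivation.sub_apply, Derivation.add_apply, Derivation.smul_apply, smul_eq_mul]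
    ring
  induction hZ, hW using Submodule.span_induction₂ with
  | mem_mem Z W hZ hW => exact h Z hZ W hW
  | zero_left W _ => rw [e1]; exact Submodule.zero_mem _
  | zero_right Z _ => rw [e2]; exact Submodule.zero_mem _
  | add_left Y Z W _ _ _ h1 h2 => rw [e3]; exact Submodule.add_mem _ h1 h2
  | add_right Y Z W _ _ _ h1 h2 => rw [e4]; exact Submodule.add_mem _ h1 h2
  | smul_left f Z W hZ hW h1 =>
    rw [e5]
    exact Submodule.add_mem _ (Submodule.smul_mem _ _ h1) (Submodule.smul_mem _ _ hZ)
  | smul_right f Z W hZ hW h1 =>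
    rw [lie_fsmul]
    exact Submodule.add_mem _ (Submodule.smul_mem _ _ hW) (Submodule.smul_mem _ _ h1)

/-- A space of vector fields closed under multiplication by functions and under brackets, as a Lie
algebra over the constants. -/
def lieOfSubmodule {ι : Type*} (B : Submodule (Fn 𝕜 ι) (VF 𝕜 ι))
    (h : ∀ Z ∈ B, ∀ W ∈ B, ⁅Z, W⁆ ∈ B) : LieSubalgebra 𝕜 (VF 𝕜 ι) where
  carrier := B
  add_mem' hZ hW := B.add_mem hZ hW
  zero_mem' := B.zero_mem
  smul_mem' c _ hZ := (B.restrictScalars 𝕜).smul_mem c hZ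
  lie_mem' {Z W} hZ hW := h Z hZ W hW

theorem lift_lie_baseVF (Z : VF 𝕜 ℤ) (a : Fin 3) : ⁅lift Z, baseVF 𝕜 a⁆ = 0 := by
  refine Derivation.ext fun F => ?_
  have h := congrArg (fun W : VF 𝕜 DynVar => W F) (baseVF_lie_lift a Z)
  simp only [Derivation.commutator_apply, Derivation.zero_apply] at h ⊢
  linear_combination -h

theorem span_basisLx {α A₁ A₂ : 𝕜} (hα : α ≠ 0) (hA₁ : A₁ ≠ 0) (hA₂ : A₂ ≠ 0) :
    Submodule.span (Fn 𝕜 DynVar) (Set.range (basisLx α)) =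
      Submodule.span (Fn 𝕜 DynVar) (Lx α A₁ A₂ : Set (VF 𝕜 DynVar)) := by
  have hV0 : S₀ α ∈ V α 0 ∧ S₁ α ∈ V α 0 :=
    ⟨Submodule.subset_span ⟨0, le_rfl, IsCommutator.left⟩,
      Submodule.subset_span ⟨0, le_rfl, IsCommutator.right⟩⟩
  refine le_antisymm (Submodule.span_le.2 ?_) (Submodule.span_le.2 ?_)
  · set C := Submodule.span (Fn 𝕜 DynVar) (Lx α A₁ A₂ : Set (VF 𝕜 DynVar)) with hC
    have hsub : ∀ {Z}, Z ∈ Lx α A₁ A₂ → Z ∈ C := fun h => Submodule.subset_span h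
    have hlift : ∀ {n Y}, Y ∈ V α n → lift Y ∈ C := by
      intro n Y hY
      refine lift_mem_of_span (fun Z hZ => ?_) hY
      obtain ⟨m, _, hZ⟩ := hZ
      obtain ⟨_, β, hβ⟩ := exists_eT_smul_lift_mem hα hA₁ hA₂ hZ
      have h1 : lift Z = eT (-β) • (eT β • lift Z) := by
        refine Derivation.ext fun F => ?_
        simp only [Derivation.smul_apply, smul_eq_mul]
        rw [← mul_assoc, eT_neg_mul, one_mul]
      rw [h1]
      exact C.smul_mem _ (hsub hβ)
    rintro _ ⟨a | x, rfl⟩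
    · rw [basisLx_inl]
      fin_cases a
      · exact hsub (X_mem α A₁ A₂)
      · exact (K₀_mem_iff (hsub (Xtilde_mem α A₁ A₂)) (hlift hV0.1) (hlift hV0.2)).1
          (hsub (K₀_mem α A₁ A₂))
      · exact hsub (Xtilde_mem α A₁ A₂)
    · rw [basisLx_inr]
      obtain ⟨n, hn⟩ := tauBasis_mem_V α x
      exact hlift hn
  · set B := Submodule.span (Fn 𝕜 DynVar) (Set.range (basisLx α)) with hB
    have hbase : ∀ a, baseVF 𝕜 a ∈ B := fun a => Submodule.subset_span ⟨Sum.inl a, rfl⟩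
    have hV : ∀ {n Y}, Y ∈ V α n → lift Y ∈ B := by
      intro n Y hY
      rw [← span_basisV] at hY
      refine lift_mem_of_span ?_ hY
      rintro _ ⟨x, rfl⟩
      rw [basisV_eq, ← basisLx_inr]
      exact Submodule.subset_span ⟨_, rfl⟩
    have hlie : ∀ Z ∈ Set.range (basisLx α), ∀ W ∈ Set.range (basisLx α), ⁅Z, W⁆ ∈ B := by
      rintro _ ⟨a | x, rfl⟩ _ ⟨b | y, rfl⟩
      · rw [basisLx_inl, basisLx_inl, baseVF_lie]
        exact B.zero_mem
      · rw [basisLx_inl, basisLx_inr, baseVF_lie_lift]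
        exact B.zero_mem
      · rw [basisLx_inl, basisLx_inr, lift_lie_baseVF]
        exact B.zero_mem
      · rw [basisLx_inr, basisLx_inr]
        obtain ⟨m, hm⟩ := tauBasis_mem_V α x
        obtain ⟨n, hn⟩ := tauBasis_mem_V α y
        rw [← lift_lie (formal_of_mem_V hm) (formal_of_mem_V hn)]
        exact hV (lie_mem_V hm hn)
    have hL : Lx α A₁ A₂ ≤ lieOfSubmodule B fun Z hZ W hW => lie_mem_span hlie hZ hW := by
      refine LieSubalgebra.lieSpan_le.2 ?_
      rintro Z (rfl | rfl)
      · exact (K₀_mem_iff (hbase 2) (hV hV0.1) (hV hV0.2)).2 (hbase 1)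
      · exact hbase 0
    exact hL

end Span

/-! ### Independence and infinite dimension of the characteristic Lie algebra -/

section DomainIndependence

/-- Linear independence over a domain is preserved by an embedding into a larger domain, since it is
witnessed by a left inverse up to a nonzero factor. -/
theorem LinearIndependent.map_ringHom {R S I J : Type*} [CommRing R] [IsDomain R] [CommRing S]
    [IsDomain S] {φ : R →+* S} (hφ : Function.Injective φ) {v : J → I → R}
    (hv : LinearIndependent R v) : LinearIndependent S fun j i => φ (v j i) := by
  classical
  rw [linearIndependent_iff']
  intro K g hg j hj
  obtain ⟨s, b, d, hd, hb⟩ := exists_left_inverse (hv.comp (fun k : K => (k : J))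
    Subtype.val_injective)
  have h1 : ∑ i ∈ s, φ (b ⟨j, hj⟩ i) * ∑ k : K, g k * φ (v k i) = 0 :=
    Finset.sum_eq_zero fun i _ => by
      have h2 := congrFun hg i
      rw [Finset.sum_apply, ← Finset.sum_coe_sort] at h2
      exact mul_eq_zero_of_right _ h2
  simp only [Finset.mul_sum] at h1
  rw [Finset.sum_comm] at h1
  have h3 : ∀ k : K, ∑ i ∈ s, φ (b ⟨j, hj⟩ i) * (g k * φ (v k i)) =
      if ⟨j, hj⟩ = k then g k * φ d else 0 := by
    intro k
    have h4 := congrArg φ (hb ⟨j, hj⟩ k)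
    rw [map_sum] at h4
    have h5 : ∑ i ∈ s, φ (b ⟨j, hj⟩ i) * (g k * φ (v k i)) =
        g k * ∑ i ∈ s, φ (b ⟨j, hj⟩ i * v k i) := by
      rw [Finset.mul_sum]
      refine Finset.sum_congr rfl fun i _ => ?_
      rw [map_mul]
      ring
    rw [h5]
    refine (congrArg (g k * ·) h4).trans ?_
    split_ifs <;> simp
  simp only [h3, Finset.sum_ite_eq, Finset.mem_univ, if_true] at h1
  exact (mul_eq_zero.1 h1).resolve_right ((map_ne_zero_iff φ hφ).2 hd)

/-- A set of vectors over a domain whose span contains an infinite linearly independent family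
contains arbitrarily many linearly independent vectors: over the field of fractions the set contains
a basis of its span. -/
theorem exists_linearIndependent_of_span {R I J : Type*} [CommRing R] [IsDomain R] [Infinite J]
    {s : Set (I → R)} {v : J → I → R} (hv : LinearIndependent R v)
    (hs : ∀ j, v j ∈ Submodule.span R s) (m : ℕ) :
    ∃ w : Fin m → I → R, (∀ k, w k ∈ s) ∧ LinearIndependent R w := by
  classical
  let K := FractionRing R
  let φ : (I → R) →ₗ[R] (I → K) := (Algebra.linearMap R K).compLeft I
  have hK : LinearIndependent K fun j => φ (v j) :=
    LinearIndependent.map_ringHom (φ := algebraMap R K) (IsFractionRing.injective R K) hv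
  have hsK : ∀ j, φ (v j) ∈ Submodule.span K (φ '' s) := by
    intro j
    have h1 : Submodule.span R s ≤
        ((Submodule.span K (φ '' s)).restrictScalars R).comap φ :=
      Submodule.span_le.2 fun x hx => Submodule.subset_span ⟨x, hx, rfl⟩
    exact h1 (hs j)
  obtain ⟨b, hb, hspan, hli⟩ := exists_linearIndependent K (φ '' s)
  have hinf : Infinite b := by
    by_contra hfin
    rw [not_infinite_iff_finite] at hfin
    have := Fintype.ofFinite b
    have := hK.finite_of_le_span_finite _ b (by
      rw [hspan]
      rintro _ ⟨j, rfl⟩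
      exact hsK j)
    exact not_finite J
  choose f hf hφf using fun x : b => hb x.2
  let e : Fin m ↪ b := (Fin.valEmbedding).trans (Infinite.natEmbedding b)
  refine ⟨fun k => f (e k), fun k => hf _, LinearIndependent.of_comp φ ?_⟩
  have h2 : (fun k => φ (f (e k))) = (fun x : b => (x : I → K)) ∘ e := funext fun k => hφf _
  change LinearIndependent R fun k => φ (f (e k))
  rw [h2]
  exact (hli.comp e e.injective).restrict_scalars' R

end DomainIndependence

section Independence

variable {𝕜 : Type*} [RCLike 𝕜]

/-- The values of a vector field on the coordinates `t_x`, `x`, `t` and on the `τ_j`, in terms of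
its coefficients. -/
noncomputable def adapted (𝕜 : Type*) [RCLike 𝕜] : (DynVar → Fn 𝕜 DynVar) →ₗ[Fn 𝕜 DynVar]
    (Fin 3 → Fn 𝕜 DynVar) × (ℤ → Fn 𝕜 DynVar) where
  toFun v := (![v (DynVar.dt 0), v DynVar.x, v (DynVar.t 0)],
    fun j => v (DynVar.t j) - v (DynVar.t (j + 1)))
  map_add' v w := by
    refine Prod.ext ?_ ?_
    · funext a; fin_cases a <;> rfl
    · funext j
      simp only [Pi.add_apply, Prod.mk_add_mk]
      ring
  map_smul' c v := by
    refine Prod.ext ?_ ?_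
    · funext a; fin_cases a <;> rfl
    · funext j
      simp only [Pi.smul_apply, smul_eq_mul, RingHom.id_apply, Prod.smul_mk]
      ring

theorem adapted_coeffs_snd (Z : VF 𝕜 DynVar) (j : ℤ) :
    (adapted 𝕜 (coeffs Z)).2 j = Z (pull (coord j)) := by
  rw [pull_coord, map_sub]
  rfl

theorem linearIndependent_basisLx {α : 𝕜} (hα : α ≠ 0) :
    LinearIndependent (Fn 𝕜 DynVar) fun x => coeffs (basisLx α x) := by
  refine LinearIndependent.of_comp (adapted 𝕜) ?_
  have h1 : LinearIndependent (Fn 𝕜 DynVar)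
      fun a : Fin 3 => (Pi.single a 1 : Fin 3 → Fn 𝕜 DynVar) := Pi.linearIndependent_single_one _ _
  have h2 : LinearIndependent (Fn 𝕜 DynVar) fun x j => pull (coeffs (tauBasis α x) j) :=
    LinearIndependent.map_ringHom (φ := (pull : Fn 𝕜 ℤ →ₐ[𝕜] Fn 𝕜 DynVar).toRingHom)
      pull_injective (linearIndependent_tauBasis hα)
  have h3 := linearIndependent_inl_union_inr' h1 h2
  have h4 : (⇑(adapted 𝕜) ∘ fun x => coeffs (basisLx α x)) = Sum.elim
      (LinearMap.inl (Fn 𝕜 DynVar) (Fin 3 → Fn 𝕜 DynVar) (ℤ → Fn 𝕜 DynVar) ∘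
        fun a : Fin 3 => (Pi.single a 1 : Fin 3 → Fn 𝕜 DynVar))
      (LinearMap.inr (Fn 𝕜 DynVar) (Fin 3 → Fn 𝕜 DynVar) (ℤ → Fn 𝕜 DynVar) ∘
        fun x j => pull (coeffs (tauBasis α x) j)) := by
    funext x
    rcases x with a | x
    · refine Prod.ext ?_ ?_
      · change ![baseVF 𝕜 a (coord (DynVar.dt 0)), baseVF 𝕜 a (coord DynVar.x),
          baseVF 𝕜 a (coord (DynVar.t 0))] = Pi.single a 1
        fin_cases a
        · change ![partialVF 𝕜 _ _, partialVF 𝕜 _ _, partialVF 𝕜 _ _] = _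
          rw [partialVF_coord, partialVF_coord, partialVF_coord]
          funext b; fin_cases b <;> simp
        · change ![partialVF 𝕜 _ _, partialVF 𝕜 _ _, partialVF 𝕜 _ _] = _
          rw [partialVF_coord, partialVF_coord, partialVF_coord]
          funext b; fin_cases b <;> simp
        · change ![Xtilde 𝕜 _, Xtilde 𝕜 _, Xtilde 𝕜 _] = _
          rw [Xtilde_dt, Xtilde_x, Xtilde_t]
          funext b; fin_cases b <;> simp
      · funext j
        exact (adapted_coeffs_snd _ _).trans (baseVF_pull_coord a j)
    · refine Prod.ext ?_ ?_
      · change ![basisLx α (Sum.inr x) (coord (DynVar.dt 0)),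
          basisLx α (Sum.inr x) (coord DynVar.x), basisLx α (Sum.inr x) (coord (DynVar.t 0))] = 0
        rw [basisLx_inr, lift_dt, lift_x, lift_t_zero]
        funext b; fin_cases b <;> rfl
      · funext j
        refine (adapted_coeffs_snd _ _).trans ?_
        rw [basisLx_inr, lift_pull_coord]
        rfl
  rw [h4]
  exact h3

/-- The coefficients of a vector field, as a linear map over functions. -/
def coeffsMap (𝕜 : Type*) [RCLike 𝕜] (ι : Type*) : VF 𝕜 ι →ₗ[Fn 𝕜 ι] (ι → Fn 𝕜 ι) where
  toFun := coeffs
  map_add' _ _ := rfl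
  map_smul' _ _ := rfl

/-- `L_x` contains arbitrarily many vector fields whose coefficients are linearly independent over
functions. -/
theorem exists_linearIndependent_Lx {α A₁ A₂ : 𝕜} (hα : α ≠ 0) (hA₁ : A₁ ≠ 0) (hA₂ : A₂ ≠ 0)
    (m : ℕ) : ∃ Z : Fin m → VF 𝕜 DynVar, (∀ j, Z j ∈ Lx α A₁ A₂) ∧
      LinearIndependent (Fn 𝕜 DynVar) fun j => coeffs (Z j) := by
  obtain ⟨w, hw, hli⟩ := exists_linearIndependent_of_span
    (s := coeffsMap 𝕜 DynVar '' (Lx α A₁ A₂ : Set (VF 𝕜 DynVar))) (linearIndependent_basisLx hα)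
    (fun x => by
      rw [Submodule.span_image]
      refine ⟨basisLx α x, ?_, rfl⟩
      rw [SetLike.mem_coe, ← span_basisLx hα hA₁ hA₂]
      exact Submodule.subset_span ⟨x, rfl⟩) m
  choose Z hZ hZw using hw
  refine ⟨Z, hZ, ?_⟩
  have : (fun j => coeffs (Z j)) = w := funext hZw
  rwa [this]

theorem infiniteDim_Lx {α A₁ A₂ : 𝕜} (hα : α ≠ 0) (hA₁ : A₁ ≠ 0) (hA₂ : A₂ ≠ 0) :
    InfiniteDim (Lx α A₁ A₂) := fun m => by
  obtain ⟨Z, hZ, hli⟩ := exists_linearIndependent_Lx hα hA₁ hA₂ m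
  exact ⟨Z, hZ, fnIndep_of_linearIndependent hli⟩

theorem not_finiteDimensional_Lx {α A₁ A₂ : 𝕜} (hα : α ≠ 0) (hA₁ : A₁ ≠ 0) (hA₂ : A₂ ≠ 0) :
    ¬ FiniteDimensional 𝕜 (Lx α A₁ A₂) := by
  intro hfin
  obtain ⟨Z, hZ, hli⟩ :=
    exists_linearIndependent_Lx hα hA₁ hA₂ (Module.finrank 𝕜 (Lx α A₁ A₂) + 1)
  have h1 : LinearIndependent 𝕜 fun j => (⟨Z j, hZ j⟩ : Lx α A₁ A₂) :=
    LinearIndependent.of_comp (Lx α A₁ A₂).toSubmodule.subtype (linearIndependent_of_coeffs hli)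
  have h2 := h1.fintype_card_le_finrank
  rw [Fintype.card_fin] at h2
  omega

end Independence

/-! ### Independence of the rows of coefficients -/

section Rows

variable {𝕜 : Type*} [RCLike 𝕜]

/-- A linear relation between `L + 1` consecutive components of the vectors `v N` can be moved by the
triangular action of the shift to any other place. -/
theorem exists_row_relation {v : ℕ → ℤ → Fn 𝕜 ℤ} {u : ℕ → Fn 𝕜 ℤ} {C : ℕ → ℕ → Fn 𝕜 ℤ}
    (hv : ∀ N i, shift 𝕜 (v N (i - 1)) = u N * ∑ k ∈ Finset.range (N + 1), C N k * v k i)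
    (hu : ∀ N, u N ≠ 0) (hC : ∀ N, C N N = 1) {L : ℕ} {a : ℤ}
    (h : ∃ ω : ℕ → Fn 𝕜 ℤ, ω 0 ≠ 0 ∧ ω L ≠ 0 ∧
      ∀ k, ∑ j ∈ Finset.range (L + 1), ω j * v k (a + j) = 0) (c : ℤ) :
    ∃ ω : ℕ → Fn 𝕜 ℤ, ω 0 ≠ 0 ∧ ω L ≠ 0 ∧
      ∀ k, ∑ j ∈ Finset.range (L + 1), ω j * v k (c + j) = 0 := by
  obtain ⟨n, rfl⟩ : ∃ n, c = a + n := ⟨c - a, by ring⟩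
  induction n using Int.induction_on with
  | zero => simpa using h
  | succ n ih =>
    obtain ⟨ω, h0, hL, hω⟩ := ih
    refine ⟨fun j => shift 𝕜 (ω j), (map_ne_zero_iff _ (shift 𝕜).injective).2 h0,
      (map_ne_zero_iff _ (shift 𝕜).injective).2 hL, fun N => ?_⟩
    induction N using Nat.strong_induction_on with
    | _ N ihN =>
      have h1 := congrArg (shift 𝕜) (hω N)
      have h2 : ∀ j : ℕ, shift 𝕜 (ω j * v N (a + n + j)) = u N * ∑ k ∈ Finset.range (N + 1),
          C N k * (shift 𝕜 (ω j) * v k (a + (n + 1) + j)) := by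
        intro j
        rw [map_mul, show a + n + j = a + (n + 1) + j - 1 by ring, hv, mul_left_comm,
          Finset.mul_sum]
        congr 1
        exact Finset.sum_congr rfl fun k _ => mul_left_comm _ _ _
      rw [map_sum, map_zero] at h1
      simp only [h2] at h1
      rw [← Finset.mul_sum, Finset.sum_comm] at h1
      have h3 := (mul_eq_zero.1 h1).resolve_left (hu N)
      simp only [← Finset.mul_sum] at h3
      rw [Finset.sum_range_succ, Finset.sum_eq_zero, zero_add, hC, one_mul] at h3
      · exact_mod_cast h3
      · intro k hk
        have := ihN k (Finset.mem_range.1 hk)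
        push_cast at this
        rw [this, mul_zero]
  | pred n ih =>
    obtain ⟨ω, h0, hL, hω⟩ := ih
    refine ⟨fun j => (shift 𝕜).symm (ω j), (map_ne_zero_iff _ (shift 𝕜).symm.injective).2 h0,
      (map_ne_zero_iff _ (shift 𝕜).symm.injective).2 hL, fun N => ?_⟩
    refine (shift 𝕜).injective ?_
    rw [map_sum, map_zero]
    have h2 : ∀ j : ℕ, shift 𝕜 ((shift 𝕜).symm (ω j) * v N (a + (-n - 1) + j)) =
        u N * ∑ k ∈ Finset.range (N + 1), C N k * (ω j * v k (a + -n + j)) := by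
      intro j
      rw [map_mul, AlgEquiv.apply_symm_apply, show a + (-n - 1) + j = a + -n + j - 1 by ring, hv,
        mul_left_comm, Finset.mul_sum]
      congr 1
      exact Finset.sum_congr rfl fun k _ => mul_left_comm _ _ _
    simp only [h2]
    rw [← Finset.mul_sum, Finset.sum_comm]
    simp only [← Finset.mul_sum, hω, mul_zero, Finset.sum_const_zero]

/-- If the vectors `v N`, on which the shift acts by an invertible triangular matrix, are linearly
independent, then so are their components. A relation of length `L + 1` between components, moved
to all places, would make every vector determined by `L` consecutive components, and `L + 1` of the
vectors would be dependent. -/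
theorem linearIndependent_rows {v : ℕ → ℤ → Fn 𝕜 ℤ} {u : ℕ → Fn 𝕜 ℤ} {C : ℕ → ℕ → Fn 𝕜 ℤ}
    (hv : ∀ N i, shift 𝕜 (v N (i - 1)) = u N * ∑ k ∈ Finset.range (N + 1), C N k * v k i)
    (hu : ∀ N, u N ≠ 0) (hC : ∀ N, C N N = 1) (hli : LinearIndependent (Fn 𝕜 ℤ) v) :
    LinearIndependent (Fn 𝕜 ℤ) fun (i : ℤ) (k : ℕ) => v k i := by
  classical
  have hno : ∀ (L : ℕ) (a : ℤ), ¬ ∃ ω : ℕ → Fn 𝕜 ℤ, ω 0 ≠ 0 ∧ ω L ≠ 0 ∧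
      ∀ k, ∑ j ∈ Finset.range (L + 1), ω j * v k (a + j) = 0 := by
    intro L a h
    have hrel := exists_row_relation hv hu hC h
    have hdep : ¬ LinearIndependent (Fn 𝕜 ℤ) fun (k : Fin (L + 1)) (j : Fin L) => v k (j : ℕ) := by
      intro h1
      have := h1.fintype_card_le_finrank
      simp at this
    obtain ⟨f, hf, k, hk⟩ := Fintype.not_linearIndependent_iff.1 hdep
    let g : ℤ → Fn 𝕜 ℤ := fun i => ∑ k : Fin (L + 1), f k * v k i
    have hg0 : ∀ j : ℕ, j < L → g (0 + j) = 0 := by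
      intro j hj
      have := congrFun hf ⟨j, hj⟩
      rw [Finset.sum_apply] at this
      rw [zero_add]
      exact this
    have hωg : ∀ (ω : ℕ → Fn 𝕜 ℤ) (c : ℤ),
        (∀ k, ∑ j ∈ Finset.range (L + 1), ω j * v k (c + j) = 0) →
        ∑ j ∈ Finset.range (L + 1), ω j * g (c + j) = 0 := by
      intro ω c hω
      simp only [g, Finset.mul_sum]
      rw [Finset.sum_comm]
      refine Finset.sum_eq_zero fun k _ => ?_
      simp only [mul_left_comm (ω _)]
      rw [← Finset.mul_sum, hω, mul_zero]
    have hfwd : ∀ c, (∀ j : ℕ, j < L → g (c + j) = 0) → g (c + L) = 0 := by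
      intro c hc
      obtain ⟨ω, _, hL, hω⟩ := hrel c
      have h1 := hωg ω c hω
      rw [Finset.sum_range_succ, Finset.sum_eq_zero, zero_add] at h1
      · exact (mul_eq_zero.1 h1).resolve_left hL
      · intro j hj
        rw [hc j (Finset.mem_range.1 hj), mul_zero]
    have hbwd : ∀ c, (∀ j : ℕ, j < L → g (c + 1 + j) = 0) → g c = 0 := by
      intro c hc
      obtain ⟨ω, h0, _, hω⟩ := hrel c
      have h1 := hωg ω c hω
      rw [Finset.sum_range_succ', Finset.sum_eq_zero, zero_add] at h1
      · simpa using (mul_eq_zero.1 h1).resolve_left h0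
      · intro j hj
        have := hc j (Finset.mem_range.1 hj)
        rw [show c + 1 + j = c + (j + 1 : ℕ) by push_cast; ring] at this
        rw [this, mul_zero]
    have hall : ∀ c : ℤ, ∀ j : ℕ, j < L → g (c + j) = 0 := by
      intro c
      induction c using Int.induction_on with
      | zero => exact hg0
      | succ n ih =>
        intro j hj
        rcases Nat.lt_or_ge (j + 1) L with h1 | h1
        · have := ih (j + 1) h1
          rwa [show (n : ℤ) + (j + 1 : ℕ) = n + 1 + j by push_cast; ring] at this
        · have := hfwd n ih
          rwa [show (n : ℤ) + (L : ℕ) = n + 1 + j by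
            rw [show L = j + 1 by omega]; push_cast; ring] at this
      | pred n ih =>
        intro j hj
        rcases j with _ | j
        · have := hbwd (-n - 1) (by rwa [sub_add_cancel])
          simpa using this
        · have := ih j (by omega)
          rwa [show -(n : ℤ) + j = -n - 1 + (j + 1 : ℕ) by push_cast; ring] at this
    have hg : ∀ i, g i = 0 := fun i => by
      have := hfwd (i - L) (hall _)
      rwa [sub_add_cancel] at this
    have h2 := hli.comp (fun k : Fin (L + 1) => (k : ℕ)) Fin.val_injective
    refine hk (Fintype.linearIndependent_iff.1 h2 f (funext fun i => ?_) k)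
    rw [Finset.sum_apply]
    exact hg i
  rw [linearIndependent_iff']
  intro s f hf
  by_contra! hne
  obtain ⟨i₀, hi₀, hne⟩ := hne
  set s' := s.filter fun i => f i ≠ 0 with hs'
  have hs'n : s'.Nonempty := ⟨i₀, Finset.mem_filter.2 ⟨hi₀, hne⟩⟩
  set a := s'.min' hs'n with ha
  set b := s'.max' hs'n with hb
  have hab : a ≤ b := s'.min'_le_max' hs'n
  obtain ⟨L, hL⟩ : ∃ L : ℕ, b = a + L := ⟨(b - a).toNat, by omega⟩
  have hmem : ∀ i ∈ s', f i ≠ 0 := fun i hi => (Finset.mem_filter.1 hi).2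
  have has : a ∈ s' := s'.min'_mem hs'n
  have hbs : b ∈ s' := s'.max'_mem hs'n
  refine hno L a ⟨fun j => if a + j ∈ s' then f (a + j) else 0, ?_, ?_, fun k => ?_⟩
  · simp only [Nat.cast_zero, add_zero, if_pos has]
    exact hmem a has
  · simp only [← hL, if_pos hbs]
    exact hmem b hbs
  · have h1 := congrFun hf k
    rw [Finset.sum_apply] at h1
    have h2 : ∑ i ∈ s', f i * v k i = 0 := by
      rw [← Pi.zero_apply (M := fun _ => Fn 𝕜 ℤ) k, ← h1]
      refine Finset.sum_subset (Finset.filter_subset _ _) fun i hi hi' => ?_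
      have : f i = 0 := by
        by_contra h
        exact hi' (Finset.mem_filter.2 ⟨hi, h⟩)
      rw [this, zero_mul]
    refine Eq.trans ?_ h2
    dsimp only
    refine Finset.sum_bij_ne_zero (fun j _ _ => a + j) ?_ ?_ ?_ ?_
    · intro j _ h
      by_contra hj
      exact h (by rw [if_neg hj, zero_mul])
    · intro j _ _ l _ _ h
      omega
    · intro i hi h
      have h3 := s'.min'_le i hi
      have h4 := s'.le_max' i hi
      refine ⟨(i - a).toNat, Finset.mem_range.2 (by omega), ?_, by omega⟩
      rw [show a + ((i - a).toNat : ℤ) = i by omega, if_pos hi]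
      exact h
    · intro j _ h
      have hj : a + (j : ℤ) ∈ s' := by
        by_contra hj
        exact h (by rw [if_neg hj, zero_mul])
      rw [if_pos hj]

theorem linearIndependent_rows_triCoeff {α : 𝕜} (hα : α ≠ 0) :
    LinearIndependent (Fn 𝕜 ℤ) fun (i : ℤ) (k : ℕ) => triCoeff α k i := by
  obtain ⟨u, C, hv, hu, hC, _⟩ := exists_triCoeff α
  exact linearIndependent_rows (C := fun N k => algebraMap 𝕜 (Fn 𝕜 ℤ) (C N k)) hv hu
    (fun N => by rw [hC, map_one]) (linearIndependent_triCoeff hα)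

end Rows

/-! ### Vector fields annihilating a function on a region -/

section Annihilator

variable {𝕜 : Type*} [RCLike 𝕜] {ι : Type*} [DecidableEq ι]

/-- The formal vector fields that annihilate the function `F` on the region `U`, where `s` is a
finite set of variables on which alone `F` depends. -/
def annihilator (U : Set (ι → 𝕜)) (F : (ι → 𝕜) → 𝕜) (s : Finset ι) :
    Submodule (Fn 𝕜 ι) (VF 𝕜 ι) where
  carrier := {Z | Formal Z ∧ ∀ p ∈ U, ∑ i ∈ s, (Z (coord i)).1 p * pd i F p = 0}
  add_mem' {Z W} hZ hW := by
    refine ⟨hZ.1.add hW.1, fun p hp => ?_⟩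
    have h : ∀ i, ((Z + W) (coord i)).1 p * pd i F p =
        (Z (coord i)).1 p * pd i F p + (W (coord i)).1 p * pd i F p := fun i =>
      add_mul ((Z (coord i)).1 p) ((W (coord i)).1 p) _
    simp only [h]
    rw [Finset.sum_add_distrib, hZ.2 p hp, hW.2 p hp, add_zero]
  zero_mem' := ⟨formal_zero, fun p _ => Finset.sum_eq_zero fun i _ => zero_mul (pd i F p)⟩
  smul_mem' f Z hZ := by
    refine ⟨hZ.1.fsmul f, fun p hp => ?_⟩
    have h : ∀ i, ((f • Z) (coord i)).1 p * pd i F p =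
        f.1 p * ((Z (coord i)).1 p * pd i F p) := fun i =>
      mul_assoc (f.1 p) ((Z (coord i)).1 p) _
    simp only [h]
    rw [← Finset.mul_sum, hZ.2 p hp, mul_zero]

/-- Differentiation of the relation `W F = 0` along `Z`. -/
theorem sum_apply_apply_mul_pd {U : Set (ι → 𝕜)} (hU : IsOpen U) {F : (ι → 𝕜) → 𝕜}
    (hF : IsLocFun U F) {s : Finset ι} (hs : ∀ i, i ∉ s → ∀ p ∈ U, pd i F p = 0) {Z W : VF 𝕜 ι}
    (hZ : Formal Z) (hW : ∀ p ∈ U, ∑ i ∈ s, (W (coord i)).1 p * pd i F p = 0) {p : ι → 𝕜}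
    (hp : p ∈ U) :
    ∑ i ∈ s, (Z (W (coord i))).1 p * pd i F p = -∑ k ∈ s, ∑ i ∈ s,
      (Z (coord k)).1 p * (W (coord i)).1 p * pd k (pd i F) p := by
  choose σ hσ using fun i => (W (coord i) : Fn 𝕜 ι).exists_support
  set t := s ∪ s.biUnion σ with ht
  have hder : ∀ k, ∑ i ∈ s, ((partialVF 𝕜 k (W (coord i))).1 p * pd i F p +
      (W (coord i)).1 p * pd k (pd i F) p) = 0 := by
    intro k
    have h1 : HasDerivAt (fun x => ∑ i ∈ s, (W (coord i)).1 (Function.update p k x) *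
        pd i F (Function.update p k x))
        (∑ i ∈ s, ((partialVF 𝕜 k (W (coord i))).1 p * pd i F p +
          (W (coord i)).1 p * pd k (pd i F) p)) (p k) := by
      refine HasDerivAt.fun_sum fun i _ => ?_
      have h2 := (differentiableAt_update k (W (coord i)) p).hasDerivAt
      have h3 := ((hF.pd hU i).differentiableAt hU k hp).hasDerivAt
      have h4 := h2.mul h3
      rw [Function.update_eq_self] at h4
      exact h4
    have h5 : (fun x => ∑ i ∈ s, (W (coord i)).1 (Function.update p k x) *
        pd i F (Function.update p k x)) =ᶠ[nhds (p k)] fun _ => 0 := by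
      filter_upwards [eventually_update_mem hU hp k] with x hx
      exact hW _ hx
    exact h1.unique ((hasDerivAt_const (p k) (0 : 𝕜)).congr_of_eventuallyEq h5)
  have hZW : ∀ i ∈ s, (Z (W (coord i))).1 p =
      ∑ k ∈ t, (Z (coord k)).1 p * (partialVF 𝕜 k (W (coord i))).1 p := by
    intro i hi
    rw [hZ.apply (s := t) fun k hk => hσ i k fun h => hk
      (Finset.mem_union_right _ (Finset.mem_biUnion.2 ⟨i, hi, h⟩)), Fn.sum_apply]
    rfl
  have h1 : ∑ i ∈ s, (Z (W (coord i))).1 p * pd i F p = -∑ k ∈ t, ∑ i ∈ s,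
      (Z (coord k)).1 p * (W (coord i)).1 p * pd k (pd i F) p := by
    rw [Finset.sum_congr rfl fun i hi => by rw [hZW i hi, Finset.sum_mul], Finset.sum_comm,
      ← Finset.sum_neg_distrib]
    refine Finset.sum_congr rfl fun k _ => ?_
    have h2 := congrArg ((Z (coord k)).1 p * ·) (hder k)
    simp only [Finset.mul_sum, mul_zero] at h2
    rw [eq_neg_iff_add_eq_zero, ← Finset.sum_add_distrib, ← h2]
    refine Finset.sum_congr rfl fun i _ => ?_
    ring
  rw [h1]
  refine congrArg Neg.neg (Finset.sum_subset Finset.subset_union_left fun k _ hk => ?_).symm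
  refine Finset.sum_eq_zero fun i _ => ?_
  -- The derivative `∂_k F` vanishes on the open set `U`, hence so does `∂_i ∂_k F`.
  have h3 : pd i (pd k F) p = 0 := by
    have h5 : (fun x => pd k F (Function.update p i x)) =ᶠ[nhds (p i)] fun _ => 0 := by
      filter_upwards [eventually_update_mem hU hp i] with x hx
      exact hs k hk _ hx
    exact ((hasDerivAt_const (p i) (0 : 𝕜)).congr_of_eventuallyEq h5).deriv
  rw [hF.pd_comm hU k i hp, h3, mul_zero]

theorem lie_mem_annihilator {U : Set (ι → 𝕜)} (hU : IsOpen U) {F : (ι → 𝕜) → 𝕜}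
    (hF : IsLocFun U F) {s : Finset ι} (hs : ∀ i, i ∉ s → ∀ p ∈ U, pd i F p = 0) {Z W : VF 𝕜 ι}
    (hZ : Z ∈ annihilator U F s) (hW : W ∈ annihilator U F s) : ⁅Z, W⁆ ∈ annihilator U F s := by
  refine ⟨hZ.1.lie hW.1, fun p hp => ?_⟩
  have h : ∀ i, (⁅Z, W⁆ (coord i)).1 p * pd i F p =
      (Z (W (coord i))).1 p * pd i F p - (W (Z (coord i))).1 p * pd i F p := fun i => by
    rw [Derivation.commutator_apply]
    exact sub_mul ((Z (W (coord i))).1 p) ((W (Z (coord i))).1 p) _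
  simp only [h]
  rw [Finset.sum_sub_distrib, sum_apply_apply_mul_pd hU hF hs hZ.1 hW.2 hp,
    sum_apply_apply_mul_pd hU hF hs hW.1 hZ.2 hp, sub_eq_zero, neg_inj, Finset.sum_comm]
  refine Finset.sum_congr rfl fun k _ => Finset.sum_congr rfl fun i _ => ?_
  rw [hF.pd_comm hU i k hp, mul_comm ((Z (coord i)).1 p)]

theorem partialVF_mem_annihilator {U : Set (ι → 𝕜)} {F : (ι → 𝕜) → 𝕜} {s : Finset ι}
    (hs : ∀ i, i ∉ s → ∀ p ∈ U, pd i F p = 0) (i : ι) :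
    partialVF 𝕜 i ∈ annihilator U F s ↔ ∀ p ∈ U, pd i F p = 0 := by
  have key : ∀ p ∈ U, ∑ j ∈ s, (partialVF 𝕜 i (coord j)).1 p * pd j F p = pd i F p := by
    intro p hp
    have h1 : ∀ j, (partialVF 𝕜 i (coord j)).1 p * pd j F p = if i = j then pd j F p else 0 := by
      intro j
      rw [partialVF_coord]
      split_ifs
      · exact one_mul _
      · exact zero_mul _
    simp only [h1, Finset.sum_ite_eq]
    split_ifs with hi
    · rfl
    · exact (hs i hi p hp).symm
  constructor
  · intro h p hp
    rw [← key p hp]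
    exact h.2 p hp
  · intro h
    exact ⟨formal_partialVF i, fun p hp => by rw [key p hp, h p hp]⟩

end Annihilator

/-! ### Absence of nontrivial `x`-integrals -/

section Integral

variable {𝕜 : Type*} [RCLike 𝕜]

/-- The total derivative `D_x`. -/
noncomputable def totalDx (α A₁ A₂ : 𝕜) : VF 𝕜 DynVar := vectorField (DxCoeff α A₁ A₂)

theorem totalDx_mem_annihilator {α A₁ A₂ : 𝕜} {U : Set (DynVar → 𝕜)} {F : (DynVar → 𝕜) → 𝕜}
    (hF : IsXIntegral α A₁ A₂ U F) {s : Finset DynVar}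
    (hs : ∀ i, i ∉ s → ∀ p ∈ U, pd i F p = 0) : totalDx α A₁ A₂ ∈ annihilator U F s := by
  refine ⟨formal_vectorField _, fun p hp => ?_⟩
  rw [← hF.2 p hp]
  simp only [totalDx, vectorField_coord]
  refine (finsum_eq_sum_of_support_subset _ fun i hi => ?_).symm
  by_contra h
  exact hi (by simp only [hs i h p hp, mul_zero])

theorem partialVF_dF (α A₁ A₂ : 𝕜) (m : ℕ) (j : ℤ) :
    partialVF 𝕜 (DynVar.dt m) (dF α A₁ A₂ j) = 0 := by
  simp [dF, partialVF_expF, partialVF_coord]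

theorem partialVF_dt_vel (α A₁ A₂ : 𝕜) (m : ℕ) (k : ℤ) :
    partialVF 𝕜 (DynVar.dt (m + 1)) (vel α A₁ A₂ k) = 0 := by
  refine int_ext (f := fun k => partialVF 𝕜 (DynVar.dt (m + 1)) (vel α A₁ A₂ k))
    (g := fun _ => 0) ?_ (fun j => ?_) k
  · simp only [vel_zero]
    rw [partialVF_coord, if_neg (by simp)]
  · simp only [vel_add_one, map_add, partialVF_dF, add_zero, sub_self]

/-- Brackets with `D_x` lower the order of `∂/∂(D_x ^ m t)`. -/
theorem partialVF_lie_totalDx (α A₁ A₂ : 𝕜) (m : ℕ) :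
    ⁅partialVF 𝕜 (DynVar.dt (m + 1)), totalDx α A₁ A₂⁆ = partialVF 𝕜 (DynVar.dt m) := by
  have hconst : ∀ i, totalDx α A₁ A₂ (partialVF 𝕜 (DynVar.dt (m + 1)) (coord i)) = 0 := fun i => by
    rw [partialVF_coord]
    split_ifs
    · exact Derivation.map_one_eq_zero _
    · exact map_zero _
  have hD : Formal (totalDx α A₁ A₂) := formal_vectorField _
  refine ((formal_partialVF _).lie hD).ext (formal_partialVF _) fun i => ?_
  rw [Derivation.commutator_apply, hconst, sub_zero, totalDx, vectorField_coord, partialVF_coord]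
  rcases i with _ | k | l
  · rw [if_neg (by simp)]
    exact Derivation.map_one_eq_zero _
  · rw [if_neg (by simp)]
    exact partialVF_dt_vel α A₁ A₂ m k
  · refine (partialVF_coord _ _).trans ?_
    simp

/-- An `x`-integral does not depend on the `D_x ^ m t`. -/
theorem pd_dt_eq_zero {α A₁ A₂ : 𝕜} {U : Set (DynVar → 𝕜)} (hU : IsOpen U)
    {F : (DynVar → 𝕜) → 𝕜} (hF : IsXIntegral α A₁ A₂ U F) {s : Finset DynVar}
    (hs : ∀ i, i ∉ s → ∀ p ∈ U, pd i F p = 0) (m : ℕ) : ∀ p ∈ U, pd (DynVar.dt m) F p = 0 := by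
  have hstep : ∀ m, (∀ p ∈ U, pd (DynVar.dt (m + 1)) F p = 0) →
      ∀ p ∈ U, pd (DynVar.dt m) F p = 0 := by
    intro m h
    rw [← partialVF_mem_annihilator hs] at h ⊢
    rw [← partialVF_lie_totalDx α A₁ A₂ m]
    exact lie_mem_annihilator hU hF.1 hs h (totalDx_mem_annihilator hF hs)
  obtain ⟨M, hM⟩ : ∃ M, ∀ m, M ≤ m → DynVar.dt m ∉ s := by
    have hfin : {m : ℕ | DynVar.dt m ∈ s}.Finite :=
      s.finite_toSet.preimage (fun a _ b _ h => DynVar.dt.inj h)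
    obtain ⟨M, hM⟩ := hfin.bddAbove
    exact ⟨M + 1, fun m hm h => by have := hM h; omega⟩
  have : ∀ n m, M ≤ m + n → ∀ p ∈ U, pd (DynVar.dt m) F p = 0 := by
    intro n
    induction n with
    | zero => exact fun m hm => hs _ (hM m hm)
    | succ n ih => exact fun m hm => hstep m (ih (m + 1) (by omega))
  exact this M m (by omega)

/-- The characteristic Lie algebra annihilates the `x`-integrals. -/
theorem Lx_le_annihilator {α A₁ A₂ : 𝕜} {U : Set (DynVar → 𝕜)} (hU : IsOpen U)
    {F : (DynVar → 𝕜) → 𝕜} (hF : IsXIntegral α A₁ A₂ U F) {s : Finset DynVar}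
    (hs : ∀ i, i ∉ s → ∀ p ∈ U, pd i F p = 0) :
    Submodule.span (Fn 𝕜 DynVar) (Lx α A₁ A₂ : Set (VF 𝕜 DynVar)) ≤ annihilator U F s := by
  refine Submodule.span_le.2 ?_
  have hL : Lx α A₁ A₂ ≤ lieOfSubmodule (annihilator U F s)
      fun Z hZ W hW => lie_mem_annihilator hU hF.1 hs hZ hW := by
    refine LieSubalgebra.lieSpan_le.2 ?_
    rintro Z (rfl | rfl)
    · refine ⟨formal_K₀ α A₁ A₂, fun p hp => ?_⟩
      rw [← (totalDx_mem_annihilator hF hs).2 p hp]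
      refine Finset.sum_congr rfl fun i _ => ?_
      rcases i with _ | k | m
      · rw [K₀_x, totalDx, vectorField_coord]
        rfl
      · rw [K₀_t, totalDx, vectorField_coord]
        rfl
      · rw [pd_dt_eq_zero hU hF hs m p hp, mul_zero, mul_zero]
    · exact (partialVF_mem_annihilator hs _).2 (pd_dt_eq_zero hU hF hs 0)
  exact hL

theorem lift_fsmul (f : Fn 𝕜 ℤ) (Z : VF 𝕜 ℤ) : lift (f • Z) = pull f • lift Z := by
  refine (formal_lift _).ext_dyn ((formal_lift _).fsmul _) ?_ ?_ (fun j => ?_) (fun m => ?_)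
  · simp only [Derivation.smul_apply, lift_x, smul_zero]
  · simp only [Derivation.smul_apply, lift_t_zero, smul_zero]
  · simp only [Derivation.smul_apply, lift_pull_coord, smul_eq_mul, map_mul]
  · simp only [Derivation.smul_apply, lift_dt, smul_zero]

theorem tele_congr {M : Type*} [AddCommGroup M] {h h' : ℤ → M} {N : ℕ}
    (hh : ∀ j : ℤ, -N ≤ j → j < N → h j = h' j) {k : ℤ} (h₁ : -N ≤ k) (h₂ : k ≤ N) :
    tele h k = tele h' k := by
  rcases k with n | n
  · refine Finset.sum_congr rfl fun i hi => hh _ (by omega) ?_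
    have := Finset.mem_range.1 hi
    have : (n : ℤ) ≤ N := h₂
    omega
  · refine congrArg Neg.neg (Finset.sum_congr rfl fun i hi => hh _ ?_ (by omega))
    have := Finset.mem_range.1 hi
    have : -(N : ℤ) ≤ -((n : ℤ) + 1) := h₁
    omega

/-- The field `∂/∂t_i` in terms of the fields `∂/∂τ_j` and `X̃`. -/
theorem partialVF_t_eq (i : ℤ) : partialVF 𝕜 (DynVar.t i) =
    lift (partialVF 𝕜 i) + ((-1 : Fn 𝕜 DynVar) • lift (partialVF 𝕜 (i - 1)) +
      (if i = 0 then 1 else 0 : Fn 𝕜 DynVar) • Xtilde 𝕜) := by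
  refine (formal_partialVF _).ext_dyn ((formal_lift _).add (((formal_lift _).fsmul _).add
    (formal_Xtilde.fsmul _))) ?_ ?_ (fun j => ?_) (fun m => ?_)
  · simp only [Derivation.add_apply, Derivation.smul_apply, lift_x, Xtilde_x, partialVF_coord,
      smul_eq_mul]
    simp
  · simp only [Derivation.add_apply, Derivation.smul_apply, lift_t_zero, Xtilde_t, partialVF_coord,
      smul_eq_mul]
    simp
  · have h3 : Xtilde 𝕜 (pull (coord j)) = 0 := baseVF_pull_coord 2 j
    simp only [Derivation.add_apply, Derivation.smul_apply, lift_pull_coord, h3, smul_eq_mul]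
    rw [pull_coord, map_sub, partialVF_coord, partialVF_coord, partialVF_coord, partialVF_coord]
    have h4 : i - 1 = j ↔ i = j + 1 := sub_eq_iff_eq_add
    simp only [DynVar.t.injEq, h4]
    split_ifs <;> simp
  · simp only [Derivation.add_apply, Derivation.smul_apply, lift_dt, Xtilde_dt, partialVF_coord,
      smul_eq_mul]
    simp

/-- If the lifts of `S₀, S₁, P_k, Q_{2k}` annihilate a function of finitely many variables, then so
does a multiple of every `∂/∂τ_i`: the rows of coefficients of these fields are independent, and
some combination of the fields has `∂/∂τ_i` as its only component in a given finite window. -/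
theorem exists_smul_lift_partialVF_mem {α : 𝕜} (hα : α ≠ 0) {U : Set (DynVar → 𝕜)}
    {F : (DynVar → 𝕜) → 𝕜} {s : Finset DynVar}
    (h : ∀ x, lift (tauBasis α x) ∈ annihilator U F s) (i : ℤ) :
    ∃ d : Fn 𝕜 DynVar, d ≠ 0 ∧ d • lift (partialVF 𝕜 i) ∈ annihilator U F s := by
  classical
  -- The window `[-N, N]` contains `i`, `i + 1` and all `k` for which `F` depends on `t_k`.
  obtain ⟨N, hN⟩ : ∃ N : ℕ, ∀ k : ℤ, DynVar.t k ∈ insert (DynVar.t (i + 1)) (insert (DynVar.t i) s) →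
      -N ≤ k ∧ k ≤ N := by
    have hfin : {k : ℤ | DynVar.t k ∈ insert (DynVar.t (i + 1)) (insert (DynVar.t i) s)}.Finite :=
      (Finset.finite_toSet _).preimage (fun a _ b _ h => DynVar.t.inj h)
    obtain ⟨a, ha⟩ := hfin.bddAbove
    obtain ⟨b, hb⟩ := hfin.bddBelow
    exact ⟨(|a| + |b|).toNat, fun k hk => by
      have h1 := ha hk
      have h2 := hb hk
      have h3 := le_abs_self a
      have h4 := neg_abs_le b
      have h5 := abs_nonneg a
      have h6 := abs_nonneg b
      omega⟩
  have hi₁ := hN i (by simp)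
  have hi₂ := hN (i + 1) (by simp)
  let J := Finset.Ico (-(N : ℤ)) N
  obtain ⟨t, b, d, hd, hb⟩ := exists_left_inverse ((linearIndependent_rows_triCoeff hα).comp
    (fun j : J => (j : ℤ)) Subtype.val_injective)
  have hiJ : i ∈ J := Finset.mem_Ico.2 ⟨hi₁.1, by omega⟩
  let Y : VF 𝕜 ℤ := ∑ k ∈ t, b ⟨i, hiJ⟩ k • tri α (S₀ α) (S₁ α) k
  have hY : ∀ j ∈ J, Y (coord j) = if i = j then d else 0 := by
    intro j hj
    have h1 := hb ⟨i, hiJ⟩ ⟨j, hj⟩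
    rw [sum_apply_coord]
    refine h1.trans ?_
    simp only [Subtype.mk.injEq]
  have hYmem : lift Y ∈ annihilator U F s := by
    have h1 : lift Y = ∑ k ∈ t, pull (b ⟨i, hiJ⟩ k) • lift (tri α (S₀ α) (S₁ α) k) := by
      refine (map_sum (liftHom 𝕜) _ t).trans (Finset.sum_congr rfl fun k _ => ?_)
      exact lift_fsmul _ _
    rw [h1]
    refine Submodule.sum_mem _ fun k _ => Submodule.smul_mem _ _ ?_
    obtain ⟨x, rfl⟩ := exists_triIndex k
    rw [← tauBasis_eq]
    exact h x
  refine ⟨pull d, (map_ne_zero_iff _ pull_injective).2 hd, (formal_lift _).fsmul _, fun p hp => ?_⟩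
  rw [← hYmem.2 p hp]
  refine Finset.sum_congr rfl fun v hv => ?_
  have h1 : (pull d • lift (partialVF 𝕜 i)) (coord v) = lift Y (coord v) := by
    rw [← lift_fsmul]
    rcases v with _ | k | m
    · rw [lift_x, lift_x]
    · rw [lift_t, lift_t]
      refine congrArg Neg.neg (tele_congr (N := N) (fun j h₁ h₂ => ?_) (hN k (by simp [hv])).1
        (hN k (by simp [hv])).2)
      rw [hY j (Finset.mem_Ico.2 ⟨h₁, h₂⟩), Derivation.smul_apply, partialVF_coord, smul_eq_mul]
      split_ifs <;> simp
    · rw [lift_dt, lift_dt]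
  rw [h1]

/-- The multiples of `∂/∂τ_i` and `X̃` give multiples of `∂/∂t_i`; hence all partial derivatives of
an `x`-integral vanish. -/
theorem IsXIntegral.eq_const {α A₁ A₂ : 𝕜} (hα : α ≠ 0) (hA₁ : A₁ ≠ 0) (hA₂ : A₂ ≠ 0)
    {U : Set (DynVar → 𝕜)} {F : (DynVar → 𝕜) → 𝕜} (hU : IsOpen U) (hc : IsConnected U)
    (hF : IsXIntegral α A₁ A₂ U F) : ∃ c : 𝕜, ∀ p ∈ U, F p = c := by
  obtain ⟨s, hs⟩ := hF.1.exists_support hU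
  have hmem : ∀ x, basisLx α x ∈ annihilator U F s := fun x =>
    Lx_le_annihilator hU hF hs (by
      rw [← span_basisLx hα hA₁ hA₂]
      exact Submodule.subset_span ⟨x, rfl⟩)
  have hlift : ∀ x, lift (tauBasis α x) ∈ annihilator U F s := fun x => by
    rw [← basisLx_inr]
    exact hmem _
  refine hF.1.eq_const hU hc fun v => ?_
  rcases v with _ | i | m
  · exact (partialVF_mem_annihilator hs _).1 (hmem (Sum.inl 1))
  · obtain ⟨d₁, hd₁, h₁⟩ := exists_smul_lift_partialVF_mem hα hlift i
    obtain ⟨d₂, hd₂, h₂⟩ := exists_smul_lift_partialVF_mem hα hlift (i - 1)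
    have h3 : (d₁ * d₂) • partialVF 𝕜 (DynVar.t i) ∈ annihilator U F s := by
      have h4 : (d₁ * d₂) • partialVF 𝕜 (DynVar.t i) =
          d₂ • (d₁ • lift (partialVF 𝕜 i)) + ((-d₁) • (d₂ • lift (partialVF 𝕜 (i - 1))) +
            (d₁ * d₂ * (if i = 0 then 1 else 0) : Fn 𝕜 DynVar) • Xtilde 𝕜) := by
        rw [partialVF_t_eq]
        refine Derivation.ext fun G => ?_
        simp only [Derivation.add_apply, Derivation.smul_apply, smul_eq_mul]
        ring
      rw [h4]
      exact Submodule.add_mem _ (Submodule.smul_mem _ _ h₁)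
        (Submodule.add_mem _ (Submodule.smul_mem _ _ h₂)
          (Submodule.smul_mem _ _ (hmem (Sum.inl 2))))
    refine Fn.eq_zero_of_mul_eq_zero (mul_ne_zero hd₁ hd₂) hU (hF.1.pd hU _).continuousOn
      fun p hp => ?_
    have h5 := h3.2 p hp
    have h6 : ∀ v, (((d₁ * d₂) • partialVF 𝕜 (DynVar.t i)) (coord v)).1 p * pd v F p =
        if DynVar.t i = v then (d₁ * d₂).1 p * pd v F p else 0 := by
      intro v
      rw [Derivation.smul_apply, partialVF_coord, smul_eq_mul]
      split_ifs
      · rw [mul_one]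
      · rw [mul_zero]
        exact zero_mul _
    simp only [h6, Finset.sum_ite_eq] at h5
    split_ifs at h5 with hi
    · exact h5
    · rw [hs _ hi p hp, mul_zero]
  · exact pd_dt_eq_zero hU hF hs m

end Integral

/-! ### Reduction to the semi-discrete sine-Gordon model -/

section SineGordon

theorem hasDerivAt_rescale_iff {κ l c : ℂ} (hκ : κ ≠ 0) (hl : l ≠ 0) (f : ℂ → ℂ) (p x : ℂ) :
    HasDerivAt (fun x => κ * f (l * x) + c) (κ * (p * l)) x ↔ HasDerivAt f p (l * x) := by
  constructor
  · intro h
    have h1 : HasDerivAt (fun y : ℂ => l⁻¹ * y) l⁻¹ (l * x) := by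
      simpa using (hasDerivAt_id (l * x)).const_mul l⁻¹
    have h2 : l⁻¹ * (l * x) = x := by field_simp
    have h3 := (((h2.symm ▸ h).comp (l * x) h1).sub_const c).const_mul κ⁻¹
    refine (h3.congr_deriv ?_).congr_of_eventuallyEq (Filter.Eventually.of_forall fun y => ?_)
    · field_simp
    · simp only [Function.comp_apply]
      rw [mul_inv_cancel_left₀ hl, add_sub_cancel_right, inv_mul_cancel_left₀ hκ]
  · intro h
    have h1 : HasDerivAt (fun y : ℂ => l * y) l x := by
      simpa using (hasDerivAt_id x).const_mul l
    exact ((h.comp x h1).const_mul κ).add_const c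

/-- If `d` and `d'` correspond to each other, the substitution `t(n, x) = κ u(n, l x) + c` maps
solutions to solutions. -/
theorem solvesOn_rescale_iff {κ l c : ℂ} (hκ : κ ≠ 0) (hl : l ≠ 0) {d d' : ℂ → ℂ → ℂ}
    (hd : ∀ v w, d' (κ * v + c) (κ * w + c) = κ * (d v w * l)) (U : Set ℂ) (u : ℤ → ℂ → ℂ) :
    SolvesOn d U u ↔ SolvesOn d' {x | l * x ∈ U} (fun n x => κ * u n (l * x) + c) := by
  have key : ∀ n x, (∃ p, HasDerivAt (u n) p (l * x) ∧
      HasDerivAt (u (n + 1)) (p + d (u n (l * x)) (u (n + 1) (l * x))) (l * x)) ↔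
      ∃ p, HasDerivAt (fun x => κ * u n (l * x) + c) p x ∧
        HasDerivAt (fun x => κ * u (n + 1) (l * x) + c)
          (p + d' (κ * u n (l * x) + c) (κ * u (n + 1) (l * x) + c)) x := by
    intro n x
    constructor
    · rintro ⟨p, h1, h2⟩
      refine ⟨κ * (p * l), (hasDerivAt_rescale_iff hκ hl _ _ _).2 h1, ?_⟩
      rw [hd, ← mul_add, ← add_mul]
      exact (hasDerivAt_rescale_iff hκ hl _ _ _).2 h2
    · rintro ⟨p, h1, h2⟩
      obtain ⟨q, rfl⟩ : ∃ q, p = κ * (q * l) := ⟨p / (κ * l), by field_simp⟩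
      rw [hd, ← mul_add, ← add_mul] at h2
      exact ⟨q, (hasDerivAt_rescale_iff hκ hl _ _ _).1 h1, (hasDerivAt_rescale_iff hκ hl _ _ _).1 h2⟩
  constructor
  · intro h n x hx
    exact (key n x).1 (h n (l * x) hx)
  · intro h n y hy
    obtain ⟨x, rfl⟩ : ∃ x, y = l * x := ⟨y / l, by field_simp⟩
    exact (key n x).2 (h n x hy)

/-- With `e^{2αc} = -A₂ / A₁` the function `d` becomes a multiple of `sin v + sin w`. -/
theorem exists_rescale {α A₁ A₂ : ℂ} (hα : α ≠ 0) (hA₁ : A₁ ≠ 0) (hA₂ : A₂ ≠ 0) :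
    ∃ κ l c : ℂ, κ ≠ 0 ∧ l ≠ 0 ∧ ∀ v w, dC α A₁ A₂ (κ * v + c) (κ * w + c) =
      κ * ((Complex.sin v + Complex.sin w) * l) := by
  obtain ⟨c, hc⟩ : ∃ c : ℂ, Complex.exp (α * c) * Complex.exp (α * c) = -A₂ / A₁ := by
    refine ⟨Complex.log (-A₂ / A₁) / (2 * α), ?_⟩
    rw [← Complex.exp_add]
    have h : α * (Complex.log (-A₂ / A₁) / (2 * α)) + α * (Complex.log (-A₂ / A₁) / (2 * α)) =
        Complex.log (-A₂ / A₁) := by field_simp; ring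
    rw [h, Complex.exp_log (div_ne_zero (neg_ne_zero.2 hA₂) hA₁)]
  have he := Complex.exp_ne_zero (α * c)
  have hA : A₂ = -A₁ * (Complex.exp (α * c) * Complex.exp (α * c)) := by
    rw [hc]; field_simp
  refine ⟨Complex.I / α, 2 * α * A₁ * Complex.exp (α * c), c, div_ne_zero Complex.I_ne_zero hα,
    mul_ne_zero (mul_ne_zero (mul_ne_zero two_ne_zero hα) hA₁) he, fun v w => ?_⟩
  have h1 : ∀ v, Complex.exp (α * (Complex.I / α * v + c)) =
      Complex.exp (v * Complex.I) * Complex.exp (α * c) := fun v => by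
    rw [← Complex.exp_add]
    congr 1
    field_simp
  have h2 : ∀ v, Complex.exp (-(α * (Complex.I / α * v + c))) * Complex.exp (α * c) =
      Complex.exp (-v * Complex.I) := fun v => by
    rw [← Complex.exp_add]
    congr 1
    field_simp
    ring
  have h3 : dC α A₁ A₂ (Complex.I / α * v + c) (Complex.I / α * w + c) =
      A₁ * Complex.exp (α * c) * (Complex.exp (w * Complex.I) + Complex.exp (v * Complex.I) -
        Complex.exp (-v * Complex.I) - Complex.exp (-w * Complex.I)) := by
    rw [dC, h1, h1, ← h2 v, ← h2 w]
    linear_combination (Complex.exp (-(α * (Complex.I / α * v + c))) +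
      Complex.exp (-(α * (Complex.I / α * w + c)))) * hA
  rw [h3, Complex.sin, Complex.sin]
  field_simp
  ring_nf
  simp only [Complex.I_sq]
  ring

theorem map_ne_zero_of_ne_zero {𝕜 : Type*} [RCLike 𝕜] {a : 𝕜} (ha : a ≠ 0) :
    RCLike.map 𝕜 ℂ a ≠ 0 := by
  intro h
  refine ha (RCLike.ext ?_ ?_)
  · simpa using congrArg Complex.re h
  · simpa using congrArg Complex.im h

end SineGordon

end DarbouxChain

theorem mainTheorem3 {𝕜 : Type*} [RCLike 𝕜] (α A₁ A₂ : 𝕜) (hα : α ≠ 0) (hA₁ : A₁ ≠ 0)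
    (hA₂ : A₂ ≠ 0) :
    -- the chain is reduced by `t(n, x) = κ u(n, l x) + c` to the semi-discrete sine-Gordon
    -- model `u_{1x} = u_x + sin u + sin u_1`
    (∃ κ l c : ℂ, κ ≠ 0 ∧ l ≠ 0 ∧ ∀ (U : Set ℂ) (u : ℤ → ℂ → ℂ),
      SolvesOn (fun v w => Complex.sin v + Complex.sin w) U u ↔
        SolvesOn (dC (RCLike.map 𝕜 ℂ α) (RCLike.map 𝕜 ℂ A₁) (RCLike.map 𝕜 ℂ A₂))
          {x | l * x ∈ U} (fun n x => κ * u n (l * x) + c)) ∧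
    -- `S₀`, `S₁` and the characteristic Lie algebra
    (K₀ α A₁ A₂ = partialVF 𝕜 DynVar.x + (coord (DynVar.dt 0) : Fn 𝕜 DynVar) • Xtilde 𝕜
        - (A₁ • eT α) • lift (S₀ α)
        - (A₂ • eT (-α)) • lift (S₁ α)) ∧
    eT α • lift (S₀ α) ∈ Lx α A₁ A₂ ∧
    eT (-α) • lift (S₁ α) ∈ Lx α A₁ A₂ ∧
    -- the first shift conjugates
    conj (S₀ α) = eTau α • S₀ α ∧
    conj (S₁ α) = eTau (-α) • S₁ α ∧
    conj (P α 1) = P α 1 - (2 * α) • (S₀ α + S₁ α) ∧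
    conj (P α 2) = eTau (-α) •
      (P α 2 + (2 * α) • P α 1 - (2 * α ^ 2) • (S₀ α + S₁ α)) ∧
    conj (Q α 2) = eTau α •
      (Q α 2 - (2 * α) • P α 1 + (2 * α ^ 2) • (S₀ α + S₁ α)) ∧
    ⁅S₁ α, P α 2⁆ = -α • P α 2 ∧
    ⁅S₀ α, Q α 2⁆ = α • Q α 2 ∧
    -- the recursions
    (∀ n : ℕ, 1 ≤ n →
      conj (P α (2 * n + 1)) + ((2 * α) • eTau α) • conj (P α (2 * n))
        = P α (2 * n + 1) + (2 * α) • Q α (2 * n) ∧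
      eTau α • conj (P α (2 * n + 2)) - α • conj (P α (2 * n + 1))
        = P α (2 * n + 2) + α • Q α (2 * n + 1) ∧
      conj (Q α (2 * n + 1)) - ((2 * α) • eTau (-α)) • conj (Q α (2 * n))
        = Q α (2 * n + 1) - (2 * α) • P α (2 * n) ∧
      eTau (-α) • conj (Q α (2 * n + 2)) + α • conj (Q α (2 * n + 1))
        = Q α (2 * n + 2) - α • P α (2 * n + 1) ∧
      P α (2 * n + 1) = Q α (2 * n + 1) ∧
      ⁅S₁ α, P α (2 * n + 2)⁆ = -α • P α (2 * n + 2) ∧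
      ⁅S₀ α, Q α (2 * n + 2)⁆ = α • Q α (2 * n + 2)) ∧
    -- the coefficients before `∂/∂τ` vanish
    (∀ k : ℕ, 1 ≤ k → conj (P α k) (coord 0) = 0 ∧ conj (Q α k) (coord 0) = 0) ∧
    -- the triangular form of the shift conjugates
    (∀ n : ℕ, 1 ≤ n →
      eTau (-α) • conj (Q α (2 * n)) + eTau α • conj (P α (2 * n))
        = Q α (2 * n) + P α (2 * n)) ∧
    (∃ μ ν : ℕ → ℕ → 𝕜,
      (∀ n : ℕ,
        conj (P α (2 * n + 1)) = P α (2 * n + 1)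
          + ∑ k ∈ Finset.Icc 1 n,
              (μ (2 * n + 1) (2 * k) • P α (2 * k) + ν (2 * n + 1) (2 * k) • Q α (2 * k))
          + ∑ k ∈ Finset.range n, μ (2 * n + 1) (2 * k + 1) • P α (2 * k + 1)
          + μ (2 * n + 1) 0 • S₀ α + ν (2 * n + 1) 0 • S₁ α) ∧
      (∀ n : ℕ, 1 ≤ n →
        conj (P α (2 * n)) = eTau (-α) • (P α (2 * n)
          + ∑ k ∈ Finset.Icc 1 (n - 1),
              (μ (2 * n) (2 * k) • P α (2 * k) + ν (2 * n) (2 * k) • Q α (2 * k))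
          + ∑ k ∈ Finset.range n, μ (2 * n) (2 * k + 1) • P α (2 * k + 1)
          + μ (2 * n) 0 • S₀ α + ν (2 * n) 0 • S₁ α) ∧
        conj (Q α (2 * n)) = eTau α • (Q α (2 * n)
          - ∑ k ∈ Finset.Icc 1 (n - 1),
              (μ (2 * n) (2 * k) • P α (2 * k) + ν (2 * n) (2 * k) • Q α (2 * k))
          - ∑ k ∈ Finset.range n, μ (2 * n) (2 * k + 1) • P α (2 * k + 1)
          - μ (2 * n) 0 • S₀ α - ν (2 * n) 0 • S₁ α) ∧
        μ (2 * n + 1) (2 * n) = -2 * α ∧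
        ν (2 * n + 1) (2 * n) = 2 * α ∧
        μ (2 * n) (2 * n - 1) = 2 * α)) ∧
    -- the space `V_n` of commutators of multiplicity at most `n`: basis and linear growth
    (∀ n : ℕ, LinearIndependent 𝕜 (basisV α n) ∧ FnIndep (basisV α n) ∧
      Submodule.span 𝕜 (Set.range (basisV α n)) = V α n ∧
      Module.finrank 𝕜 (V α n) = 2 + n + n / 2) ∧
    -- the characteristic Lie algebra: basis over functions and infinite dimension
    FnIndep (basisLx α) ∧
    Submodule.span (Fn 𝕜 DynVar) (Set.range (basisLx α)) =
      Submodule.span (Fn 𝕜 DynVar) (Lx α A₁ A₂ : Set (VF 𝕜 DynVar)) ∧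
    InfiniteDim (Lx α A₁ A₂) ∧
    ¬ FiniteDimensional 𝕜 (Lx α A₁ A₂) ∧
    -- there is no nontrivial `x`-integral
    (∀ (U : Set (DynVar → 𝕜)) (F : (DynVar → 𝕜) → 𝕜), IsOpen U → IsConnected U →
      IsXIntegral α A₁ A₂ U F → ∃ c : 𝕜, ∀ p ∈ U, F p = c) := by
  refine ⟨?_, K₀_eq α A₁ A₂, (eT_smul_lift_mem hα hA₁ hA₂).1, (eT_smul_lift_mem hα hA₁ hA₂).2,
    conj_S₀ α, conj_S₁ α, conj_P_one α, conj_P_two α, conj_Q_two α, lie_S₁_P_even α 0,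
    lie_S₀_Q_even α 0, conj_recursions α,
    fun k _ => ⟨conj_coord_zero (P_mem α k), conj_coord_zero (Q_mem α k)⟩,
    conj_Q_add_conj_P α, exists_conj_coefficients α,
    fun n => ⟨linearIndependent_of_coeffs (linearIndependent_coeffs_basisV hα n),
      fnIndep_of_linearIndependent (linearIndependent_coeffs_basisV hα n), span_basisV α n,
      finrank_V hα n⟩,
    fnIndep_of_linearIndependent (linearIndependent_basisLx hα), span_basisLx hα hA₁ hA₂,
    infiniteDim_Lx hα hA₁ hA₂, not_finiteDimensional_Lx hα hA₁ hA₂,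
    fun U F hU hc hF => hF.eq_const hα hA₁ hA₂ hU hc⟩
  obtain ⟨κ, l, c, hκ, hl, h⟩ := exists_rescale (map_ne_zero_of_ne_zero hα)
    (map_ne_zero_of_ne_zero hA₁) (map_ne_zero_of_ne_zero hA₂)
  exact ⟨κ, l, c, hκ, hl, fun U u => solvesOn_rescale_iff hκ hl h U u⟩
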